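/- Let $(M,g)$ be a connected smooth 4-dimensional manifold with a smooth Lorentzian metric (signature $(-,+,+,+)$) that is Einstein, i.e. $R_{ab}=\Lambda g_{ab}$ for some function $\Lambda$, and suppose that its Weyl tensor $C_{abcd}$ is not identically zero. Let $Y$ be a smooth conformal Killing–Yano 3-form, i.e. a 3-form such that $$\nabla_aY_{bcd}+\nabla_bY_{acd}=2g_{a[b}h_{cd]}+2g_{b[a}h_{cd]}$$ for some 2-form $h$, where $\nabla$ is the Levi-Civita connection and square brackets denote antisymmetrization with weight $1/3!$. Suppose that the divergence $(\operatorname{div}Y)_{bc}=\nabla^aY_{abc}$ (a constant multiple of $h_{bc}$) is not identically zero. Let $\xi$ be the vector dual to $Y$, $\xi_d=\tfrac1{3!}Y_{abc}\,\epsilon^{abc}{}_d$, where $\epsilon$ is a local volume form of $g$ (unique up to sign). Then the following are equivalent: 1. $A=\operatorname{div}Y$ is a Killing–Yano 2-form: $\nabla_aA_{bc}+\nabla_bA_{ac}=0$ on $M$. 2. At every point of $M$ at which the Weyl tensor does not vanish (hence at every point of $M$, if the Weyl tensor vanishes nowhere), the Weyl tensor is of Petrov type N and $\xi$ is a nonzero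 null vector spanning its repeated principal null direction. Here a null tetrad $(l,k,m,\bar m)$ has $l,k$ real, $m$ complex, $l\cdot k=-1$, $m\cdot\bar m=1$ and all other products zero. With $\Psi_0=C(l,m,l,m)$, $\Psi_1=C(l,k,l,m)$, $\Psi_2=C(l,m,\bar m,k)$, $\Psi_3=C(l,k,\bar m,k)$, $\Psi_4=C(k,\bar m,k,\bar m)$, the Weyl tensor is of Petrov type N at a point if some null tetrad there has $\Psi_0=\Psi_1=\Psi_2=\Psi_3=0\neq\Psi_4$, and $l$ spans a repeated principal null direction if $\Psi_0=\Psi_1=0$ in a null tetrad with first vector $l$. -/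

import Mathlib

open scoped Manifold ContDiff

noncomputable section

namespace CKY

/-! ### Tensor calculus in a coordinate domain of `ℝⁿ` -/

/-- The coordinate space `ℝⁿ`. -/
abbrev Coord (n : ℕ) := EuclideanSpace ℝ (Fin n)

/-- The partial derivative `∂ₐ f` at `u`. -/
def pderiv {n : ℕ} (a : Fin n) (f : Coord n → ℝ) (u : Coord n) : ℝ :=
  fderiv ℝ f u (EuclideanSpace.single a 1)

section Local

variable {n : ℕ} (G : Coord n → Matrix (Fin n) (Fin n) ℝ)

/-- Christoffel symbols `Γᵈₐᵦ` of the metric `G` (Levi-Civita connection). -/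
def christoffel (u : Coord n) (d a b : Fin n) : ℝ :=
  (1 / 2) * ∑ e, (G u)⁻¹ d e *
    (pderiv a (fun v => G v e b) u + pderiv b (fun v => G v e a) u - pderiv e (fun v => G v a b) u)

/-- The curvature components `Rᵈ_{cab}`, that is
`∂ₐ Γᵈ_{bc} - ∂_b Γᵈ_{ac} + Γᵈ_{ae} Γᵉ_{bc} - Γᵈ_{be} Γᵉ_{ac}`. -/
def riemannUp (u : Coord n) (d c a b : Fin n) : ℝ :=
  pderiv a (fun v => christoffel G v d b c) u - pderiv b (fun v => christoffel G v d a c) u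
    + ∑ e, (christoffel G u d a e * christoffel G u e b c
        - christoffel G u d b e * christoffel G u e a c)

/-- The Riemann tensor with all indices down, `R_{abcd} = g_{ae} Rᵉ_{bcd}`. -/
def riemann (u : Coord n) (a b c d : Fin n) : ℝ :=
  ∑ e, G u a e * riemannUp G u e b c d

/-- The Ricci tensor `R_{ab} = Rᶜ_{acb}`. -/
def ricci (u : Coord n) (a b : Fin n) : ℝ :=
  ∑ c, riemannUp G u c a c b

/-- The Ricci scalar `gᵃᵇ R_{ab}`. -/
def scalarCurv (u : Coord n) : ℝ :=
  ∑ a, ∑ b, (G u)⁻¹ a b * ricci G u a b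

/-- The Weyl tensor with all indices down (used for `n ≥ 3`). -/
def weyl (u : Coord n) (a b c d : Fin n) : ℝ :=
  riemann G u a b c d
    - (1 / ((n : ℝ) - 2)) *
        (G u a c * ricci G u b d - G u a d * ricci G u b c
          + G u b d * ricci G u a c - G u b c * ricci G u a d)
    + (scalarCurv G u / (((n : ℝ) - 1) * ((n : ℝ) - 2))) *
        (G u a c * G u b d - G u a d * G u b c)

/-- The components `∇ₐ T_{i₁ ⋯ iₚ}` of the covariant derivative of a covariant tensor. -/
def covDeriv {p : ℕ} (T : Coord n → (Fin p → Fin n) → ℝ) (u : Coord n) (a : Fin n)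
    (I : Fin p → Fin n) : ℝ :=
  pderiv a (fun v => T v I) u
    - ∑ k : Fin p, ∑ d, christoffel G u d a (I k) * T u (Function.update I k d)

/-- The divergence `∇ᵃ T_{a i₂ ⋯ iₚ}` (contraction on the first index). -/
def localDivergence {q : ℕ} (T : Coord n → (Fin (q + 1) → Fin n) → ℝ) (u : Coord n)
    (B : Fin q → Fin n) : ℝ :=
  ∑ a, ∑ c, (G u)⁻¹ a c * covDeriv G T u a (Fin.cons c B)

end Local

/-- Total skew-symmetry of an array of components. -/
def IsSkew {n p : ℕ} (T : (Fin p → Fin n) → ℝ) : Prop :=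
  ∀ (σ : Equiv.Perm (Fin p)) (I : Fin p → Fin n),
    T (I ∘ σ) = ((Equiv.Perm.sign σ : ℤ) : ℝ) * T I

/-- The total antisymmetrization `T_{[i₁ ⋯ iₚ]}`, with the factor `1 / p!`. -/
def alternate {n p : ℕ} (T : (Fin p → Fin n) → ℝ) (I : Fin p → Fin n) : ℝ :=
  (1 / (p.factorial : ℝ)) *
    ∑ σ : Equiv.Perm (Fin p), ((Equiv.Perm.sign σ : ℤ) : ℝ) * T (I ∘ σ)

/-! ### Algebra at a point of a four-dimensional Lorentzian manifold -/

section Pointwise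

variable (G : Matrix (Fin 4) (Fin 4) ℝ)

/-- The volume form `ε_{abcd} = √|det g| [abcd]`, for the orientation of the coordinates;
here `[abcd]` is the Levi-Civita symbol, with `[0123] = 1`. -/
def volumeForm (I : Fin 4 → Fin 4) : ℝ :=
  Real.sqrt |G.det| * (Matrix.of fun i j : Fin 4 => if I i = j then (1 : ℝ) else 0).det

/-- The Hodge dual `(1/3!) Y_{abc} εᵃᵇᶜ_d` of a 3-form, with its index raised to
give a vector. -/
def hodgeDual (Y : (Fin 3 → Fin 4) → ℝ) (e : Fin 4) : ℝ :=
  ∑ d, G⁻¹ e d * ((1 / 6) * ∑ a, ∑ b, ∑ c, Y ![a, b, c] *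
    ∑ a', ∑ b', ∑ c', G⁻¹ a a' * G⁻¹ b b' * G⁻¹ c c' * volumeForm G ![a', b', c', d])

/-- The complex bilinear extension of the metric. -/
def cdot (v w : Fin 4 → ℂ) : ℂ :=
  ∑ a, ∑ b, (G a b : ℂ) * v a * w b

/-- The complex multilinear extension of a tensor with four indices. -/
def ceval (C : Fin 4 → Fin 4 → Fin 4 → Fin 4 → ℝ) (v w x y : Fin 4 → ℂ) : ℂ :=
  ∑ a, ∑ b, ∑ c, ∑ d, (C a b c d : ℂ) * v a * w b * x c * y d

/-- A real vector seen as a complex one. -/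
def toC (v : Fin 4 → ℝ) : Fin 4 → ℂ := fun a => (v a : ℂ)

/-- The complex conjugate vector. -/
def conjV (v : Fin 4 → ℂ) : Fin 4 → ℂ := fun a => (starRingEnd ℂ) (v a)

/-- A null tetrad `(l, k, m, m̄)` for a metric of signature `(-,+,+,+)`: `l` and `k` are real,
`m` is complex, and the only nonzero products are `l·k = -1` and `m·m̄ = 1`. -/
structure IsNullTetrad (l k : Fin 4 → ℝ) (m : Fin 4 → ℂ) : Prop where
  ll : cdot G (toC l) (toC l) = 0
  kk : cdot G (toC k) (toC k) = 0
  mm : cdot G m m = 0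
  lm : cdot G (toC l) m = 0
  km : cdot G (toC k) m = 0
  lk : cdot G (toC l) (toC k) = -1
  mmbar : cdot G m (conjV m) = 1

variable (C : Fin 4 → Fin 4 → Fin 4 → Fin 4 → ℝ)

/-- The Weyl scalar `Ψ₀ = C(l, m, l, m)`. -/
def Psi0 (l : Fin 4 → ℝ) (m : Fin 4 → ℂ) : ℂ := ceval C (toC l) m (toC l) m

/-- The Weyl scalar `Ψ₁ = C(l, k, l, m)`. -/
def Psi1 (l k : Fin 4 → ℝ) (m : Fin 4 → ℂ) : ℂ := ceval C (toC l) (toC k) (toC l) m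

/-- The Weyl scalar `Ψ₂ = C(l, m, m̄, k)`. -/
def Psi2 (l k : Fin 4 → ℝ) (m : Fin 4 → ℂ) : ℂ := ceval C (toC l) m (conjV m) (toC k)

/-- The Weyl scalar `Ψ₃ = C(l, k, m̄, k)`. -/
def Psi3 (l k : Fin 4 → ℝ) (m : Fin 4 → ℂ) : ℂ := ceval C (toC l) (toC k) (conjV m) (toC k)

/-- The Weyl scalar `Ψ₄ = C(k, m̄, k, m̄)`. -/
def Psi4 (k : Fin 4 → ℝ) (m : Fin 4 → ℂ) : ℂ := ceval C (toC k) (conjV m) (toC k) (conjV m)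

/-- Petrov type N: in some null tetrad, `Ψ₄` is the only nonzero Weyl scalar. -/
def IsPetrovTypeN : Prop :=
  ∃ (l k : Fin 4 → ℝ) (m : Fin 4 → ℂ), IsNullTetrad G l k m ∧
    Psi0 C l m = 0 ∧ Psi1 C l k m = 0 ∧ Psi2 C l k m = 0 ∧ Psi3 C l k m = 0 ∧ Psi4 C k m ≠ 0

/-- The nonzero null vector `l` spans a repeated principal null direction (multiplicity at
least two): `Ψ₀ = Ψ₁ = 0` in a null tetrad whose first vector is `l`. -/
def IsRepeatedPND (l : Fin 4 → ℝ) : Prop :=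
  ∃ (k : Fin 4 → ℝ) (m : Fin 4 → ℂ), IsNullTetrad G l k m ∧ Psi0 C l m = 0 ∧ Psi1 C l k m = 0

end Pointwise

/-! ### Tensors on manifolds, through their components in all charts -/

section Manifold

variable {n : ℕ} {M : Type*} [TopologicalSpace M] [ChartedSpace (Coord n) M]

/-- The coordinate vector `∂ᵢ` of the chart `e`, at the point with coordinates `u`. -/
def coordVec (e : OpenPartialHomeomorph M (Coord n)) (u : Coord n) (i : Fin n) :
    TangentSpace (𝓡 n) (e.symm u) :=
  mfderiv 𝓘(ℝ, Coord n) (𝓡 n) e.symm u (EuclideanSpace.single i (1 : ℝ) : Coord n)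

variable (n M) in
/-- A smooth Lorentzian metric, of signature `(-,+,…,+)`. -/
structure LorentzianMetric [IsManifold (𝓡 n) ∞ M] where
  /-- The inner product on each tangent space. -/
  val : ∀ x : M, TangentSpace (𝓡 n) x →L[ℝ] TangentSpace (𝓡 n) x →L[ℝ] ℝ
  symm : ∀ x v w, val x v w = val x w v
  lorentzian : ∀ x : M, ∃ b : Module.Basis (Fin n) ℝ (TangentSpace (𝓡 n) x),
    ∀ i j, val x (b i) (b j) = if i = j then (if (i : ℕ) = 0 then -1 else 1) else 0
  smooth : ∀ e ∈ IsManifold.maximalAtlas (𝓡 n) ∞ M, ∀ i j : Fin n,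
    ContDiffOn ℝ ∞ (fun u => val (e.symm u) (coordVec e u i) (coordVec e u j)) e.target

/-- The components of covariant tensors of rank `p` in all charts, as functions of the
coordinates; only charts of the atlas and points of their targets are relevant. -/
abbrev Components (n p : ℕ) (M : Type*) [TopologicalSpace M] :=
  OpenPartialHomeomorph M (Coord n) → Coord n → (Fin p → Fin n) → ℝ

/-- A differential `p`-form on `M` (not assumed smooth). -/
abbrev FormField (n p : ℕ) (M : Type*) [TopologicalSpace M] [ChartedSpace (Coord n) M] :=
  ∀ x : M, TangentSpace (𝓡 n) x [⋀^Fin p]→L[ℝ] ℝ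

/-- The components `Y(∂_{i₁}, …, ∂_{iₚ})` of a differential form. -/
def FormField.comp {p : ℕ} (Y : FormField n p M) : Components n p M :=
  fun e u I => Y (e.symm u) (fun k => coordVec e u (I k))

variable [IsManifold (𝓡 n) ∞ M]

/-- Smoothness of a differential form. -/
def FormField.IsSmooth {p : ℕ} (Y : FormField n p M) : Prop :=
  ∀ e ∈ IsManifold.maximalAtlas (𝓡 n) ∞ M, ∀ I, ContDiffOn ℝ ∞ (fun u => Y.comp e u I) e.target

namespace LorentzianMetric

variable (g : LorentzianMetric n M)

/-- The matrix `g_{ij}` of the metric in a chart. -/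
def mat (e : OpenPartialHomeomorph M (Coord n)) (u : Coord n) : Matrix (Fin n) (Fin n) ℝ :=
  Matrix.of fun i j => g.val (e.symm u) (coordVec e u i) (coordVec e u j)

/-- Einstein manifold: the Ricci tensor is proportional to the metric. -/
def IsEinstein : Prop :=
  ∃ Λ : M → ℝ, ∀ e ∈ IsManifold.maximalAtlas (𝓡 n) ∞ M, ∀ u ∈ e.target, ∀ a b,
    ricci (g.mat e) u a b = Λ (e.symm u) * g.mat e u a b

/-- The divergence `∇ᵃ Y_{a b₂ ⋯ bₚ}`. -/
def divergence {q : ℕ} (Y : Components n (q + 1) M) : Components n q M :=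
  fun e => localDivergence (g.mat e) (Y e)

/-- Conformal Killing–Yano tensor of order `p = q + 1`: a skew-symmetric tensor with
`∇ₐ Y_{b₁ b₂ ⋯ bₚ} + ∇_{b₁} Y_{a b₂ ⋯ bₚ} = 2 g_{a[b₁} h_{b₂ ⋯ bₚ]} + 2 g_{b₁[a} h_{b₂ ⋯ bₚ]}`
for some skew-symmetric `h`. -/
def IsConformalKillingYano {q : ℕ} (Y : Components n (q + 1) M) : Prop :=
  ∃ h : Components n q M, ∀ e ∈ IsManifold.maximalAtlas (𝓡 n) ∞ M, ∀ u ∈ e.target,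
    IsSkew (Y e u) ∧ IsSkew (h e u) ∧ ∀ (a b : Fin n) (B : Fin q → Fin n),
      covDeriv (g.mat e) (Y e) u a (Fin.cons b B) + covDeriv (g.mat e) (Y e) u b (Fin.cons a B)
        = 2 * alternate (fun I => g.mat e u a (I 0) * h e u (Fin.tail I)) (Fin.cons b B)
          + 2 * alternate (fun I => g.mat e u b (I 0) * h e u (Fin.tail I)) (Fin.cons a B)

/-- Killing–Yano tensor of order `p = q + 1`: the same equation with `h = 0`. -/
def IsKillingYano {q : ℕ} (A : Components n (q + 1) M) : Prop :=
  ∀ e ∈ IsManifold.maximalAtlas (𝓡 n) ∞ M, ∀ u ∈ e.target,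
    IsSkew (A e u) ∧ ∀ (a b : Fin n) (B : Fin q → Fin n),
      covDeriv (g.mat e) (A e) u a (Fin.cons b B)
        + covDeriv (g.mat e) (A e) u b (Fin.cons a B) = 0

end LorentzianMetric

end Manifold

end CKY

end

/-! The vector `ξ` dual to a conformal Killing–Yano 3-form is a conformal Killing field, with
divergence `4 φ`. Its second derivative is therefore determined: `∇_c ∇_a ξ_b = R_{dcab} ξ^d + φ_a
g_{cb} - φ_b g_{ca} + φ_c g_{ab}`, where `φ_a = ∂_a φ`. For an Einstein metric the Riemann tensor is
the Weyl tensor plus a constant-curvature term, and the latter only replaces `φ_a` by `θ_a = φ_a +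
(Λ/3) ξ_a` in the part skew in `a, b`. That part is thus `C_{dcab} ξ^d` plus a pure trace. Since
`div Y` is the Hodge dual of the skew part of `∇ξ`, and a 2-form is Killing–Yano exactly when the
derivative of its dual is pure trace, condition 1 is equivalent to `C_{abcd} ξ^d = 0` everywhere
(`divergence_killingYano_iff`).

The rest of the equivalence is mostly algebra at a point. A nonzero Weyl tensor is annihilated by
null vectors only, because its left and right duals agree (`IsWeyl.null_of_inKer`). In a null frame
starting with such a nonzero vector only `Ψ₄` survives (`IsWeyl.typeN_of_inKer`). Conversely, for
type N, vanishing of `Ψ₀` and `Ψ₁` along `ξ` makes `C(ξ, v, ξ, w)` a multiple of `(ξ·v)(ξ·w)`, which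
forces `ξ` to be proportional to the vector that annihilates `C` (`IsWeyl.inKer_of_typeN`).

What remains is that `ξ` has no zero where `C ≠ 0`. At such a zero, one derivative of `C·ξ = 0`
gives `∇ξ = 0`, and two give `θ = 0` (`jet_eq_zero_of_weyl_ne`). When `C·ξ = 0` the triple `(ξ, ∇ξ,
θ)` has first derivatives bounded by itself, so by Grönwall it vanishes near the point
(`jet_eventually_eq_zero`). Connectedness then gives `Y = 0` (`eq_zero_of_eventually_eq_zero`),
against `div Y ≠ 0`. -/

noncomputable section

namespace CKY

/-! ### Partial derivatives of scalar and matrix-valued functions. -/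

section Calculus

variable {n : ℕ} {U : Set (Coord n)} {u : Coord n} {f g : Coord n → ℝ} {a b : Fin n}

theorem differentiableAt_of_contDiffOn (hU : IsOpen U) (hf : ContDiffOn ℝ ∞ f U) (hu : u ∈ U) :
    DifferentiableAt ℝ f u :=
  (hf.contDiffAt (hU.mem_nhds hu)).differentiableAt (by simp)

theorem pderiv_contDiffOn (hU : IsOpen U) (hf : ContDiffOn ℝ ∞ f U) (a : Fin n) :
    ContDiffOn ℝ ∞ (pderiv a f) U :=
  (hf.fderiv_of_isOpen hU (m := ∞) (by simp)).clm_apply contDiffOn_const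

theorem pderiv_add (hf : DifferentiableAt ℝ f u) (hg : DifferentiableAt ℝ g u) :
    pderiv a (fun v => f v + g v) u = pderiv a f u + pderiv a g u := by
  simp only [pderiv]; rw [fderiv_fun_add hf hg]; rfl

theorem pderiv_sub (hf : DifferentiableAt ℝ f u) (hg : DifferentiableAt ℝ g u) :
    pderiv a (fun v => f v - g v) u = pderiv a f u - pderiv a g u := by
  simp only [pderiv]; rw [fderiv_fun_sub hf hg]; rfl

theorem pderiv_neg : pderiv a (fun v => -f v) u = -pderiv a f u := by
  simp only [pderiv]; rw [fderiv_fun_neg]; rfl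

theorem pderiv_mul (hf : DifferentiableAt ℝ f u) (hg : DifferentiableAt ℝ g u) :
    pderiv a (fun v => f v * g v) u = pderiv a f u * g u + f u * pderiv a g u := by
  simp only [pderiv]; rw [fderiv_fun_mul hf hg]; simp; ring

theorem pderiv_const_mul (c : ℝ) (hf : DifferentiableAt ℝ f u) :
    pderiv a (fun v => c * f v) u = c * pderiv a f u := by
  simp only [pderiv]; rw [fderiv_const_mul hf]; rfl

theorem pderiv_const (c : ℝ) : pderiv a (fun _ : Coord n => c) u = 0 := by
  simp [pderiv]

theorem pderiv_sum {ι : Type*} {s : Finset ι} {F : ι → Coord n → ℝ}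
    (hF : ∀ i ∈ s, DifferentiableAt ℝ (F i) u) :
    pderiv a (fun v => ∑ i ∈ s, F i v) u = ∑ i ∈ s, pderiv a (F i) u := by
  simp only [pderiv]; rw [fderiv_fun_sum hF]; simp

theorem pderiv_congr (hU : IsOpen U) (hu : u ∈ U) (h : ∀ v ∈ U, f v = g v) :
    pderiv a f u = pderiv a g u := by
  have : f =ᶠ[nhds u] g := Filter.eventually_of_mem (hU.mem_nhds hu) h
  simp only [pderiv, this.fderiv_eq]

theorem pderiv_comm (hU : IsOpen U) (hf : ContDiffOn ℝ ∞ f U) (hu : u ∈ U) :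
    pderiv a (pderiv b f) u = pderiv b (pderiv a f) u := by
  have hc : ContDiffAt ℝ ∞ f u := hf.contDiffAt (hU.mem_nhds hu)
  have hs := hc.isSymmSndFDerivAt (by
    simp only [minSmoothness_of_isRCLikeNormedField]; exact WithTop.coe_le_coe.2 (le_top : (2 : ℕ∞) ≤ ⊤))
  have hd : DifferentiableAt ℝ (fderiv ℝ f) u :=
    (hc.fderiv_right (m := ∞) (by simp)).differentiableAt (by simp)
  have key : ∀ c d : Fin n, pderiv c (pderiv d f) u
      = fderiv ℝ (fderiv ℝ f) u (EuclideanSpace.single c 1) (EuclideanSpace.single d 1) := by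
    intro c d
    have : pderiv d f = fun v => fderiv ℝ f v (EuclideanSpace.single d 1) := rfl
    rw [pderiv, this, fderiv_clm_apply hd (by fun_prop)]
    simp
  rw [key, key, hs.eq]

theorem differentiableAt_finset_prod {ι : Type*} {s : Finset ι} {F : ι → Coord n → ℝ}
    (hF : ∀ i ∈ s, DifferentiableAt ℝ (F i) u) :
    DifferentiableAt ℝ (fun v => ∏ i ∈ s, F i v) u := by
  classical
  exact (HasFDerivAt.finsetProd (u := s) (g := F)
    (fun i hi => (hF i hi).hasFDerivAt)).differentiableAt

theorem pderiv_finset_prod {ι : Type*} [DecidableEq ι] {s : Finset ι} {F : ι → Coord n → ℝ}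
    (hF : ∀ i ∈ s, DifferentiableAt ℝ (F i) u) :
    pderiv a (fun v => ∏ i ∈ s, F i v) u
      = ∑ i ∈ s, (∏ j ∈ s.erase i, F j u) * pderiv a (F i) u := by
  have := HasFDerivAt.finsetProd (u := s) (g := F) (fun i hi => (hF i hi).hasFDerivAt)
  simp only [pderiv]
  rw [this.fderiv]
  simp

/-- The entrywise partial derivative of a matrix-valued function. -/
def mpderiv {m k : Type*} (a : Fin n) (F : Coord n → Matrix m k ℝ) (u : Coord n) : Matrix m k ℝ :=
  Matrix.of fun i j => pderiv a (fun v => F v i j) u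

/-- Smoothness of a matrix-valued function on a set. -/
def MSmooth {m k : Type*} (F : Coord n → Matrix m k ℝ) (U : Set (Coord n)) : Prop :=
  ∀ i j, ContDiffOn ℝ ∞ (fun u => F u i j) U

variable {m k l : Type*} {F H : Coord n → Matrix m k ℝ}

@[simp] theorem mpderiv_apply (i : m) (j : k) :
    mpderiv a F u i j = pderiv a (fun v => F v i j) u := rfl

theorem MSmooth.diff (hU : IsOpen U) (hF : MSmooth F U) (hu : u ∈ U) (i : m) (j : k) :
    DifferentiableAt ℝ (fun u => F u i j) u :=
  differentiableAt_of_contDiffOn hU (hF i j) hu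

theorem mpderiv_add (hU : IsOpen U) (hF : MSmooth F U) (hH : MSmooth H U) (hu : u ∈ U) :
    mpderiv a (fun v => F v + H v) u = mpderiv a F u + mpderiv a H u := by
  ext i j; exact pderiv_add (hF.diff hU hu i j) (hH.diff hU hu i j)

theorem mpderiv_sub (hU : IsOpen U) (hF : MSmooth F U) (hH : MSmooth H U) (hu : u ∈ U) :
    mpderiv a (fun v => F v - H v) u = mpderiv a F u - mpderiv a H u := by
  ext i j; exact pderiv_sub (hF.diff hU hu i j) (hH.diff hU hu i j)

theorem mpderiv_transpose : mpderiv a (fun v => (F v).transpose) u = (mpderiv a F u).transpose :=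
  rfl

theorem mpderiv_smul (hU : IsOpen U) (hf : ContDiffOn ℝ ∞ f U) (hH : MSmooth H U) (hu : u ∈ U) :
    mpderiv a (fun v => f v • H v) u = pderiv a f u • H u + f u • mpderiv a H u := by
  ext i j; exact pderiv_mul (differentiableAt_of_contDiffOn hU hf hu) (hH.diff hU hu i j)

theorem mpderiv_mul [Fintype k] {P : Coord n → Matrix k l ℝ} (hU : IsOpen U) (hF : MSmooth F U)
    (hP : MSmooth P U) (hu : u ∈ U) :
    mpderiv a (fun v => F v * P v) u = mpderiv a F u * P u + F u * mpderiv a P u := by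
  ext i j
  simp only [mpderiv_apply, Matrix.mul_apply, Matrix.add_apply]
  rw [pderiv_sum (fun c _ => (hF.diff hU hu i c).fun_mul (hP.diff hU hu c j)),
    ← Finset.sum_add_distrib]
  exact Finset.sum_congr rfl fun c _ => pderiv_mul (hF.diff hU hu i c) (hP.diff hU hu c j)

theorem mpderiv_congr (hU : IsOpen U) (hu : u ∈ U) (h : ∀ v ∈ U, F v = H v) :
    mpderiv a F u = mpderiv a H u := by
  ext i j; exact pderiv_congr hU hu fun v hv => by rw [h v hv]

theorem mpderiv_comm (hU : IsOpen U) (hF : MSmooth F U) (hu : u ∈ U) :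
    mpderiv a (mpderiv b F) u = mpderiv b (mpderiv a F) u := by
  ext i j; exact pderiv_comm hU (hF i j) hu

theorem MSmooth.transpose (hF : MSmooth F U) : MSmooth (fun v => (F v).transpose) U :=
  fun i j => hF j i

theorem MSmooth.mul [Fintype k] {P : Coord n → Matrix k l ℝ} (hF : MSmooth F U)
    (hP : MSmooth P U) : MSmooth (fun v => F v * P v) U := by
  intro i j
  simp only [Matrix.mul_apply]
  exact ContDiffOn.sum fun c _ => (hF i c).mul (hP c j)

section Square

variable {m : Type*} [Fintype m] [DecidableEq m] {F : Coord n → Matrix m m ℝ}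

theorem MSmooth.det (hF : MSmooth F U) : ContDiffOn ℝ ∞ (fun v => (F v).det) U := by
  simp only [Matrix.det_apply']
  exact ContDiffOn.sum fun σ _ => contDiffOn_const.mul (contDiffOn_prod fun i _ => hF _ _)

theorem MSmooth.inv (hF : MSmooth F U) (h0 : ∀ v ∈ U, (F v).det ≠ 0) :
    MSmooth (fun v => (F v)⁻¹) U := by
  intro i j
  have h : ContDiffOn ℝ ∞ (fun v => (F v).adjugate i j) U := by
    simp only [Matrix.adjugate_apply]
    refine MSmooth.det (F := fun v => (F v).updateRow j (Pi.single i 1)) fun p q => ?_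
    by_cases hp : p = j
    · subst hp; simpa using contDiffOn_const
    · simpa [Matrix.updateRow_ne hp] using hF p q
  have h2 := (hF.det.inv h0).mul h
  refine h2.congr fun v _ => ?_
  simp [Matrix.inv_def, Ring.inverse_eq_inv']

/-- Jacobi's formula. The product rule in the Leibniz expansion gives one determinant for each
differentiated column, and Cramer's rule turns it into a diagonal entry of the adjugate times the
derivative. -/
theorem pderiv_det (hU : IsOpen U) (hF : MSmooth F U) (hu : u ∈ U) :
    pderiv a (fun v => (F v).det) u = ((F u).adjugate * mpderiv a F u).trace := by
  have h1 : pderiv a (fun v => (F v).det) u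
      = ∑ i, ((F u).updateCol i (fun r => mpderiv a F u r i)).det := by
    simp only [Matrix.det_apply']
    rw [pderiv_sum]
    · rw [Finset.sum_comm]
      refine Finset.sum_congr rfl fun σ _ => ?_
      rw [pderiv_const_mul, pderiv_finset_prod, Finset.mul_sum]
      · refine Finset.sum_congr rfl fun i _ => ?_
        rw [← Finset.mul_prod_erase Finset.univ _ (Finset.mem_univ i)]
        simp only [Matrix.updateCol_self, mpderiv_apply]
        have : ∀ c : m → ℝ, ∏ j ∈ Finset.univ.erase i, (F u).updateCol i c (σ j) j
            = ∏ j ∈ Finset.univ.erase i, F u (σ j) j := fun c =>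
          Finset.prod_congr rfl fun j hj => Matrix.updateCol_ne (Finset.ne_of_mem_erase hj)
        rw [this]
        ring
      · exact fun i _ => hF.diff hU hu (σ i) i
      · exact differentiableAt_finset_prod (F := fun i v => F v (σ i) i)
          fun i _ => hF.diff hU hu (σ i) i
    · exact fun σ _ => (differentiableAt_finset_prod (F := fun i v => F v (σ i) i)
        fun i _ => hF.diff hU hu (σ i) i).const_mul _
  rw [h1, Matrix.trace]
  refine Finset.sum_congr rfl fun i _ => ?_
  rw [← Matrix.cramer_apply, Matrix.cramer_eq_adjugate_mulVec]
  rfl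

end Square

end Calculus

/-! ### Levi-Civita connection, symmetries of the curvature, and conformal Killing fields. -/

section Geometry

open Matrix

variable {n : ℕ}

/-- A smooth (pseudo-Riemannian) metric on an open set of the coordinate space. -/
structure MetricOn (G : Coord n → Matrix (Fin n) (Fin n) ℝ) (U : Set (Coord n)) : Prop where
  isOpen : IsOpen U
  smooth : MSmooth G U
  symm : ∀ u ∈ U, (G u)ᵀ = G u
  det_ne : ∀ u ∈ U, (G u).det ≠ 0

/-- The connection matrix `(Γ_c)ᵈₐ = Γᵈ_{ca}`. -/
def connMat (G : Coord n → Matrix (Fin n) (Fin n) ℝ) (c : Fin n) (u : Coord n) :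
    Matrix (Fin n) (Fin n) ℝ :=
  Matrix.of fun d a => christoffel G u d c a

/-- The curvature matrix `(R_{ab})ᵈ_c = Rᵈ_{cab}`. -/
def curvMat (G : Coord n → Matrix (Fin n) (Fin n) ℝ) (a b : Fin n) (u : Coord n) :
    Matrix (Fin n) (Fin n) ℝ :=
  Matrix.of fun d c => riemannUp G u d c a b

variable {G : Coord n → Matrix (Fin n) (Fin n) ℝ} {U : Set (Coord n)} {u : Coord n}

@[simp] theorem connMat_apply (c d a : Fin n) : connMat G c u d a = christoffel G u d c a := rfl

@[simp] theorem curvMat_apply (a b c d : Fin n) :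
    curvMat G a b u d c = riemannUp G u d c a b := rfl

namespace MetricOn

variable (hG : MetricOn G U) (hu : u ∈ U)
include hG

theorem inv_smooth : MSmooth (fun v => (G v)⁻¹) U := hG.smooth.inv hG.det_ne

theorem christoffel_smooth (d a b : Fin n) : ContDiffOn ℝ ∞ (fun v => christoffel G v d a b) U := by
  simp only [christoffel]
  refine contDiffOn_const.mul (ContDiffOn.sum fun e _ => (hG.inv_smooth d e).mul ?_)
  exact ((pderiv_contDiffOn hG.isOpen (hG.smooth e b) a).add
    (pderiv_contDiffOn hG.isOpen (hG.smooth e a) b)).sub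
    (pderiv_contDiffOn hG.isOpen (hG.smooth a b) e)

theorem connMat_smooth (c : Fin n) : MSmooth (connMat G c) U :=
  fun d a => hG.christoffel_smooth d c a

theorem riemannUp_smooth (d c a b : Fin n) :
    ContDiffOn ℝ ∞ (fun v => riemannUp G v d c a b) U := by
  simp only [riemannUp]
  have h := hG.christoffel_smooth
  exact ((pderiv_contDiffOn hG.isOpen (h d b c) a).sub
    (pderiv_contDiffOn hG.isOpen (h d a c) b)).add
    (ContDiffOn.sum fun e _ => ((h d a e).mul (h e b c)).sub ((h d b e).mul (h e a c)))

theorem ricci_smooth (a b : Fin n) : ContDiffOn ℝ ∞ (fun v => ricci G v a b) U :=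
  ContDiffOn.sum fun c _ => hG.riemannUp_smooth c a c b

theorem scalarCurv_smooth : ContDiffOn ℝ ∞ (fun v => scalarCurv G v) U :=
  ContDiffOn.sum fun a _ => ContDiffOn.sum fun b _ => (hG.inv_smooth a b).mul (hG.ricci_smooth a b)

theorem riemann_smooth (a b c d : Fin n) : ContDiffOn ℝ ∞ (fun v => riemann G v a b c d) U :=
  ContDiffOn.sum fun e _ => (hG.smooth a e).mul (hG.riemannUp_smooth e b c d)

theorem weyl_smooth (a b c d : Fin n) : ContDiffOn ℝ ∞ (fun v => weyl G v a b c d) U := by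
  simp only [weyl]
  have g := hG.smooth
  have r := hG.ricci_smooth
  refine ((hG.riemann_smooth a b c d).sub (contDiffOn_const.mul ?_)).add
    ((hG.scalarCurv_smooth.div_const _).mul
      (((g a c).mul (g b d)).sub ((g a d).mul (g b c))))
  exact ((((g a c).mul (r b d)).sub ((g a d).mul (r b c))).add ((g b d).mul (r a c))).sub
    ((g b c).mul (r a d))

include hu

theorem symm_apply (a b : Fin n) : G u a b = G u b a := by
  conv_lhs => rw [← hG.symm u hu]
  rfl

theorem mul_inv : G u * (G u)⁻¹ = 1 := Matrix.mul_nonsing_inv _ (hG.det_ne u hu).isUnit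

theorem inv_mul : (G u)⁻¹ * G u = 1 := Matrix.nonsing_inv_mul _ (hG.det_ne u hu).isUnit

theorem inv_symm : ((G u)⁻¹)ᵀ = (G u)⁻¹ := by
  rw [Matrix.transpose_nonsing_inv, hG.symm u hu]

theorem pderiv_symm (c a b : Fin n) :
    pderiv c (fun v => G v a b) u = pderiv c (fun v => G v b a) u :=
  pderiv_congr hG.isOpen hu fun _ hv => hG.symm_apply hv a b

theorem christoffel_symm (d a b : Fin n) : christoffel G u d a b = christoffel G u d b a := by
  simp only [christoffel]
  congr 1
  refine Finset.sum_congr rfl fun e _ => ?_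
  rw [hG.pderiv_symm hu e a b]
  ring

theorem lower_christoffel (x a b : Fin n) :
    ∑ d, G u x d * christoffel G u d a b = (1 / 2) * (pderiv a (fun v => G v x b) u
      + pderiv b (fun v => G v x a) u - pderiv x (fun v => G v a b) u) := by
  simp only [christoffel]
  set w : Fin n → ℝ := fun e => pderiv a (fun v => G v e b) u + pderiv b (fun v => G v e a) u
    - pderiv e (fun v => G v a b) u with hw
  have h : (G u *ᵥ ((G u)⁻¹ *ᵥ w)) x = w x := by
    rw [Matrix.mulVec_mulVec, hG.mul_inv hu, Matrix.one_mulVec]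
  have : w x = pderiv a (fun v => G v x b) u + pderiv b (fun v => G v x a) u
    - pderiv x (fun v => G v a b) u := rfl
  rw [← this, ← h]
  simp only [Matrix.mulVec, dotProduct, Finset.mul_sum, hw]
  refine Finset.sum_congr rfl fun d _ => Finset.sum_congr rfl fun e _ => by ring

/-- The metric is parallel. -/
theorem mpderiv_metric (c : Fin n) :
    mpderiv c G u = (connMat G c u)ᵀ * G u + G u * connMat G c u := by
  ext a b
  have h1 : ((connMat G c u)ᵀ * G u) a b = ∑ d, G u b d * christoffel G u d c a := by
    simp only [Matrix.mul_apply, Matrix.transpose_apply, connMat_apply]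
    exact Finset.sum_congr rfl fun d _ => by rw [hG.symm_apply hu d b, mul_comm]
  have h2 : (G u * connMat G c u) a b = ∑ d, G u a d * christoffel G u d c b := by
    simp only [Matrix.mul_apply, connMat_apply]
  rw [Matrix.add_apply, h1, h2, hG.lower_christoffel hu, hG.lower_christoffel hu, mpderiv_apply,
    hG.pderiv_symm hu c b a, hG.pderiv_symm hu a b c, hG.pderiv_symm hu b c a]
  ring

omit hG hu in
theorem curvMat_eq (a b : Fin n) :
    curvMat G a b u = mpderiv a (connMat G b) u - mpderiv b (connMat G a) u
      + (connMat G a u * connMat G b u - connMat G b u * connMat G a u) := by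
  ext d c
  simp [riemannUp, Matrix.mul_apply, Finset.sum_sub_distrib]

/-- Metric compatibility used twice. Only the symmetry of the left side in `c` and `d` matters
later. -/
theorem mpderiv_mpderiv_metric (d c : Fin n) :
    mpderiv d (mpderiv c G) u = (mpderiv d (connMat G c) u)ᵀ * G u
      + (connMat G c u)ᵀ * ((connMat G d u)ᵀ * G u + G u * connMat G d u)
      + (((connMat G d u)ᵀ * G u + G u * connMat G d u) * connMat G c u
      + G u * mpderiv d (connMat G c) u) := by
  have hM := hG.connMat_smooth c
  rw [mpderiv_congr hG.isOpen hu fun v hv => hG.mpderiv_metric hv c,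
    mpderiv_add hG.isOpen (hM.transpose.mul hG.smooth) (hG.smooth.mul hM) hu,
    mpderiv_mul hG.isOpen hM.transpose hG.smooth hu, mpderiv_mul hG.isOpen hG.smooth hM hu,
    hG.mpderiv_metric hu d, mpderiv_transpose]

/-- The curvature is the obstruction to commuting the second partial derivatives of the parallel
metric, and these commute. No choice of normal coordinates is needed. -/
theorem curvMat_skew (a b : Fin n) : G u * curvMat G a b u + (curvMat G a b u)ᵀ * G u = 0 := by
  have h := mpderiv_comm hG.isOpen hG.smooth hu (a := a) (b := b)
  rw [hG.mpderiv_mpderiv_metric hu, hG.mpderiv_mpderiv_metric hu, ← sub_eq_zero] at h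
  rw [curvMat_eq, ← h]
  simp only [Matrix.transpose_add, Matrix.transpose_sub, Matrix.transpose_mul]
  noncomm_ring

omit hG hu in
theorem riemann_skew_right (a b c d : Fin n) : riemann G u a b c d = -riemann G u a b d c := by
  simp only [riemann, riemannUp, ← Finset.sum_neg_distrib]
  refine Finset.sum_congr rfl fun e _ => ?_
  rw [← mul_neg]
  congr 1
  rw [Finset.sum_sub_distrib, Finset.sum_sub_distrib]
  ring

theorem riemann_skew_left (a b c d : Fin n) : riemann G u a b c d = -riemann G u b a c d := by
  have h := congrFun (congrFun (hG.curvMat_skew hu c d) a) b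
  simp only [Matrix.add_apply, Matrix.mul_apply, Matrix.transpose_apply, curvMat_apply,
    Matrix.zero_apply] at h
  rw [riemann, riemann, eq_neg_iff_add_eq_zero, ← h]
  congr 1
  exact Finset.sum_congr rfl fun e _ => by rw [hG.symm_apply hu b e, mul_comm]

theorem riemannUp_cyclic (d a b c : Fin n) :
    riemannUp G u d a b c + riemannUp G u d b c a + riemannUp G u d c a b = 0 := by
  have hp : ∀ x a b : Fin n, pderiv x (fun v => christoffel G v d a b) u
      = pderiv x (fun v => christoffel G v d b a) u := fun x a b =>
    pderiv_congr hG.isOpen hu fun v hv => hG.christoffel_symm hv d a b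
  simp only [riemannUp, Finset.sum_sub_distrib]
  rw [hp c b a, hp a c b, hp b a c]
  simp only [hG.christoffel_symm hu _ b a, hG.christoffel_symm hu _ c b,
    hG.christoffel_symm hu _ a c]
  ring

theorem riemann_cyclic (a b c d : Fin n) :
    riemann G u a b c d + riemann G u a c d b + riemann G u a d b c = 0 := by
  simp only [riemann, ← Finset.sum_add_distrib, ← mul_add]
  exact Finset.sum_eq_zero fun e _ => by rw [hG.riemannUp_cyclic hu, mul_zero]

theorem riemann_pair (a b c d : Fin n) : riemann G u a b c d = riemann G u c d a b := by
  have c1 := hG.riemann_cyclic hu a b c d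
  have c2 := hG.riemann_cyclic hu b c d a
  have c3 := hG.riemann_cyclic hu c d a b
  have c4 := hG.riemann_cyclic hu d a b c
  have l := hG.riemann_skew_left hu
  have r := fun a b c d => riemann_skew_right (G := G) (u := u) a b c d
  -- Pair symmetry is a signed combination of the four cyclic identities, once skewness in each pair
  -- identifies their terms.
  linarith [l a b c d, l a c d b, l a d b c, l b c d a, l b d a c, l b a c d, l c d a b, l c a b d,
    l c b d a, l d a b c, l d b c a, l d c a b, r a b c d, r a c d b, r a d b c, r b c d a,
    r b d a c, r b a c d, r c d a b, r c a b d, r c b d a, r d a b c, r d b c a, r d c a b]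

theorem ricci_eq_trace (b d : Fin n) :
    ∑ a, ∑ c, (G u)⁻¹ a c * riemann G u a b c d = ricci G u b d := by
  have h : ∀ c, ∑ a, (G u)⁻¹ a c * riemann G u a b c d = riemannUp G u c b c d := by
    intro c
    have := congrFun (congrArg (fun N => N *ᵥ (fun e => riemannUp G u e b c d)) (hG.inv_mul hu)) c
    simp only [Matrix.one_mulVec, ← Matrix.mulVec_mulVec] at this
    rw [← this]
    simp only [Matrix.mulVec, dotProduct, riemann]
    refine Finset.sum_congr rfl fun a _ => ?_
    rw [show (G u)⁻¹ a c = (G u)⁻¹ c a from congrFun (congrFun (hG.inv_symm hu) c) a]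
  rw [Finset.sum_comm]
  exact Finset.sum_congr rfl fun c _ => h c

end MetricOn

/-- The covariant derivative `∇ₐ ξᵇ` of a vector field. -/
def vecD (G : Coord n → Matrix (Fin n) (Fin n) ℝ) (ξ : Coord n → Fin n → ℝ) (u : Coord n) :
    Matrix (Fin n) (Fin n) ℝ :=
  Matrix.of fun a b => pderiv a (fun v => ξ v b) u + ∑ c, christoffel G u b a c * ξ u c

/-- The covariant derivative `∇_c Kₐᵇ` of a mixed tensor field. -/
def endD (G K : Coord n → Matrix (Fin n) (Fin n) ℝ) (c : Fin n) (u : Coord n) :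
    Matrix (Fin n) (Fin n) ℝ :=
  mpderiv c K u - (connMat G c u)ᵀ * K u + K u * (connMat G c u)ᵀ

/-- The covariant derivative `∇_c Bᵃᵇ` of a contravariant tensor field of rank two. -/
def bivD (G B : Coord n → Matrix (Fin n) (Fin n) ℝ) (c : Fin n) (u : Coord n) :
    Matrix (Fin n) (Fin n) ℝ :=
  mpderiv c B u + connMat G c u * B u + B u * (connMat G c u)ᵀ

namespace MetricOn

variable (hG : MetricOn G U)
include hG

theorem vecD_smooth {ξ : Coord n → Fin n → ℝ} (hξ : ∀ b, ContDiffOn ℝ ∞ (fun v => ξ v b) U) :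
    MSmooth (vecD G ξ) U := fun a b =>
  (pderiv_contDiffOn hG.isOpen (hξ b) a).add
    (ContDiffOn.sum fun c _ => (hG.christoffel_smooth b a c).mul (hξ c))

variable (hu : u ∈ U)
include hu

/-- The Ricci identity for a vector field. -/
theorem ricci_identity {ξ : Coord n → Fin n → ℝ} (hξ : ∀ b, ContDiffOn ℝ ∞ (fun v => ξ v b) U)
    (c a b : Fin n) :
    endD G (vecD G ξ) c u a b - endD G (vecD G ξ) a u c b
      = ∑ d, riemannUp G u b d c a * ξ u d := by
  have hd : ∀ d, DifferentiableAt ℝ (fun v => ξ v d) u := fun d =>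
    differentiableAt_of_contDiffOn hG.isOpen (hξ d) hu
  have hc : ∀ x y z, DifferentiableAt ℝ (fun v => christoffel G v x y z) u := fun x y z =>
    differentiableAt_of_contDiffOn hG.isOpen (hG.christoffel_smooth x y z) hu
  have key : ∀ a c, pderiv c (fun v => vecD G ξ v a b) u
      = pderiv c (pderiv a (fun v => ξ v b)) u
        + ∑ d, (pderiv c (fun v => christoffel G v b a d) u * ξ u d
          + christoffel G u b a d * pderiv c (fun v => ξ v d) u) := by
    intro a c
    simp only [vecD, Matrix.of_apply]
    rw [pderiv_add (differentiableAt_of_contDiffOn hG.isOpen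
      (pderiv_contDiffOn hG.isOpen (hξ b) a) hu)
      (DifferentiableAt.fun_sum fun d _ => (hc b a d).fun_mul (hd d)),
      pderiv_sum fun d _ => (hc b a d).fun_mul (hd d)]
    congr 1
    exact Finset.sum_congr rfl fun d _ => pderiv_mul (hc b a d) (hd d)
  -- After expansion, the second partials of `ξ`, the torsion-free lower connection term and the sum
  -- of the cross terms `Γ ∂ξ` are symmetric in `a` and `c`; only `∂Γ` and `ΓΓ` survive the
  -- difference.
  have h1 : ∀ a c, endD G (vecD G ξ) c u a b = pderiv c (fun v => vecD G ξ v a b) u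
      - (∑ d, christoffel G u d c a * vecD G ξ u d b)
      + ((∑ d, christoffel G u b c d * pderiv a (fun v => ξ v d) u)
        + ∑ d, (∑ e, christoffel G u b c e * christoffel G u e a d) * ξ u d) := by
    intro a c
    simp only [endD, Matrix.add_apply, Matrix.sub_apply, Matrix.mul_apply, Matrix.transpose_apply,
      connMat_apply, mpderiv_apply]
    congr 1
    simp only [Finset.sum_mul]
    rw [Finset.sum_comm, ← Finset.sum_add_distrib]
    refine Finset.sum_congr rfl fun d _ => ?_
    simp only [vecD, Matrix.of_apply]
    rw [add_mul, Finset.sum_mul, mul_comm]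
    congr 1
    exact Finset.sum_congr rfl fun e _ => by ring
  have h2 : ∀ d, christoffel G u d c a = christoffel G u d a c := fun d =>
    hG.christoffel_symm hu d c a
  rw [h1, h1, key, key, pderiv_comm hG.isOpen (hξ b) hu]
  simp only [h2, riemannUp, Finset.sum_add_distrib, Finset.sum_sub_distrib, add_mul, sub_mul]
  ring

/-- The covariant derivative of the metric equation `∇ₐ ξ_b + ∇_b ξₐ = 2 φ g_{ab}`. -/
theorem endD_conformal {K : Coord n → Matrix (Fin n) (Fin n) ℝ} (hK : MSmooth K U)
    {φ : Coord n → ℝ} (hφ : ContDiffOn ℝ ∞ φ U)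
    (h : ∀ v ∈ U, K v * G v + (K v * G v)ᵀ = (2 * φ v) • G v) (c : Fin n) :
    endD G K c u * G u + (endD G K c u * G u)ᵀ = (2 * pderiv c φ u) • G u := by
  have hKG := hK.mul hG.smooth
  have h1 := mpderiv_congr (a := c) hG.isOpen hu h
  have h2φ : ContDiffOn ℝ ∞ (fun v => 2 * φ v) U := contDiffOn_const.mul hφ
  rw [mpderiv_add hG.isOpen hKG hKG.transpose hu, mpderiv_transpose,
    mpderiv_mul hG.isOpen hK hG.smooth hu, mpderiv_smul hG.isOpen h2φ hG.smooth hu,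
    pderiv_const_mul _ (differentiableAt_of_contDiffOn hG.isOpen hφ hu),
    hG.mpderiv_metric hu] at h1
  have h2 := h u hu
  have hS := hG.symm u hu
  set M := connMat G c u
  set D := mpderiv c K u
  set L := K u * G u with hL
  -- Because the metric is parallel, lowering the index after differentiating `K` agrees with
  -- differentiating the lowered tensor `L`.
  have e1 : endD G K c u * G u = D * G u + K u * (Mᵀ * G u + G u * M) - Mᵀ * L - L * M := by
    rw [hL]; simp only [endD]; noncomm_ring
  have e2 : Mᵀ * (L + Lᵀ) + (L + Lᵀ) * M = (2 * φ u) • (Mᵀ * G u + G u * M) := by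
    rw [h2]; simp [smul_add]
  rw [e1]
  have e3 : (2 * pderiv c φ u) • G u = (D * G u + K u * (Mᵀ * G u + G u * M))
      + (D * G u + K u * (Mᵀ * G u + G u * M))ᵀ - (2 * φ u) • (Mᵀ * G u + G u * M) := by
    rw [h1]; abel
  rw [e3, ← e2]
  simp only [Matrix.transpose_add, Matrix.transpose_sub, Matrix.transpose_mul,
    Matrix.transpose_transpose]
  noncomm_ring

/-- Index raising commutes with the covariant derivative. This passes from `∇ₐ ξᵇ` to the bivector
whose dual is the divergence of `Y`. -/
theorem endD_eq_mul_bivD {K B : Coord n → Matrix (Fin n) (Fin n) ℝ} (hB : MSmooth B U)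
    (h : ∀ v ∈ U, K v = G v * B v) (c : Fin n) : endD G K c u = G u * bivD G B c u := by
  simp only [endD, bivD]
  rw [mpderiv_congr (a := c) hG.isOpen hu h, mpderiv_mul hG.isOpen hG.smooth hB hu,
    hG.mpderiv_metric hu, h u hu]
  noncomm_ring

/-- The second covariant derivative of a conformal Killing vector field `ξ`:
`∇_c ∇ₐ ξ_b = R_{dcab} ξᵈ + φₐ g_{cb} - φ_b g_{ca} + φ_c g_{ab}`. -/
theorem endD_vecD_conformal {ξ : Coord n → Fin n → ℝ}
    (hξ : ∀ b, ContDiffOn ℝ ∞ (fun v => ξ v b) U) {φ : Coord n → ℝ} (hφ : ContDiffOn ℝ ∞ φ U)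
    (h : ∀ v ∈ U, vecD G ξ v * G v + (vecD G ξ v * G v)ᵀ = (2 * φ v) • G v) (c a b : Fin n) :
    (endD G (vecD G ξ) c u * G u) a b = (∑ d, riemann G u d c a b * ξ u d)
      + pderiv a φ u * G u c b - pderiv b φ u * G u c a + pderiv c φ u * G u a b := by
  -- Koszul's trick: the part of `N c a b` symmetric in `a, b` is given by the conformal factor and
  -- the part skew in `c, a` by curvature. Swapping the first two and the last two indices in turn
  -- runs through all six orders and returns to `N c a b` with the opposite sign, so `2 * N c a b`
  -- is known.
  set N : Fin n → Fin n → Fin n → ℝ := fun c a b => (endD G (vecD G ξ) c u * G u) a b with hN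
  have s1 : ∀ c a b, N c a b + N c b a = 2 * pderiv c φ u * G u a b := fun c a b =>
    congrFun (congrFun (hG.endD_conformal hu (hG.vecD_smooth hξ) hφ h c) a) b
  have s2 : ∀ c a b, N c a b - N a c b = ∑ d, riemann G u b d c a * ξ u d := by
    intro c a b
    simp only [hN, Matrix.mul_apply, riemann]
    rw [← Finset.sum_sub_distrib]
    simp only [Finset.sum_mul]
    rw [Finset.sum_comm]
    refine Finset.sum_congr rfl fun f _ => ?_
    rw [← sub_mul, hG.ricci_identity hu hξ, hG.symm_apply hu b f, Finset.sum_mul]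
    exact Finset.sum_congr rfl fun d _ => by ring
  -- The first Bianchi identity merges two of the three curvature terms picked up on the way; the
  -- third equals it too, so the factor two cancels.
  have s3 : ∑ d, riemann G u b d c a * ξ u d + ∑ d, riemann G u a d b c * ξ u d
      = ∑ d, riemann G u d c a b * ξ u d := by
    rw [← Finset.sum_add_distrib]
    refine Finset.sum_congr rfl fun d _ => ?_
    have := hG.riemann_cyclic hu d a b c
    rw [hG.riemann_skew_left hu b d, hG.riemann_skew_left hu a d]
    linear_combination (-ξ u d) * this
  have s4 : ∑ d, riemann G u c d a b * ξ u d = -∑ d, riemann G u d c a b * ξ u d := by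
    rw [← Finset.sum_neg_distrib]
    exact Finset.sum_congr rfl fun d _ => by rw [hG.riemann_skew_left hu c d]; ring
  have g := hG.symm_apply hu
  change N c a b = _
  have h1 := s2 c a b
  have h2 := s1 a c b
  have h3 := s2 a b c
  have h4 := s1 b a c
  have h5 := s2 b c a
  have h6 := s1 c b a
  rw [g a c] at h4
  rw [g b a] at h6
  linarith

end MetricOn

end Geometry

/-! ### Four-index tensors in frames and the symmetries of a Weyl tensor. -/

section WeylAlgebra

open Matrix

/-- A tensor with four indices. -/
abbrev Tensor4 (R : Type*) := Fin 4 → Fin 4 → Fin 4 → Fin 4 → R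

section Frames

variable {R : Type*} [CommRing R]

/-- The multilinear form of a tensor with four indices. -/
def teval (C : Tensor4 R) (v w x y : Fin 4 → R) : R :=
  ∑ a, ∑ b, ∑ c, ∑ d, C a b c d * v a * w b * x c * y d

/-- The components of a tensor in the frame formed by the columns of `E`. -/
def pull (C : Tensor4 R) (E : Matrix (Fin 4) (Fin 4) R) : Tensor4 R :=
  fun i j k l => teval C (E.col i) (E.col j) (E.col k) (E.col l)

theorem sum_prod_four (f : Tensor4 R) : ∑ a, ∑ b, ∑ c, ∑ d, f a b c d
    = ∑ p : Fin 4 × Fin 4 × Fin 4 × Fin 4, f p.1 p.2.1 p.2.2.1 p.2.2.2 := by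
  simp only [Fintype.sum_prod_type]

theorem teval_mulVec (C : Tensor4 R) (E : Matrix (Fin 4) (Fin 4) R) (v w x y : Fin 4 → R) :
    teval C (E *ᵥ v) (E *ᵥ w) (E *ᵥ x) (E *ᵥ y) = teval (pull C E) v w x y := by
  have h : ∀ a b c d, C a b c d * (E *ᵥ v) a * (E *ᵥ w) b * (E *ᵥ x) c * (E *ᵥ y) d
      = ∑ p : Fin 4 × Fin 4 × Fin 4 × Fin 4, C a b c d * E a p.1 * E b p.2.1 * E c p.2.2.1
        * E d p.2.2.2 * (v p.1 * w p.2.1 * x p.2.2.1 * y p.2.2.2) := by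
    intro a b c d
    rw [← sum_prod_four fun i j k l => C a b c d * E a i * E b j * E c k
        * E d l * (v i * w j * x k * y l)]
    simp only [Matrix.mulVec, dotProduct]
    have : ∀ i j k l, C a b c d * E a i * E b j * E c k * E d l * (v i * w j * x k * y l)
      = C a b c d * ((E a i * v i) * ((E b j * w j) * ((E c k * x k) * (E d l * y l)))) := by
      intros; ring
    simp only [this, ← Finset.mul_sum, ← Finset.sum_mul]
    ring
  simp only [teval, h, pull]
  rw [sum_prod_four, Finset.sum_comm, sum_prod_four]
  refine Finset.sum_congr rfl fun q _ => ?_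
  rw [sum_prod_four]
  simp only [Finset.sum_mul, Matrix.col_apply]
  exact Finset.sum_congr rfl fun p _ => by ring

theorem pull_pull (C : Tensor4 R) (E F : Matrix (Fin 4) (Fin 4) R) :
    pull (pull C E) F = pull C (E * F) := by
  funext i j k l
  have : ∀ i, (E * F).col i = E *ᵥ F.col i := fun i => rfl
  simp only [pull, this]
  rw [teval_mulVec]

theorem teval_single (C : Tensor4 R) (i j k l : Fin 4) :
    teval C (Pi.single i 1) (Pi.single j 1) (Pi.single k 1) (Pi.single l 1) = C i j k l := by
  simp only [teval]
  rw [Finset.sum_eq_single i, Finset.sum_eq_single j, Finset.sum_eq_single k,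
    Finset.sum_eq_single l] <;> simp +contextual

theorem pull_one (C : Tensor4 R) : pull C 1 = C := by
  funext i j k l
  have : ∀ i, (1 : Matrix (Fin 4) (Fin 4) R).col i = Pi.single i 1 := by
    intro i; ext j; simp [Matrix.one_apply, Pi.single_apply]
  simp only [pull, this, teval_single]

theorem pull_pull_of_mul_eq_one (C : Tensor4 R) {E F : Matrix (Fin 4) (Fin 4) R} (h : E * F = 1) :
    pull (pull C E) F = C := by
  rw [pull_pull, h, pull_one]

theorem pull_zero (E : Matrix (Fin 4) (Fin 4) R) : pull (0 : Tensor4 R) E = 0 := by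
  funext i j k l; simp [pull, teval]

/-- The vector `x` lies in the kernel of the tensor `C` in its last index. -/
def InKer (C : Tensor4 R) (x : Fin 4 → R) : Prop := ∀ a b c, ∑ d, C a b c d * x d = 0

theorem InKer.frame {C : Tensor4 R} {E : Matrix (Fin 4) (Fin 4) R} {x : Fin 4 → R}
    (h : InKer C (E *ᵥ x)) : InKer (pull C E) x := by
  intro i j k
  have h1 : ∑ l, pull C E i j k l * x l
      = teval C (E *ᵥ Pi.single i 1) (E *ᵥ Pi.single j 1) (E *ᵥ Pi.single k 1) (E *ᵥ x) := by
    rw [teval_mulVec]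
    simp only [teval]
    symm
    rw [Finset.sum_eq_single i, Finset.sum_eq_single j, Finset.sum_eq_single k] <;>
      simp +contextual
  rw [h1, teval]
  refine Finset.sum_eq_zero fun a _ => Finset.sum_eq_zero fun b _ =>
    Finset.sum_eq_zero fun c _ => ?_
  have := h a b c
  rw [← zero_mul ((E *ᵥ Pi.single i 1) a * (E *ᵥ Pi.single j 1) b * (E *ᵥ Pi.single k 1) c),
    ← this, Finset.sum_mul]
  exact Finset.sum_congr rfl fun d _ => by ring

end Frames

/-- The algebraic symmetries of a Weyl tensor; `H` is the inverse metric. -/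
structure IsWeyl (H : Matrix (Fin 4) (Fin 4) ℝ) (C : Tensor4 ℝ) : Prop where
  skew_left : ∀ a b c d, C a b c d = -C b a c d
  skew_right : ∀ a b c d, C a b c d = -C a b d c
  pair : ∀ a b c d, C a b c d = C c d a b
  cyclic : ∀ a b c d, C a b c d + C a c d b + C a d b c = 0
  trace : ∀ b d, ∑ a, ∑ c, H a c * C a b c d = 0

/-- The symmetries pass to a frame by multilinearity. The trace condition needs `hE`: contracting
two frame slots with `H'` contracts the original slots with `E * H' * Eᵀ`. -/
theorem IsWeyl.frame {H H' E : Matrix (Fin 4) (Fin 4) ℝ} {C : Tensor4 ℝ} (hC : IsWeyl H C)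
    (hE : E * H' * Eᵀ = H) : IsWeyl H' (pull C E) := by
  have sl : ∀ v w x y, teval C v w x y = -teval C w v x y := by
    intro v w x y
    simp only [teval, ← Finset.sum_neg_distrib]
    rw [Finset.sum_comm]
    refine Finset.sum_congr rfl fun a _ => Finset.sum_congr rfl fun b _ =>
      Finset.sum_congr rfl fun c _ => Finset.sum_congr rfl fun d _ => ?_
    rw [hC.skew_left]; ring
  have pr : ∀ v w x y, teval C v w x y = teval C x y v w := by
    intro v w x y
    simp only [teval]
    rw [sum_prod_four, sum_prod_four]
    refine Finset.sum_nbij' (fun p => (p.2.2.1, p.2.2.2, p.1, p.2.1))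
      (fun p => (p.2.2.1, p.2.2.2, p.1, p.2.1)) (by simp) (by simp) (by simp) (by simp) ?_
    intro p _
    rw [hC.pair]; ring
  have cy : ∀ v w x y, teval C v w x y + teval C v x y w + teval C v y w x = 0 := by
    intro v w x y
    have h1 : teval C v x y w = ∑ a, ∑ b, ∑ c, ∑ d, C a c d b * v a * w b * x c * y d := by
      simp only [teval]
      refine Finset.sum_congr rfl fun a _ => ?_
      rw [Finset.sum_congr rfl fun b _ => Finset.sum_comm, Finset.sum_comm]
      refine Finset.sum_congr rfl fun b _ => Finset.sum_congr rfl fun c _ =>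
        Finset.sum_congr rfl fun d _ => by ring
    have h2 : teval C v y w x = ∑ a, ∑ b, ∑ c, ∑ d, C a d b c * v a * w b * x c * y d := by
      simp only [teval]
      refine Finset.sum_congr rfl fun a _ => ?_
      rw [Finset.sum_comm]
      refine Finset.sum_congr rfl fun b _ => ?_
      rw [Finset.sum_comm]
      refine Finset.sum_congr rfl fun c _ => Finset.sum_congr rfl fun d _ => by ring
    rw [h1, h2]
    simp only [teval, ← Finset.sum_add_distrib]
    refine Finset.sum_eq_zero fun a _ => Finset.sum_eq_zero fun b _ =>
      Finset.sum_eq_zero fun c _ => Finset.sum_eq_zero fun d _ => ?_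
    linear_combination (v a * w b * x c * y d) * hC.cyclic a b c d
  refine ⟨fun a b c d => sl _ _ _ _, fun a b c d => ?_, fun a b c d => pr _ _ _ _,
    fun a b c d => cy _ _ _ _, fun b d => ?_⟩
  · simp only [pull]
    rw [pr, sl, pr]
  · have h1 : ∀ p q, ∑ i, ∑ k, H' i k * E p i * E q k = H p q := by
      intro p q
      rw [← hE]
      simp only [Matrix.mul_apply, Matrix.transpose_apply, Finset.sum_mul]
      rw [Finset.sum_comm]
      exact Finset.sum_congr rfl fun i _ => Finset.sum_congr rfl fun k _ => by ring
    have h2 : ∑ i, ∑ k, H' i k * pull C E i b k d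
        = ∑ p : Fin 4 × Fin 4 × Fin 4 × Fin 4, (∑ i, ∑ k, H' i k * E p.1 i * E p.2.2.1 k)
          * (C p.1 p.2.1 p.2.2.1 p.2.2.2 * E p.2.1 b * E p.2.2.2 d) := by
      simp only [pull, teval, sum_prod_four, Finset.mul_sum, Finset.sum_mul, Matrix.col_apply]
      rw [Finset.sum_congr rfl fun i _ => Finset.sum_comm, Finset.sum_comm]
      exact Finset.sum_congr rfl fun p _ => Finset.sum_congr rfl fun i _ =>
        Finset.sum_congr rfl fun k _ => by ring
    rw [h2]
    simp only [h1]
    rw [← sum_prod_four fun p q r s => H p r * (C p q r s * E q b * E s d), Finset.sum_comm]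
    refine Finset.sum_eq_zero fun q _ => ?_
    rw [Finset.sum_congr rfl fun p _ => Finset.sum_comm, Finset.sum_comm]
    refine Finset.sum_eq_zero fun s _ => ?_
    rw [← zero_mul (E q b * E s d), ← hC.trace q s, Finset.sum_mul]
    refine Finset.sum_congr rfl fun p _ => ?_
    rw [Finset.sum_mul]
    exact Finset.sum_congr rfl fun r _ => by ring

theorem skew_eq_zero {T : Fin 4 → Fin 4 → ℝ} (hT : ∀ a b, T a b = -T b a) (h01 : T 0 1 = 0)
    (h02 : T 0 2 = 0) (h03 : T 0 3 = 0) (h12 : T 1 2 = 0) (h13 : T 1 3 = 0) (h23 : T 2 3 = 0)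
    (a b : Fin 4) : T a b = 0 := by
  have hd : ∀ a, T a a = 0 := fun a => by linarith [hT a a]
  have h10 : T 1 0 = 0 := by rw [hT, h01, neg_zero]
  have h20 : T 2 0 = 0 := by rw [hT, h02, neg_zero]
  have h30 : T 3 0 = 0 := by rw [hT, h03, neg_zero]
  have h21 : T 2 1 = 0 := by rw [hT, h12, neg_zero]
  have h31 : T 3 1 = 0 := by rw [hT, h13, neg_zero]
  have h32 : T 3 2 = 0 := by rw [hT, h23, neg_zero]
  fin_cases a <;> fin_cases b <;> first | assumption | exact hd _

/-- A tensor with the pair symmetries of a curvature tensor is determined by the components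
over pairs of distinct indices. -/
theorem IsWeyl.eq_zero {H : Matrix (Fin 4) (Fin 4) ℝ} {C : Tensor4 ℝ} (hC : IsWeyl H C)
    (h1 : ∀ c d, C 0 1 c d = 0) (h2 : ∀ c d, C 0 2 c d = 0) (h3 : ∀ c d, C 0 3 c d = 0)
    (h4 : C 1 2 1 2 = 0) (h5 : C 1 2 1 3 = 0) (h6 : C 1 2 2 3 = 0) (h7 : C 1 3 1 3 = 0)
    (h8 : C 1 3 2 3 = 0) (h9 : C 2 3 2 3 = 0) : C = 0 := by
  have p := hC.pair
  have r := hC.skew_right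
  have h12 : ∀ c d, C 1 2 c d = 0 := skew_eq_zero (r 1 2) (by rw [p, h1]) (by rw [p, h2])
    (by rw [p, h3]) h4 h5 h6
  have h13 : ∀ c d, C 1 3 c d = 0 := skew_eq_zero (r 1 3) (by rw [p, h1]) (by rw [p, h2])
    (by rw [p, h3]) (by rw [p, h12]) h7 h8
  have h23 : ∀ c d, C 2 3 c d = 0 := skew_eq_zero (r 2 3) (by rw [p, h1]) (by rw [p, h2])
    (by rw [p, h3]) (by rw [p, h12]) (by rw [p, h13]) h9
  funext a b c d
  exact skew_eq_zero (T := fun a b => C a b c d) (fun a b => hC.skew_left a b c d) (h1 c d)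
    (h2 c d) (h3 c d) (h12 c d) (h13 c d) (h23 c d) a b

end WeylAlgebra

/-! ### The kernel of a nonzero Weyl tensor in Lorentzian signature. -/

section WeylAlgebra

open Matrix

/-- The Minkowski metric. -/
def minkowski : Matrix (Fin 4) (Fin 4) ℝ := !![-1, 0, 0, 0; 0, 1, 0, 0; 0, 0, 1, 0; 0, 0, 0, 1]

/-- The Gram matrix of the real frame `(l, k, Re m, Im m)` of a null tetrad. -/
def nullGram : Matrix (Fin 4) (Fin 4) ℝ :=
  !![0, -1, 0, 0; -1, 0, 0, 0; 0, 0, 1 / 2, 0; 0, 0, 0, 1 / 2]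

/-- The inverse of `nullGram`. -/
def nullGramInv : Matrix (Fin 4) (Fin 4) ℝ :=
  !![0, -1, 0, 0; -1, 0, 0, 0; 0, 0, 2, 0; 0, 0, 0, 2]

theorem minkowski_mul_self : minkowski * minkowski = 1 := by
  ext i j; fin_cases i <;> fin_cases j <;> simp [minkowski, Matrix.mul_apply, Fin.sum_univ_four]

theorem nullGram_mul_inv : nullGram * nullGramInv = 1 := by
  ext i j
  fin_cases i <;> fin_cases j <;>
    simp [nullGram, nullGramInv, Matrix.mul_apply, Fin.sum_univ_four]

/-- Here `a` and `b` play the electric and magnetic parts of a 2-form which, together with its dual,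
annihilates `x = (x0, x⃗)`. The equations read `a·x⃗ = b·x⃗ = 0`, `x0 a = x⃗ × b`, `x0 b = -x⃗ × a`.
Hence `x0² a = -x⃗ × (x⃗ × a) = |x⃗|² a`, and likewise for `b`, so both vanish unless `x` is null.
-/
theorem eq_zero_of_cross_eqs {x0 x1 x2 x3 a1 a2 a3 b1 b2 b3 : ℝ}
    (hne : x0 ^ 2 ≠ x1 ^ 2 + x2 ^ 2 + x3 ^ 2) (ha : a1 * x1 + a2 * x2 + a3 * x3 = 0)
    (ha1 : a1 * x0 = b3 * x2 - b2 * x3) (ha2 : a2 * x0 = b1 * x3 - b3 * x1)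
    (ha3 : a3 * x0 = b2 * x1 - b1 * x2) (hb : b1 * x1 + b2 * x2 + b3 * x3 = 0)
    (hb1 : b1 * x0 = a2 * x3 - a3 * x2) (hb2 : b2 * x0 = a3 * x1 - a1 * x3)
    (hb3 : b3 * x0 = a1 * x2 - a2 * x1) :
    (a1 = 0 ∧ a2 = 0 ∧ a3 = 0) ∧ b1 = 0 ∧ b2 = 0 ∧ b3 = 0 := by
  have hq : x0 ^ 2 - (x1 ^ 2 + x2 ^ 2 + x3 ^ 2) ≠ 0 := sub_ne_zero.2 hne
  refine ⟨⟨?_, ?_, ?_⟩, ?_, ?_, ?_⟩ <;> refine (mul_eq_zero.1 ?_).resolve_left hq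
  · linear_combination x0 * ha1 + x2 * hb3 - x3 * hb2 - x1 * ha
  · linear_combination x0 * ha2 + x3 * hb1 - x1 * hb3 - x2 * ha
  · linear_combination x0 * ha3 + x1 * hb2 - x2 * hb1 - x3 * ha
  · linear_combination x0 * hb1 + x3 * ha2 - x2 * ha3 - x1 * hb
  · linear_combination x0 * hb2 + x1 * ha3 - x3 * ha1 - x2 * hb
  · linear_combination x0 * hb3 + x2 * ha1 - x1 * ha2 - x3 * hb

/-- In Minkowski space, the double dual of a Weyl tensor is its opposite. -/
theorem IsWeyl.minkowski_duality {C : Tensor4 ℝ} (hC : IsWeyl minkowski C) :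
    (C 2 3 2 3 = -C 0 1 0 1 ∧ C 2 3 3 1 = -C 0 1 0 2 ∧ C 2 3 1 2 = -C 0 1 0 3 ∧
      C 3 1 3 1 = -C 0 2 0 2 ∧ C 3 1 1 2 = -C 0 2 0 3 ∧ C 1 2 1 2 = -C 0 3 0 3) ∧
    C 0 2 2 3 = C 0 1 3 1 ∧ C 0 3 2 3 = C 0 1 1 2 ∧ C 0 3 3 1 = C 0 2 1 2 := by
  have hd : ∀ a c d, C a a c d = 0 := fun a c d => by linarith [hC.skew_left a a c d]
  have hd' : ∀ a c d, C c d a a = 0 := fun a c d => by linarith [hC.skew_right c d a a]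
  -- In four dimensions the trace condition is what makes the left and right duals coincide: the
  -- purely spatial components become minus the electric ones, and the magnetic matrix becomes
  -- symmetric.
  have tr : ∀ b d, C 0 b 0 d = C 1 b 1 d + C 2 b 2 d + C 3 b 3 d := by
    intro b d
    have := hC.trace b d
    simp [Fin.sum_univ_four, minkowski] at this
    linarith
  have l := hC.skew_left
  have r := hC.skew_right
  have p := hC.pair
  have t00 := tr 0 0
  have t11 := tr 1 1
  have t22 := tr 2 2
  have t33 := tr 3 3
  have e1 : C 2 1 2 1 = C 1 2 1 2 := by linarith [l 2 1 2 1, r 1 2 2 1]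
  have e2 : C 1 3 1 3 = C 3 1 3 1 := by linarith [l 1 3 1 3, r 3 1 1 3]
  have e3 : C 3 2 3 2 = C 2 3 2 3 := by linarith [l 3 2 3 2, r 2 3 3 2]
  have e4 : ∀ i, C i 0 i 0 = C 0 i 0 i := fun i => by linarith [l i 0 i 0, r 0 i i 0]
  rw [e4 1, e4 2, e4 3, hd] at t00
  rw [e1, hd] at t11
  rw [e3, hd, ← e1, e1] at t22
  rw [hd, e2] at t33
  have t12 := tr 1 2
  have t13 := tr 1 3
  have t23 := tr 2 3
  rw [hd, hd'] at t12 t13 t23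
  have t01 := tr 0 1
  have t02 := tr 0 2
  have t03 := tr 0 3
  rw [hd, hd'] at t01 t02 t03
  refine ⟨⟨by linarith, ?_, ?_, by linarith, ?_, by linarith⟩, ?_, ?_, ?_⟩
  · linarith [l 3 1 3 2, r 1 3 3 2, p 1 3 2 3, r 2 3 1 3]
  · linarith [l 2 1 2 3, p 1 2 2 3]
  · linarith [l 1 2 1 3, l 2 1 1 3, p 1 2 1 3, l 1 3 1 2]
  · linarith [l 1 0 1 3, l 2 0 2 3, r 0 1 3 1]
  · linarith [l 1 0 1 2, l 3 0 3 2, r 0 3 3 2]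
  · linarith [l 2 0 2 1, l 3 0 3 1, r 0 2 2 1]

/-- In Minkowski space, a nonzero Weyl tensor is annihilated by null vectors only. -/
theorem IsWeyl.null_of_inKer_minkowski {C : Tensor4 ℝ} (hC : IsWeyl minkowski C)
    {x : Fin 4 → ℝ} (hx : InKer C x) (h0 : C ≠ 0) :
    x 0 ^ 2 = x 1 ^ 2 + x 2 ^ 2 + x 3 ^ 2 := by
  by_contra hne
  apply h0
  obtain ⟨⟨d11, d12, d13, d22, d23, d33⟩, m12, m13, m23⟩ := hC.minkowski_duality
  have p := hC.pair
  have r := hC.skew_right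
  have hd : ∀ a c d, C c d a a = 0 := fun a c d => by linarith [r c d a a]
  have r10 : ∀ a b, C a b 1 0 = -C a b 0 1 := fun a b => r a b 1 0
  have r20 : ∀ a b, C a b 2 0 = -C a b 0 2 := fun a b => r a b 2 0
  have r30 : ∀ a b, C a b 3 0 = -C a b 0 3 := fun a b => r a b 3 0
  have r32 : ∀ a b, C a b 3 2 = -C a b 2 3 := fun a b => r a b 3 2
  have r13 : ∀ a b, C a b 1 3 = -C a b 3 1 := fun a b => r a b 1 3
  have r21 : ∀ a b, C a b 2 1 = -C a b 1 2 := fun a b => r a b 2 1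
  have hx' : ∀ a b c, C a b c 0 * x 0 + C a b c 1 * x 1 + C a b c 2 * x 2 + C a b c 3 * x 3
      = 0 := by
    intro a b c; simpa [Fin.sum_univ_four] using hx a b c
  -- The hypotheses say that the 2-form `C a' b'` is the dual of `C a b`. Both annihilate `x`, so
  -- the cross-product system applies to the electric and magnetic parts of `C a b`.
  have key : ∀ a b a' b', C a' b' 0 1 = C a b 2 3 → C a' b' 0 2 = C a b 3 1 →
      C a' b' 0 3 = C a b 1 2 → C a' b' 2 3 = -C a b 0 1 → C a' b' 3 1 = -C a b 0 2 →
      C a' b' 1 2 = -C a b 0 3 → (C a b 0 1 = 0 ∧ C a b 0 2 = 0 ∧ C a b 0 3 = 0) ∧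
        C a b 2 3 = 0 ∧ C a b 3 1 = 0 ∧ C a b 1 2 = 0 := by
    intro a b a' b' h1 h2 h3 h4 h5 h6
    have u0 := hx' a b 0
    have u1 := hx' a b 1
    have u2 := hx' a b 2
    have u3 := hx' a b 3
    have v0 := hx' a' b' 0
    have v1 := hx' a' b' 1
    have v2 := hx' a' b' 2
    have v3 := hx' a' b' 3
    simp only [r10, r20, r30, r32, r13, r21, hd, h1, h2, h3, h4, h5, h6]
      at u0 u1 u2 u3 v0 v1 v2 v3
    exact eq_zero_of_cross_eqs hne (by linarith) (by linarith) (by linarith) (by linarith)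
      (by linarith) (by linarith) (by linarith) (by linarith)
  obtain ⟨⟨a11, a12, a13⟩, b11, b12, b13⟩ := key 0 1 2 3 (by rw [p]) (by rw [p, m12])
    (by rw [p, m13]) d11 d12 d13
  obtain ⟨⟨a21, a22, a23⟩, b21, b22, b23⟩ := key 0 2 3 1 (by rw [p, m12]) (by rw [p])
    (by rw [p, m23]) (by rw [p, d12, p 0 2 0 1]) d22 d23
  obtain ⟨⟨a31, a32, a33⟩, b31, b32, b33⟩ := key 0 3 1 2 (by rw [p, m13]) (by rw [p, m23])
    (by rw [p]) (by rw [p, d13, p 0 3 0 1]) (by rw [p, d23, p 0 3 0 2]) d33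
  have l13 : ∀ c d, C 1 3 c d = -C 3 1 c d := hC.skew_left 1 3
  refine hC.eq_zero (skew_eq_zero (r 0 1) ?_ ?_ ?_ ?_ ?_ ?_)
    (skew_eq_zero (r 0 2) ?_ ?_ ?_ ?_ ?_ ?_) (skew_eq_zero (r 0 3) ?_ ?_ ?_ ?_ ?_ ?_)
    ?_ ?_ ?_ ?_ ?_ ?_ <;> simp only [r13, l13, p 1 2 2 3, p 1 2 3 1, p 3 1 2 3, d11, d12, d13, d22,
      d23, d33, a11, a12, a13, a21, a22, a23,
      a31, a32, a33, b11, b12, b13, b21, b22, b23, b31, b32, b33, neg_zero]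

/-- The metric in a frame: `Eᵀ G E = N`, for invertible `N`. -/
theorem mul_mul_transpose_of_gram {G E N N' : Matrix (Fin 4) (Fin 4) ℝ} (hE : Eᵀ * G * E = N)
    (hN : N * N' = 1) : E * N' * Eᵀ = G⁻¹ := by
  have h1 : Eᵀ * (G * (E * N')) = 1 := by rw [← hN, ← hE]; simp only [Matrix.mul_assoc]
  have h2 : G * (E * N') * Eᵀ = 1 := mul_eq_one_comm.1 h1
  rw [Matrix.mul_assoc] at h2
  rw [Matrix.inv_eq_right_inv h2]

/-- The inverse of a frame. -/
theorem mul_coframe {G E N N' : Matrix (Fin 4) (Fin 4) ℝ} (hE : Eᵀ * G * E = N)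
    (hN : N * N' = 1) : E * (N' * Eᵀ * G) = 1 := by
  have h1 : N' * Eᵀ * G * E = 1 := by
    rw [Matrix.mul_assoc, Matrix.mul_assoc, ← Matrix.mul_assoc Eᵀ, hE, mul_eq_one_comm.1 hN]
  exact mul_eq_one_comm.1 h1

/-- A metric of Lorentzian signature. -/
def IsLorentzian (G : Matrix (Fin 4) (Fin 4) ℝ) : Prop := ∃ E, Eᵀ * G * E = minkowski

theorem minkowski_transpose : minkowskiᵀ = minkowski := by
  ext i j; fin_cases i <;> fin_cases j <;> simp [minkowski]

theorem IsLorentzian.symm {G : Matrix (Fin 4) (Fin 4) ℝ} (hG : IsLorentzian G) : Gᵀ = G := by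
  obtain ⟨E, hE⟩ := hG
  have h1 := mul_coframe hE minkowski_mul_self
  set F := minkowski * Eᵀ * G
  have h3 : G = Fᵀ * minkowski * F := by
    rw [← hE]
    calc G = (E * F)ᵀ * G * (E * F) := by rw [h1]; simp
      _ = _ := by rw [Matrix.transpose_mul]; simp only [Matrix.mul_assoc]
  rw [h3]
  simp only [Matrix.transpose_mul, Matrix.transpose_transpose, minkowski_transpose,
    Matrix.mul_assoc]

/-- Taking determinants in `Eᵀ G E = minkowski` gives `(det E)² det G = -1`. -/
theorem IsLorentzian.det_neg {G : Matrix (Fin 4) (Fin 4) ℝ} (hG : IsLorentzian G) : G.det < 0 := by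
  obtain ⟨E, hE⟩ := hG
  have h := congrArg Matrix.det hE
  have hm : minkowski.det = -1 := by
    simp [minkowski, Matrix.det_succ_row_zero, Fin.sum_univ_succ]
  rw [Matrix.det_mul, Matrix.det_mul, Matrix.det_transpose, hm] at h
  by_contra hn
  nlinarith [mul_nonneg (not_lt.1 hn) (sq_nonneg E.det)]

theorem gram_dotProduct {G E N : Matrix (Fin 4) (Fin 4) ℝ} (hE : Eᵀ * G * E = N)
    (x y : Fin 4 → ℝ) : (E *ᵥ x) ⬝ᵥ (G *ᵥ (E *ᵥ y)) = x ⬝ᵥ (N *ᵥ y) := by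
  rw [← hE, ← Matrix.mulVec_mulVec, ← Matrix.mulVec_mulVec, Matrix.dotProduct_mulVec x,
    Matrix.vecMul_transpose]

theorem minkowski_dotProduct (x y : Fin 4 → ℝ) :
    x ⬝ᵥ (minkowski *ᵥ y) = -(x 0 * y 0) + x 1 * y 1 + x 2 * y 2 + x 3 * y 3 := by
  simp [minkowski, Matrix.mulVec, dotProduct, Fin.sum_univ_four]

variable {G : Matrix (Fin 4) (Fin 4) ℝ} {C : Tensor4 ℝ}

theorem pull_ne_zero {E F : Matrix (Fin 4) (Fin 4) ℝ} (h : E * F = 1) (h0 : C ≠ 0) :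
    pull C E ≠ 0 := by
  intro hz
  apply h0
  rw [← pull_pull_of_mul_eq_one C h, hz, pull_zero]

/-- A nonzero Weyl tensor is annihilated by null vectors only. -/
theorem IsWeyl.null_of_inKer (hG : IsLorentzian G) (hC : IsWeyl G⁻¹ C) {ξ : Fin 4 → ℝ}
    (hξ : InKer C ξ) (h0 : C ≠ 0) : ξ ⬝ᵥ (G *ᵥ ξ) = 0 := by
  obtain ⟨E, hE⟩ := hG
  have h1 := mul_coframe hE minkowski_mul_self
  set F := minkowski * Eᵀ * G
  have h2 : ξ = E *ᵥ (F *ᵥ ξ) := by rw [Matrix.mulVec_mulVec, h1, Matrix.one_mulVec]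
  rw [h2] at hξ
  have := (hC.frame (mul_mul_transpose_of_gram hE minkowski_mul_self)).null_of_inKer_minkowski
    hξ.frame (pull_ne_zero h1 h0)
  rw [h2, gram_dotProduct hE, minkowski_dotProduct]
  linarith

/-- In Minkowski space, a conformal skew endomorphism whose rows are null vanishes. -/
theorem eq_zero_of_null_rows {L : Matrix (Fin 4) (Fin 4) ℝ} {φ : ℝ}
    (hs : ∀ i j, (L * minkowski) i j + (L * minkowski) j i = 2 * φ * minkowski i j)
    (hnull : ∀ i, L i 0 ^ 2 = L i 1 ^ 2 + L i 2 ^ 2 + L i 3 ^ 2) : L = 0 := by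
  have s00 := hs 0 0
  have s01 := hs 0 1
  have s02 := hs 0 2
  have s03 := hs 0 3
  have s11 := hs 1 1
  have s12 := hs 1 2
  have s13 := hs 1 3
  have s22 := hs 2 2
  have s23 := hs 2 3
  have s33 := hs 3 3
  simp [minkowski, Matrix.mul_apply, Fin.sum_univ_four] at s00 s01 s02 s03 s11 s12 s13 s22 s23 s33
  have n0 := hnull 0
  have n1 := hnull 1
  have n2 := hnull 2
  have n3 := hnull 3
  have a1 : L 1 0 = L 0 1 := by linarith
  have a2 : L 2 0 = L 0 2 := by linarith
  have a3 : L 3 0 = L 0 3 := by linarith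
  have a4 : L 2 1 = -L 1 2 := by linarith
  have a5 : L 3 1 = -L 1 3 := by linarith
  have a6 : L 3 2 = -L 2 3 := by linarith
  have a0 : L 0 0 = φ := by linarith
  have a7 : L 1 1 = φ := by linarith
  have a8 : L 2 2 = φ := by linarith
  have a9 : L 3 3 = φ := by linarith
  rw [a0] at n0
  rw [a1, a7, ← sub_eq_zero] at n1
  rw [a2, a4, a8, neg_sq] at n2
  rw [a3, a5, a6, a9, neg_sq, neg_sq] at n3
  have p0 := sq_nonneg φ
  have p1 := sq_nonneg (L 1 2)
  have p2 := sq_nonneg (L 1 3)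
  have p3 := sq_nonneg (L 2 3)
  -- With `S` the sum of the squares `p1`, `p2`, `p3`, adding `n1`, `n2`, `n3` and comparing with
  -- `n0` gives `φ² = 3 φ² + 2 S`, so `φ` and the rotation part vanish; the boost part then vanishes
  -- by `n1`, `n2`, `n3`.
  have z0 : φ = 0 := pow_eq_zero_iff two_ne_zero |>.1 (by linarith)
  have z1 : L 1 2 = 0 := pow_eq_zero_iff two_ne_zero |>.1 (by linarith)
  have z2 : L 1 3 = 0 := pow_eq_zero_iff two_ne_zero |>.1 (by linarith)
  have z3 : L 2 3 = 0 := pow_eq_zero_iff two_ne_zero |>.1 (by linarith)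
  rw [z0, z1, z2] at n1
  rw [z0, z1, z3] at n2
  rw [z0, z2, z3] at n3
  have z4 : L 0 1 = 0 := pow_eq_zero_iff two_ne_zero |>.1 (by linarith)
  have z5 : L 0 2 = 0 := pow_eq_zero_iff two_ne_zero |>.1 (by linarith)
  have z6 : L 0 3 = 0 := pow_eq_zero_iff two_ne_zero |>.1 (by linarith)
  rw [z4] at a1
  rw [z5] at a2
  rw [z6] at a3
  rw [z1, neg_zero] at a4
  rw [z2, neg_zero] at a5
  rw [z3, neg_zero] at a6
  rw [z0] at a0 a7 a8 a9
  ext i j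
  fin_cases i <;> fin_cases j <;> assumption

/-- If a nonzero Weyl tensor is annihilated by the derivative of a conformal Killing vector,
that derivative vanishes. -/
theorem IsWeyl.eq_zero_of_inKer_rows (hG : IsLorentzian G) (hC : IsWeyl G⁻¹ C) (h0 : C ≠ 0)
    {K : Matrix (Fin 4) (Fin 4) ℝ} (hK : ∀ e, InKer C (K e)) {φ : ℝ}
    (hφ : K * G + (K * G)ᵀ = (2 * φ) • G) : K = 0 := by
  have hS := hG.symm
  obtain ⟨E, hE⟩ := hG
  have h1 := mul_coframe hE minkowski_mul_self
  set F := minkowski * Eᵀ * G with hF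
  have h2 : F * E = 1 := mul_eq_one_comm.1 h1
  have hG' : G = Fᵀ * minkowski * F := by
    rw [← hE]
    calc G = (E * F)ᵀ * G * (E * F) := by rw [h1]; simp
      _ = _ := by rw [Matrix.transpose_mul]; simp only [Matrix.mul_assoc]
  -- `L` is the endomorphism in the orthonormal frame `E`, with `F` inverse to `E`. Its rows are
  -- combinations of those of `K`, so they still lie in the kernel of `C` and are null.
  set L := Eᵀ * K * Fᵀ with hL
  have hE' : Fᵀ * Eᵀ = 1 := by rw [← Matrix.transpose_mul, h1, Matrix.transpose_one]
  have hKL : K = Fᵀ * L * Eᵀ := by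
    calc K = (Fᵀ * Eᵀ) * K * (Fᵀ * Eᵀ) := by rw [hE']; simp
      _ = _ := by rw [hL]; simp only [Matrix.mul_assoc]
  have hLm : L * minkowski = Eᵀ * (K * G) * E := by
    calc L * minkowski = Eᵀ * K * Fᵀ * minkowski * (F * E) := by rw [h2, Matrix.mul_one]
      _ = Eᵀ * (K * (Fᵀ * minkowski * F)) * E := by simp only [Matrix.mul_assoc]
      _ = _ := by rw [← hG']
  have hsym : L * minkowski + (L * minkowski)ᵀ = (2 * φ) • minkowski := by
    have : (L * minkowski)ᵀ = Eᵀ * (K * G)ᵀ * E := by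
      rw [hLm]; simp only [Matrix.transpose_mul, Matrix.transpose_transpose, Matrix.mul_assoc]
    rw [this, hLm, ← Matrix.add_mul, ← Matrix.mul_add, hφ, Matrix.mul_smul, Matrix.smul_mul, hE]
  have hker : ∀ i, InKer C (E *ᵥ L i) := by
    intro i a b c
    have : E *ᵥ L i = fun d => ∑ e, E e i * K e d := by
      have h3 : E * Lᵀ = Kᵀ * E := by
        rw [hL]; simp only [Matrix.transpose_mul, Matrix.transpose_transpose]
        rw [← Matrix.mul_assoc, ← Matrix.mul_assoc, h1, Matrix.one_mul]
      funext d
      have h4 := congrFun (congrFun h3 d) i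
      simp only [Matrix.mul_apply, Matrix.transpose_apply] at h4
      rw [Matrix.mulVec, dotProduct, h4]
      exact Finset.sum_congr rfl fun e _ => mul_comm _ _
    rw [this]
    simp only [Finset.mul_sum]
    rw [Finset.sum_comm]
    refine Finset.sum_eq_zero fun e _ => ?_
    rw [← mul_zero (E e i), ← hK e a b c, Finset.mul_sum]
    exact Finset.sum_congr rfl fun d _ => by ring
  have hnull : ∀ i, L i 0 ^ 2 = L i 1 ^ 2 + L i 2 ^ 2 + L i 3 ^ 2 := fun i =>
    (hC.frame (mul_mul_transpose_of_gram hE minkowski_mul_self)).null_of_inKer_minkowski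
      (hker i).frame (pull_ne_zero h1 h0)
  have hs : ∀ i j, (L * minkowski) i j + (L * minkowski) j i = 2 * φ * minkowski i j := fun i j =>
    congrFun (congrFun hsym i) j
  have hLz : L = 0 := eq_zero_of_null_rows hs hnull
  rw [hKL, hLz]; simp

/-- A nonzero Weyl tensor determines the derivative of the conformal factor. -/
theorem IsWeyl.eq_zero_of_inKer_second (hGs : Gᵀ = G) (hG0 : G.det ≠ 0) (h0 : C ≠ 0)
    {θ : Fin 4 → ℝ} (h : ∀ a b c e f, C a b c f * θ e + C a b c e * θ f
      = G e f * ∑ d, C a b c d * (G⁻¹ *ᵥ θ) d) : θ = 0 := by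
  have hH : (G⁻¹)ᵀ = G⁻¹ := by rw [Matrix.transpose_nonsing_inv, hGs]
  have hH' : ∀ e f, G⁻¹ e f = G⁻¹ f e := fun e f => congrFun (congrFun hH f) e
  -- Contract the hypothesis over `e, f` with the inverse metric: the left side gives twice the sum
  -- `S`, the right side four times, so `S = 0`.
  have hz : ∀ a b c, ∑ d, C a b c d * (G⁻¹ *ᵥ θ) d = 0 := by
    intro a b c
    set S := ∑ d, C a b c d * (G⁻¹ *ᵥ θ) d with hS
    have h1 : ∑ e, ∑ f, G⁻¹ e f * (C a b c f * θ e) = S := by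
      rw [Finset.sum_comm, hS]
      refine Finset.sum_congr rfl fun f _ => ?_
      rw [Matrix.mulVec, dotProduct, Finset.mul_sum]
      exact Finset.sum_congr rfl fun e _ => by rw [hH' e f]; ring
    have h2 : ∑ e, ∑ f, G⁻¹ e f * (C a b c e * θ f) = S := by
      rw [hS]
      refine Finset.sum_congr rfl fun f _ => ?_
      rw [Matrix.mulVec, dotProduct, Finset.mul_sum]
      exact Finset.sum_congr rfl fun e _ => by ring
    have h3 : ∑ e, ∑ f, G⁻¹ e f * (G e f * S) = 4 * S := by
      have : (G⁻¹ * G).trace = 4 := by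
        rw [Matrix.nonsing_inv_mul _ hG0.isUnit, Matrix.trace_one]; simp
      rw [← this, Matrix.trace, Finset.sum_mul]
      refine Finset.sum_congr rfl fun e _ => ?_
      rw [Matrix.diag_apply, Matrix.mul_apply, Finset.sum_mul]
      refine Finset.sum_congr rfl fun f _ => ?_
      rw [show G e f = G f e from congrFun (congrFun hGs f) e]
      ring
    have : S + S = 4 * S := by
      calc S + S = (∑ e, ∑ f, G⁻¹ e f * (C a b c f * θ e))
            + ∑ e, ∑ f, G⁻¹ e f * (C a b c e * θ f) := by rw [h1, h2]
        _ = ∑ e, ∑ f, G⁻¹ e f * (G e f * S) := by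
          rw [← Finset.sum_add_distrib]
          refine Finset.sum_congr rfl fun e _ => ?_
          rw [← Finset.sum_add_distrib]
          exact Finset.sum_congr rfl fun f _ => by rw [← mul_add, h]
        _ = 4 * S := h3
    linarith
  have h' : ∀ a b c e f, C a b c f * θ e + C a b c e * θ f = 0 := fun a b c e f => by
    rw [h, hz, mul_zero]
  by_contra hθ
  apply h0
  -- If `θ e ≠ 0`, taking `f = e` kills the components of `C` with last index `e`, and then a
  -- general `f` kills all the others.
  obtain ⟨e, he⟩ := Function.ne_iff.1 hθ
  have h1 : ∀ a b c, C a b c e = 0 := fun a b c => by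
    have := h' a b c e e
    have he' : θ e ≠ 0 := he
    have : C a b c e * θ e = 0 := by linarith
    exact (mul_eq_zero.1 this).resolve_right he'
  funext a b c f
  have := h' a b c e f
  rw [h1, zero_mul, add_zero] at this
  exact (mul_eq_zero.1 this).resolve_right he

end WeylAlgebra

/-! ### Null tetrads and Weyl scalars in real form. -/

section WeylAlgebra

open Matrix

variable {G : Matrix (Fin 4) (Fin 4) ℝ} {C : Tensor4 ℝ}

/-- The real frame `(l, k, Re m, Im m)`. -/
def realFrame (l k : Fin 4 → ℝ) (m : Fin 4 → ℂ) : Matrix (Fin 4) (Fin 4) ℝ :=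
  Matrix.of fun a i => ![l a, k a, (m a).re, (m a).im] i

theorem cdot_mulVec (G E : Matrix (Fin 4) (Fin 4) ℝ) (v w : Fin 4 → ℂ) :
    cdot G (E.map Complex.ofReal *ᵥ v) (E.map Complex.ofReal *ᵥ w) = cdot (Eᵀ * G * E) v w := by
  have h : ∀ (H : Matrix (Fin 4) (Fin 4) ℝ) (v w : Fin 4 → ℂ),
      cdot H v w = v ⬝ᵥ (H.map Complex.ofReal *ᵥ w) := by
    intro H v w
    simp only [cdot, dotProduct, Matrix.mulVec, Finset.mul_sum, Matrix.map_apply]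
    exact Finset.sum_congr rfl fun a _ => Finset.sum_congr rfl fun b _ => by ring
  have h2 : (Eᵀ * G * E).map Complex.ofReal
      = (E.map Complex.ofReal)ᵀ * G.map Complex.ofReal * E.map Complex.ofReal := by
    have := fun A B : Matrix (Fin 4) (Fin 4) ℝ => Matrix.map_mul (L := A) (M := B)
      (f := Complex.ofRealHom)
    rw [show (Complex.ofReal : ℝ → ℂ) = Complex.ofRealHom from rfl, this, this,
      Matrix.transpose_map]
  rw [h, h, h2, ← Matrix.mulVec_mulVec, ← Matrix.mulVec_mulVec, Matrix.dotProduct_mulVec v,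
    Matrix.vecMul_transpose]

theorem ceval_mulVec (C : Tensor4 ℝ) (E : Matrix (Fin 4) (Fin 4) ℝ) (v w x y : Fin 4 → ℂ) :
    ceval C (E.map Complex.ofReal *ᵥ v) (E.map Complex.ofReal *ᵥ w) (E.map Complex.ofReal *ᵥ x)
      (E.map Complex.ofReal *ᵥ y) = ceval (pull C E) v w x y := by
  have h : ∀ D : Tensor4 ℝ, ceval D = teval fun a b c d => (D a b c d : ℂ) := fun _ => rfl
  rw [h, h, teval_mulVec]
  congr 1
  funext i j k l
  simp [pull, teval]

theorem toC_realFrame_left (l k : Fin 4 → ℝ) (m : Fin 4 → ℂ) :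
    toC l = (realFrame l k m).map Complex.ofReal *ᵥ ![1, 0, 0, 0] := by
  funext a; simp [toC, realFrame, Matrix.mulVec, dotProduct, Fin.sum_univ_four]

theorem toC_realFrame_right (l k : Fin 4 → ℝ) (m : Fin 4 → ℂ) :
    toC k = (realFrame l k m).map Complex.ofReal *ᵥ ![0, 1, 0, 0] := by
  funext a; simp [toC, realFrame, Matrix.mulVec, dotProduct, Fin.sum_univ_four]

theorem realFrame_complex (l k : Fin 4 → ℝ) (m : Fin 4 → ℂ) :
    m = (realFrame l k m).map Complex.ofReal *ᵥ ![0, 0, 1, Complex.I] := by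
  funext a
  simp [realFrame, Matrix.mulVec, dotProduct, Fin.sum_univ_four, Complex.re_add_im]

theorem realFrame_conj (l k : Fin 4 → ℝ) (m : Fin 4 → ℂ) :
    conjV m = (realFrame l k m).map Complex.ofReal *ᵥ ![0, 0, 1, -Complex.I] := by
  funext a
  apply Complex.ext <;>
    simp [conjV, realFrame, Matrix.mulVec, dotProduct, Fin.sum_univ_four]

/-- Splitting `m` into real and imaginary parts, `m·m = 0` and `m·m̄ = 1` say that these parts are
orthogonal with square `1/2` each, which explains the entries of `nullGram`. All later algebra can
then be done over `ℝ`. -/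
theorem isNullTetrad_iff (hG : Gᵀ = G) (l k : Fin 4 → ℝ) (m : Fin 4 → ℂ) :
    IsNullTetrad G l k m ↔ (realFrame l k m)ᵀ * G * realFrame l k m = nullGram := by
  set E := realFrame l k m with hE
  set N := Eᵀ * G * E with hN
  have hs : ∀ i j, N i j = N j i := by
    have : Nᵀ = N := by
      rw [hN]; simp only [Matrix.transpose_mul, Matrix.transpose_transpose, hG, Matrix.mul_assoc]
    exact fun i j => (congrFun (congrFun this i) j).symm
  have e1 : cdot G (toC l) (toC l) = N 0 0 := by
    rw [toC_realFrame_left l k m, cdot_mulVec]; simp [cdot, Fin.sum_univ_four, hN, hE]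
  have e2 : cdot G (toC k) (toC k) = N 1 1 := by
    rw [toC_realFrame_right l k m, cdot_mulVec]; simp [cdot, Fin.sum_univ_four, hN, hE]
  have e3 : cdot G m m = N 2 2 - N 3 3 + 2 * N 2 3 * Complex.I := by
    conv_lhs => rw [realFrame_complex l k m]
    rw [cdot_mulVec, ← hE, ← hN]
    simp [cdot, Fin.sum_univ_four, hs 3 2]
    linear_combination (N 3 3 : ℂ) * Complex.I_mul_I
  have e4 : cdot G (toC l) m = N 0 2 + N 0 3 * Complex.I := by
    conv_lhs => rw [toC_realFrame_left l k m]; arg 3; rw [realFrame_complex l k m]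
    rw [cdot_mulVec]; simp [cdot, Fin.sum_univ_four, hN, hE]
  have e5 : cdot G (toC k) m = N 1 2 + N 1 3 * Complex.I := by
    conv_lhs => rw [toC_realFrame_right l k m]; arg 3; rw [realFrame_complex l k m]
    rw [cdot_mulVec]; simp [cdot, Fin.sum_univ_four, hN, hE]
  have e6 : cdot G (toC l) (toC k) = N 0 1 := by
    rw [toC_realFrame_left l k m, toC_realFrame_right l k m, cdot_mulVec]
    simp [cdot, Fin.sum_univ_four, hN, hE]
  have e7 : cdot G m (conjV m) = N 2 2 + N 3 3 := by
    rw [realFrame_conj l k m]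
    conv_lhs => arg 2; rw [realFrame_complex l k m]
    rw [cdot_mulVec, ← hE, ← hN]
    simp [cdot, Fin.sum_univ_four, hs 3 2]
    linear_combination -(N 3 3 : ℂ) * Complex.I_mul_I
  constructor
  · intro h
    have h1 := h.ll
    have h2 := h.kk
    have h3 := h.mm
    have h4 := h.lm
    have h5 := h.km
    have h6 := h.lk
    have h7 := h.mmbar
    rw [e1] at h1
    rw [e2] at h2
    rw [e3] at h3
    rw [e4] at h4
    rw [e5] at h5
    rw [e6] at h6
    rw [e7] at h7
    norm_cast at h1 h2 h7
    have h6r := congrArg Complex.re h6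
    have h3r := congrArg Complex.re h3
    have h3i := congrArg Complex.im h3
    have h4r := congrArg Complex.re h4
    have h4i := congrArg Complex.im h4
    have h5r := congrArg Complex.re h5
    have h5i := congrArg Complex.im h5
    simp at h3r h3i h4r h4i h5r h5i h6r
    have n22 : N 2 2 = 2⁻¹ := by linarith
    have n33 : N 3 3 = 2⁻¹ := by linarith
    ext i j
    fin_cases i <;> fin_cases j <;>
      simp [nullGram, hs 1 0, hs 2 0, hs 3 0, hs 2 1, hs 3 1, hs 3 2, h1, h2, h3i, h4r, h4i,
        h5r, h5i, h6r, n22, n33]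
  · intro h
    rw [h] at e1 e2 e3 e4 e5 e6 e7
    refine ⟨?_, ?_, ?_, ?_, ?_, ?_, ?_⟩
    · rw [e1]; simp [nullGram]
    · rw [e2]; simp [nullGram]
    · rw [e3]; simp [nullGram]
    · rw [e4]; simp [nullGram]
    · rw [e5]; simp [nullGram]
    · rw [e6]; simp [nullGram]
    · rw [e7]; simp [nullGram]; norm_num

section Psi

variable (l k : Fin 4 → ℝ) (m : Fin 4 → ℂ)

/-- Frame indices `0, 1, 2, 3` stand for `l, k, Re m, Im m`. Here and in the four lemmas that
follow, the two real conditions are the real and imaginary parts of the scalar. -/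
theorem psi0_eq_zero_iff {D : Tensor4 ℝ} (hD : pull C (realFrame l k m) = D) :
    Psi0 C l m = 0 ↔ D 0 2 0 2 = D 0 3 0 3 ∧ D 0 2 0 3 + D 0 3 0 2 = 0 := by
  have h := ceval_mulVec C (realFrame l k m) ![1, 0, 0, 0] ![0, 0, 1, Complex.I] ![1, 0, 0, 0]
    ![0, 0, 1, Complex.I]
  rw [← toC_realFrame_left, ← realFrame_complex, hD] at h
  rw [Psi0, h, Complex.ext_iff]
  simp [ceval, Fin.sum_univ_four]
  intro _
  constructor <;> intro h2 <;> linarith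

theorem psi1_eq_zero_iff {D : Tensor4 ℝ} (hD : pull C (realFrame l k m) = D) :
    Psi1 C l k m = 0 ↔ D 0 1 0 2 = 0 ∧ D 0 1 0 3 = 0 := by
  have h := ceval_mulVec C (realFrame l k m) ![1, 0, 0, 0] ![0, 1, 0, 0] ![1, 0, 0, 0]
    ![0, 0, 1, Complex.I]
  rw [← toC_realFrame_left, ← toC_realFrame_right, ← realFrame_complex, hD] at h
  rw [Psi1, h, Complex.ext_iff]
  simp [ceval, Fin.sum_univ_four]

theorem psi2_eq_zero_iff {D : Tensor4 ℝ} (hD : pull C (realFrame l k m) = D) :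
    Psi2 C l k m = 0 ↔ D 0 2 2 1 + D 0 3 3 1 = 0 ∧ D 0 3 2 1 = D 0 2 3 1 := by
  have h := ceval_mulVec C (realFrame l k m) ![1, 0, 0, 0] ![0, 0, 1, Complex.I]
    ![0, 0, 1, -Complex.I] ![0, 1, 0, 0]
  rw [← toC_realFrame_left, ← toC_realFrame_right, ← realFrame_complex, ← realFrame_conj, hD] at h
  rw [Psi2, h, Complex.ext_iff]
  simp [ceval, Fin.sum_univ_four]
  intro _
  constructor <;> intro h2 <;> linarith

theorem psi3_eq_zero_iff {D : Tensor4 ℝ} (hD : pull C (realFrame l k m) = D) :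
    Psi3 C l k m = 0 ↔ D 0 1 2 1 = 0 ∧ D 0 1 3 1 = 0 := by
  have h := ceval_mulVec C (realFrame l k m) ![1, 0, 0, 0] ![0, 1, 0, 0]
    ![0, 0, 1, -Complex.I] ![0, 1, 0, 0]
  rw [← toC_realFrame_left, ← toC_realFrame_right, ← realFrame_conj, hD] at h
  rw [Psi3, h, Complex.ext_iff]
  simp [ceval, Fin.sum_univ_four]

theorem psi4_eq_zero_iff {D : Tensor4 ℝ} (hD : pull C (realFrame l k m) = D) :
    Psi4 C k m = 0 ↔ D 1 2 1 2 = D 1 3 1 3 ∧ D 1 2 1 3 + D 1 3 1 2 = 0 := by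
  have h := ceval_mulVec C (realFrame l k m) ![0, 1, 0, 0] ![0, 0, 1, -Complex.I] ![0, 1, 0, 0]
    ![0, 0, 1, -Complex.I]
  rw [← toC_realFrame_right, ← realFrame_conj, hD] at h
  rw [Psi4, h, Complex.ext_iff]
  simp [ceval, Fin.sum_univ_four]
  constructor <;> rintro ⟨h1, h2⟩ <;> constructor <;> linarith

end Psi

theorem nullGram_dotProduct (x y : Fin 4 → ℝ) :
    x ⬝ᵥ (nullGram *ᵥ y) = -(x 0 * y 1) - x 1 * y 0 + (x 2 * y 2 + x 3 * y 3) / 2 := by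
  simp [nullGram, Matrix.mulVec, dotProduct, Fin.sum_univ_four]
  ring

/-- The trace condition in a null frame. -/
theorem IsWeyl.nullGram_trace {D : Tensor4 ℝ} (hD : IsWeyl nullGramInv D) (b d : Fin 4) :
    D 0 b 1 d + D 1 b 0 d = 2 * D 2 b 2 d + 2 * D 3 b 3 d := by
  have := hD.trace b d
  simp [Fin.sum_univ_four, nullGramInv] at this
  linarith

/-- The Weyl tensors whose first four Weyl scalars vanish in a null frame: all components with
an index along the first frame vector vanish, and so do two others. -/
theorem IsWeyl.typeN_components {D : Tensor4 ℝ} (hD : IsWeyl nullGramInv D)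
    (h0 : D 0 2 0 2 = D 0 3 0 3 ∧ D 0 2 0 3 + D 0 3 0 2 = 0) (h1 : D 0 1 0 2 = 0 ∧ D 0 1 0 3 = 0)
    (h2 : D 0 2 2 1 + D 0 3 3 1 = 0 ∧ D 0 3 2 1 = D 0 2 3 1)
    (h3 : D 0 1 2 1 = 0 ∧ D 0 1 3 1 = 0) :
    (∀ b c d, D 0 b c d = 0) ∧ D 1 3 1 3 = -D 1 2 1 2 ∧ D 1 2 2 3 = 0 ∧ D 1 3 2 3 = 0 ∧
      D 2 3 2 3 = 0 := by
  have hd : ∀ a c d, D a a c d = 0 := fun a c d => by linarith [hD.skew_left a a c d]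
  have hd' : ∀ a c d, D c d a a = 0 := fun a c d => by linarith [hD.skew_right c d a a]
  have l := hD.skew_left
  have r := hD.skew_right
  have p := hD.pair
  have t := hD.nullGram_trace
  have cy := hD.cyclic 0 1 2 3
  -- Trace and cyclic identities leave ten independent components, which are the real and imaginary
  -- parts of the five Weyl scalars. With four scalars zero only the two components of `Ψ₄` can
  -- remain.
  have t00 := t 0 0
  have t01 := t 0 1
  have t02 := t 0 2
  have t03 := t 0 3
  have t11 := t 1 1
  have t12 := t 1 2
  have t13 := t 1 3
  have t22 := t 2 2
  have t23 := t 2 3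
  have t33 := t 3 3
  have l10 := l 1 0
  have l20 := l 2 0
  have r20 := fun a b => r a b 2 0
  have l30 := l 3 0
  have r30 := fun a b => r a b 3 0
  have l21 := l 2 1
  have r21 := fun a b => r a b 2 1
  have l31 := l 3 1
  have r31 := fun a b => r a b 3 1
  have l32 := l 3 2
  have r32 := fun a b => r a b 3 2
  obtain ⟨h0, h0'⟩ := h0
  obtain ⟨h1, h1'⟩ := h1
  obtain ⟨h2, h2'⟩ := h2
  obtain ⟨h3, h3'⟩ := h3
  simp only [hd, hd', l10, l20, r20, l30, r30, l21, r21, l31, r31, l32, r32, p 0 3 0 2, p 1 2 0 2,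
    p 1 2 0 3, p 1 3 0 3]
    at t00 t01 t02 t03 t11 t12 t13 t22 t23 t33 cy h0 h0' h1 h1' h2 h2' h3 h3'
  have e01 : ∀ c d, D 0 1 c d = 0 := skew_eq_zero (r 0 1) (by linarith) (by linarith)
    (by linarith) (by linarith) (by linarith) (by linarith)
  have e02 : ∀ c d, D 0 2 c d = 0 := skew_eq_zero (r 0 2) (by rw [p, e01]) (by linarith)
    (by linarith) (by linarith) (by linarith) (by linarith)
  have e03 : ∀ c d, D 0 3 c d = 0 := skew_eq_zero (r 0 3) (by rw [p, e01]) (by rw [p, e02])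
    (by linarith) (by linarith) (by linarith) (by linarith)
  refine ⟨fun b c d => ?_, ?_, ?_, ?_, ?_⟩
  · fin_cases b
    exacts [hd 0 c d, e01 c d, e02 c d, e03 c d]
  · linarith
  · linarith [e01 1 3]
  · linarith [e01 1 2]
  · linarith [e02 1 2, h0]

/-- The Petrov type N condition, and the kernel of the Weyl tensor, in a null frame. -/
theorem IsWeyl.eq_zero_of_nullGram {D : Tensor4 ℝ} (hD : IsWeyl nullGramInv D)
    (h0 : ∀ b c d, D 0 b c d = 0) (h4 : D 1 2 1 2 = D 1 3 1 3 ∧ D 1 2 1 3 + D 1 3 1 2 = 0) :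
    D = 0 := by
  have p := hD.pair
  obtain ⟨-, g2, g3, g4, g5⟩ := hD.typeN_components (by simp [h0]) (by simp [h0]) (by simp [h0])
    (by simp [h0])
  refine hD.eq_zero (h0 1) (h0 2) (h0 3) (by linarith) (by linarith [p 1 3 1 2]) g3 (by linarith)
    g4 g5

end WeylAlgebra

/-! ### Type N and annihilation of the Weyl tensor by its repeated null direction. -/

section WeylAlgebra

open Matrix

variable {G : Matrix (Fin 4) (Fin 4) ℝ} {C : Tensor4 ℝ}

/-- Extend the unit vector to an orthonormal basis of `ℝ³`; the pair supplies the transverse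
directions of a null frame. -/
theorem exists_orthonormal_pair {n1 n2 n3 : ℝ} (h : n1 ^ 2 + n2 ^ 2 + n3 ^ 2 = 1) :
    ∃ p q : Fin 3 → ℝ, p 0 ^ 2 + p 1 ^ 2 + p 2 ^ 2 = 1 ∧ q 0 ^ 2 + q 1 ^ 2 + q 2 ^ 2 = 1 ∧
      p 0 * q 0 + p 1 * q 1 + p 2 * q 2 = 0 ∧ n1 * p 0 + n2 * p 1 + n3 * p 2 = 0 ∧
      n1 * q 0 + n2 * q 1 + n3 * q 2 = 0 := by
  set v : EuclideanSpace ℝ (Fin 3) := !₂[n1, n2, n3] with hv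
  have hin : ∀ x y : EuclideanSpace ℝ (Fin 3), inner ℝ x y = x 0 * y 0 + x 1 * y 1 + x 2 * y 2 := by
    intro x y
    simp [PiLp.inner_apply, Fin.sum_univ_three]
    ring
  have hnv : ‖v‖ = 1 := by
    have : ‖v‖ ^ 2 = 1 := by
      rw [← real_inner_self_eq_norm_sq, hin, ← h]; simp [hv]; ring
    exact (pow_eq_one_iff_of_nonneg (norm_nonneg v) two_ne_zero).1 this
  have ho : Orthonormal ℝ (({0} : Set (Fin 3)).domRestrict fun _ => v) := by
    constructor
    · intro i; exact hnv
    · intro i j hij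
      exact absurd (Subsingleton.elim i j) hij
  obtain ⟨b, hb⟩ := ho.exists_orthonormalBasis_extension_of_card_eq (by simp)
  have h0 : b 0 = v := hb 0 rfl
  have hb' := fun i j => orthonormal_iff_ite.1 b.orthonormal i j
  have h11 := hb' 1 1
  have h22 := hb' 2 2
  have h12 := hb' 1 2
  have h01 := hb' 0 1
  have h02 := hb' 0 2
  rw [hin] at h11 h22 h12 h01 h02
  rw [h0] at h01 h02
  simp [hv] at h11 h22 h12 h01 h02
  exact ⟨fun i => b 1 i, fun i => b 2 i, by linarith, by linarith, h12, h01, h02⟩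

/-- A nonzero null vector is the first vector of a null frame. -/
theorem exists_nullFrame (hG : IsLorentzian G) {ξ : Fin 4 → ℝ} (h0 : ξ ≠ 0)
    (hξ : ξ ⬝ᵥ (G *ᵥ ξ) = 0) : ∃ F : Matrix (Fin 4) (Fin 4) ℝ, Fᵀ * G * F = nullGram ∧
      F.col 0 = ξ := by
  obtain ⟨E, hE⟩ := hG
  have h1 := mul_coframe hE minkowski_mul_self
  set E' := minkowski * Eᵀ * G
  set x := E' *ᵥ ξ with hx
  have h2 : E *ᵥ x = ξ := by rw [hx, Matrix.mulVec_mulVec, h1, Matrix.one_mulVec]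
  rw [← h2, gram_dotProduct hE, minkowski_dotProduct] at hξ
  have hx0 : x 0 ≠ 0 := by
    intro hz
    apply h0
    rw [← h2]
    have e1 : x 1 = 0 := by nlinarith [sq_nonneg (x 1), sq_nonneg (x 2), sq_nonneg (x 3)]
    have e2 : x 2 = 0 := by nlinarith [sq_nonneg (x 1), sq_nonneg (x 2), sq_nonneg (x 3)]
    have e3 : x 3 = 0 := by nlinarith [sq_nonneg (x 1), sq_nonneg (x 2), sq_nonneg (x 3)]
    have : x = 0 := by funext i; fin_cases i <;> assumption
    rw [this, Matrix.mulVec_zero]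
  obtain ⟨p, q, hpp, hqq, hpq, hp, hq⟩ := exists_orthonormal_pair (n1 := x 1 / x 0)
    (n2 := x 2 / x 0) (n3 := x 3 / x 0) (by field_simp; linarith)
  have hp' : x 1 * p 0 + x 2 * p 1 + x 3 * p 2 = 0 := by
    field_simp at hp; linarith
  have hq' : x 1 * q 0 + x 2 * q 1 + x 3 * q 2 = 0 := by
    field_simp at hq; linarith
  -- The second null vector is `z` times `x` with its spatial part reversed. Its product with `x` is
  -- `-2 z x₀²`, so this `z` normalises it to `-1`; `r` gives the transverse vectors square `1/2`.
  obtain ⟨z, hz⟩ : ∃ z, 2 * z * x 0 ^ 2 = 1 := ⟨1 / (2 * x 0 ^ 2), by field_simp⟩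
  obtain ⟨r, hr⟩ : ∃ r : ℝ, r ^ 2 = 1 / 2 := ⟨Real.sqrt (1 / 2), Real.sq_sqrt (by norm_num)⟩
  set L : Matrix (Fin 4) (Fin 4) ℝ := !![x 0, z * x 0, 0, 0; x 1, -(z * x 1), r * p 0, r * q 0;
    x 2, -(z * x 2), r * p 1, r * q 1; x 3, -(z * x 3), r * p 2, r * q 2] with hL
  -- Comparing bilinear forms on arbitrary `v, w` checks all sixteen Gram entries with one
  -- polynomial identity.
  have hgram : ∀ v w, (L *ᵥ v) ⬝ᵥ (minkowski *ᵥ (L *ᵥ w)) = v ⬝ᵥ (nullGram *ᵥ w) := by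
    intro v w
    rw [minkowski_dotProduct, nullGram_dotProduct]
    simp [hL, Matrix.mulVec, dotProduct, Fin.sum_univ_four]
    have hξ' : x 1 ^ 2 + x 2 ^ 2 + x 3 ^ 2 = x 0 ^ 2 := by linarith
    linear_combination (v 0 - z * v 1) * (w 0 - z * w 1) * hξ' - (v 0 * w 1 + v 1 * w 0) * hz
      + r ^ 2 * v 2 * w 2 * hpp + r ^ 2 * v 3 * w 3 * hqq + (v 2 * w 2 + v 3 * w 3) * hr
      + r ^ 2 * (v 2 * w 3 + v 3 * w 2) * hpq
      + r * ((v 0 - z * v 1) * w 2 + (w 0 - z * w 1) * v 2) * hp'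
      + r * ((v 0 - z * v 1) * w 3 + (w 0 - z * w 1) * v 3) * hq'
  refine ⟨E * L, ?_, ?_⟩
  · have e1 : (E * L)ᵀ * G * (E * L) = Lᵀ * minkowski * L := by
      rw [← hE, Matrix.transpose_mul]; simp only [Matrix.mul_assoc]
    rw [e1]
    apply Matrix.ext_of_mulVec_single
    intro j
    refine dotProduct_eq _ _ fun v => ?_
    rw [dotProduct_comm _ v, dotProduct_comm _ v, ← hgram, ← Matrix.mulVec_mulVec,
      ← Matrix.mulVec_mulVec, Matrix.dotProduct_mulVec v, Matrix.vecMul_transpose]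
  · have : (E * L).col 0 = E *ᵥ L.col 0 := rfl
    rw [this, ← h2]
    congr 1
    funext i
    fin_cases i <;> rfl

/-- A nonzero Weyl tensor annihilated by a nonzero vector `ξ` is of Petrov type N, and `ξ` is its
repeated principal null direction. -/
theorem IsWeyl.typeN_of_inKer (hG : IsLorentzian G) (hC : IsWeyl G⁻¹ C) {ξ : Fin 4 → ℝ}
    (hξ : InKer C ξ) (h0 : C ≠ 0) (hξ0 : ξ ≠ 0) :
    IsPetrovTypeN G C ∧ IsRepeatedPND G C ξ := by
  obtain ⟨F, hF, hcol⟩ := exists_nullFrame hG hξ0 (hC.null_of_inKer hG hξ h0)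
  set k := F.col 1
  set m : Fin 4 → ℂ := fun a => ⟨F a 2, F a 3⟩ with hm
  have hframe : realFrame ξ k m = F := by
    ext a i
    rw [← hcol]
    fin_cases i <;> rfl
  have hT : IsNullTetrad G ξ k m := by
    rw [isNullTetrad_iff hG.symm, hframe, hF]
  have hD := hC.frame (mul_mul_transpose_of_gram hF nullGram_mul_inv)
  have hFi := mul_coframe hF nullGram_mul_inv
  have hker : InKer (pull C F) ![1, 0, 0, 0] := by
    apply InKer.frame
    have : F *ᵥ ![1, 0, 0, 0] = ξ := by
      rw [← hcol]; funext i; simp [Matrix.mulVec, dotProduct, Fin.sum_univ_four]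
    rwa [this]
  -- Each of `Ψ₀` to `Ψ₃` involves `l = ξ`, so all four vanish; were `Ψ₄` zero as well, the whole
  -- tensor would be.
  have hk : ∀ b c d, pull C F 0 b c d = 0 := by
    intro b c d
    have := hker c d b
    simp [Fin.sum_univ_four] at this
    rw [hD.pair, hD.skew_right, this, neg_zero]
  have p0 : Psi0 C ξ m = 0 := by rw [psi0_eq_zero_iff _ k _ (by rw [hframe])]; simp [hk]
  have p1 : Psi1 C ξ k m = 0 := by rw [psi1_eq_zero_iff _ _ _ (by rw [hframe])]; simp [hk]
  have p2 : Psi2 C ξ k m = 0 := by rw [psi2_eq_zero_iff _ _ _ (by rw [hframe])]; simp [hk]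
  have p3 : Psi3 C ξ k m = 0 := by rw [psi3_eq_zero_iff _ _ _ (by rw [hframe])]; simp [hk]
  have p4 : Psi4 C k m ≠ 0 := by
    rw [Ne, psi4_eq_zero_iff ξ _ _ (by rw [hframe])]
    exact fun h => pull_ne_zero hFi h0 (hD.eq_zero_of_nullGram hk h)
  exact ⟨⟨ξ, k, m, hT, p0, p1, p2, p3, p4⟩, k, m, hT, p0, p1⟩

/-- If `Ψ₀ = Ψ₁ = 0`, then `C(ξ, x, ξ, y)` is a multiple of `(ξ·x)(ξ·y)`. -/
theorem IsWeyl.repeatedPND_form {D : Tensor4 ℝ} (hD : IsWeyl nullGramInv D)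
    (h0 : D 0 2 0 2 = D 0 3 0 3 ∧ D 0 2 0 3 + D 0 3 0 2 = 0) (h1 : D 0 1 0 2 = 0 ∧ D 0 1 0 3 = 0)
    (v w : Fin 4 → ℝ) : teval D ![1, 0, 0, 0] v ![1, 0, 0, 0] w = D 0 1 0 1 * (v 1 * w 1) := by
  have hd : ∀ a c d, D a a c d = 0 := fun a c d => by linarith [hD.skew_left a a c d]
  have hd' : ∀ a c d, D c d a a = 0 := fun a c d => by linarith [hD.skew_right c d a a]
  have e1 : D 2 0 2 0 = D 0 2 0 2 := by rw [hD.skew_left, hD.skew_right, neg_neg]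
  have e2 : D 3 0 3 0 = D 0 3 0 3 := by rw [hD.skew_left, hD.skew_right, neg_neg]
  -- The trace makes `D 0 2 0 2` and `D 0 3 0 3` opposite, while `Ψ₀ = 0` makes them equal.
  have t := hD.nullGram_trace 0 0
  rw [hd, hd', e1, e2] at t
  have z1 : D 0 2 0 2 = 0 := by linarith [h0.1]
  have z2 : D 0 3 0 3 = 0 := by linarith [h0.1]
  have z3 : D 0 2 0 3 = 0 := by linarith [h0.2, hD.pair 0 2 0 3]
  have z4 : D 0 3 0 2 = 0 := by linarith [h0.2, hD.pair 0 2 0 3]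
  have z5 : D 0 2 0 1 = 0 := by rw [hD.pair]; exact h1.1
  have z6 : D 0 3 0 1 = 0 := by rw [hD.pair]; exact h1.2
  simp [teval, Fin.sum_univ_four, hd, hd', z1, z2, z3, z4, z5, z6, h1.1, h1.2]
  ring

/-- In the null frame of a Weyl tensor of type N, a null vector `x` for which `D(x, v, x, w)` is a
multiple of `(x·v)(x·w)` annihilates the tensor. -/
theorem IsWeyl.inKer_of_form {D : Tensor4 ℝ} (hD : IsWeyl nullGramInv D)
    (g0 : ∀ b c d, D 0 b c d = 0) (g1 : D 1 3 1 3 = -D 1 2 1 2) (g2 : D 1 2 2 3 = 0)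
    (g3 : D 1 3 2 3 = 0) (g4 : D 2 3 2 3 = 0)
    (p4 : ¬(D 1 2 1 2 = D 1 3 1 3 ∧ D 1 2 1 3 + D 1 3 1 2 = 0)) {x : Fin 4 → ℝ}
    (hnull : x ⬝ᵥ (nullGram *ᵥ x) = 0) {c : ℝ} (hc : ∀ v w, teval D x v x w
      = c * ((x ⬝ᵥ (nullGram *ᵥ v)) * (x ⬝ᵥ (nullGram *ᵥ w)))) : InKer D x := by
  have r := hD.skew_right
  have l := hD.skew_left
  have p := hD.pair
  have hk : ∀ b c d, D b 0 c d = 0 ∧ D b c 0 d = 0 ∧ D b c d 0 = 0 := fun b c d =>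
    ⟨by rw [l, g0, neg_zero], by rw [p, g0], by rw [r, p, g0, neg_zero]⟩
  have hd : ∀ a c d, D a a c d = 0 := fun a c d => by linarith [l a a c d]
  have hd' : ∀ a c d, D c d a a = 0 := fun a c d => by linarith [r c d a a]
  have a1 : D 1 2 3 2 = 0 := by rw [r, g2, neg_zero]
  have a2 : D 3 2 1 2 = 0 := by rw [p, a1]
  have a3 : D 3 2 3 2 = 0 := by rw [l, r, g4]; simp
  have a4 : D 2 3 1 3 = 0 := by rw [p, g3]
  have a5 : D 3 2 1 3 = 0 := by rw [l, a4, neg_zero]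
  have a6 : D 3 2 2 3 = 0 := by rw [l, g4, neg_zero]
  -- Test on the transverse vectors. The matrix with entries `D 1 i 1 j` times `x₁²` must equal
  -- `c/4` times that of `x_i x_j`, for `i, j` in `{2, 3}`. The former is trace-free, so the
  -- rank-one matrix on the right vanishes, and `Ψ₄ ≠ 0` forces `x₁ = 0`. Nullity then leaves a
  -- multiple of the first frame vector.
  have s22 := hc ![0, 0, 1, 0] ![0, 0, 1, 0]
  have s33 := hc ![0, 0, 0, 1] ![0, 0, 0, 1]
  have s23 := hc ![0, 0, 1, 0] ![0, 0, 0, 1]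
  simp only [nullGram_dotProduct, teval, Fin.sum_univ_four, Matrix.cons_val, hk, g0, hd, hd', g1,
    g2, g3, g4, a1, a2, a3, a4, a5, a6,
    mul_zero, zero_mul, mul_one, add_zero, zero_add, sub_zero, neg_zero] at s22 s33 s23
  rw [nullGram_dotProduct] at hnull
  have hx1 : x 1 = 0 := by
    by_contra hx1
    have hp : D 1 2 1 3 + D 1 3 1 2 = 2 * D 1 2 1 3 := by rw [p 1 3 1 2]; ring
    rw [hp, g1] at p4
    have e1 : c * (x 2 ^ 2 + x 3 ^ 2) = 0 := by linear_combination -4 * s22 - 4 * s33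
    have e2 : c * x 2 ^ 2 = 0 ∧ c * (x 2 * x 3) = 0 := by
      rcases mul_eq_zero.1 e1 with h | h
      · simp [h]
      · have h2 : x 2 = 0 := pow_eq_zero_iff two_ne_zero |>.1
          (by linarith [sq_nonneg (x 2), sq_nonneg (x 3)])
        simp [h2]
    have hx1' : x 1 ^ 2 ≠ 0 := pow_ne_zero _ hx1
    have e3 : D 1 2 1 2 * x 1 ^ 2 = 0 := by linear_combination s22 + e2.1 / 4
    have e4 : D 1 2 1 3 * x 1 ^ 2 = 0 := by linear_combination s23 + e2.2 / 4
    have e3' := (mul_eq_zero.1 e3).resolve_right hx1'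
    have e4' := (mul_eq_zero.1 e4).resolve_right hx1'
    exact p4 (by rw [e3', e4']; simp)
  rw [hx1] at hnull
  have hx2 : x 2 = 0 := pow_eq_zero_iff two_ne_zero |>.1
    (by linarith [sq_nonneg (x 2), sq_nonneg (x 3)])
  have hx3 : x 3 = 0 := pow_eq_zero_iff two_ne_zero |>.1
    (by linarith [sq_nonneg (x 2), sq_nonneg (x 3)])
  intro a b c
  simp [Fin.sum_univ_four, hk, hx1, hx2, hx3]

/-- The repeated principal null direction of a Weyl tensor of type N annihilates it. -/
theorem IsWeyl.inKer_of_typeN (hG : IsLorentzian G) (hC : IsWeyl G⁻¹ C) {ξ : Fin 4 → ℝ}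
    (hN : IsPetrovTypeN G C) (hP : IsRepeatedPND G C ξ) : InKer C ξ := by
  obtain ⟨l, k, m, hT, p0, p1, p2, p3, p4⟩ := hN
  obtain ⟨k', m', hT', q0, q1⟩ := hP
  rw [isNullTetrad_iff hG.symm] at hT hT'
  set E := realFrame l k m with hE
  set F := realFrame ξ k' m' with hF
  have hD := hC.frame (mul_mul_transpose_of_gram hT nullGram_mul_inv)
  have hD' := hC.frame (mul_mul_transpose_of_gram hT' nullGram_mul_inv)
  rw [psi0_eq_zero_iff l k m rfl, ← hE] at p0
  rw [psi1_eq_zero_iff l k m rfl, ← hE] at p1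
  rw [psi2_eq_zero_iff l k m rfl, ← hE] at p2
  rw [psi3_eq_zero_iff l k m rfl, ← hE] at p3
  rw [Ne, psi4_eq_zero_iff l k m rfl, ← hE] at p4
  rw [psi0_eq_zero_iff ξ k' m' rfl, ← hF] at q0
  rw [psi1_eq_zero_iff ξ k' m' rfl, ← hF] at q1
  have hEi := mul_coframe hT nullGram_mul_inv
  have hFi := mul_coframe hT' nullGram_mul_inv
  set E' := nullGramInv * Eᵀ * G
  set F' := nullGramInv * Fᵀ * G
  set D := pull C E with hDdef
  obtain ⟨g0, g1, g2, g3, g4⟩ := hD.typeN_components p0 p1 p2 p3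
  have hξ : F *ᵥ ![1, 0, 0, 0] = ξ := by
    funext a; simp [hF, realFrame, Matrix.mulVec, dotProduct, Fin.sum_univ_four]
  set x := E' *ᵥ ξ with hx
  have hx' : E *ᵥ x = ξ := by rw [hx, Matrix.mulVec_mulVec, hEi, Matrix.one_mulVec]
  -- In the tetrad starting with `ξ`, the product of `ξ` with a vector is minus its `k`-coefficient.
  -- The identity of `repeatedPND_form` is therefore frame independent, and can be transported to
  -- the tetrad exhibiting type N.
  obtain ⟨c, hc⟩ : ∃ c, ∀ v w, teval D x v x w
      = c * ((x ⬝ᵥ (nullGram *ᵥ v)) * (x ⬝ᵥ (nullGram *ᵥ w))) := by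
    refine ⟨pull C F 0 1 0 1, fun v w => ?_⟩
    have hv : ∀ v, E *ᵥ v = F *ᵥ (F' *ᵥ (E *ᵥ v)) := fun v => by
      rw [Matrix.mulVec_mulVec (E *ᵥ v) F F', hFi, Matrix.one_mulVec]
    have e : ∀ v y, E *ᵥ v = F *ᵥ y → x ⬝ᵥ (nullGram *ᵥ v) = -y 1 := fun v y h => by
      rw [← gram_dotProduct hT, hx', h, ← hξ, gram_dotProduct hT', nullGram_dotProduct]
      simp
    rw [hDdef, ← teval_mulVec, hx', ← hξ, hv v, hv w, teval_mulVec, hD'.repeatedPND_form q0 q1,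
      e v _ (hv v), e w _ (hv w)]
    ring
  have hnull : x ⬝ᵥ (nullGram *ᵥ x) = 0 := by
    rw [← gram_dotProduct hT, hx', ← hξ, gram_dotProduct hT', nullGram_dotProduct]
    simp
  have hker : InKer D x := hD.inKer_of_form g0 g1 g2 g3 g4 p4 hnull hc
  rw [← pull_pull_of_mul_eq_one C hEi]
  apply InKer.frame
  rwa [← hDdef]

end WeylAlgebra

/-! ### The Levi-Civita symbol and the Hodge dual of a 3-form in components. -/

section HodgeAlgebra

open Matrix

/-- The Levi-Civita symbol. -/
def leviCivita (I : Fin 4 → Fin 4) : ℝ :=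
  (Matrix.of fun i j : Fin 4 => if I i = j then (1 : ℝ) else 0).det

theorem sum_pi_four (f : (Fin 4 → Fin 4) → ℝ) :
    ∑ I, f I = ∑ a, ∑ b, ∑ c, ∑ d, f ![a, b, c, d] := by
  rw [sum_prod_four fun a b c d => f ![a, b, c, d]]
  refine Finset.sum_nbij' (fun I => (I 0, I 1, I 2, I 3)) (fun p => ![p.1, p.2.1, p.2.2.1, p.2.2.2])
    (by simp) (by simp) ?_ (by simp) ?_
  · intro I _
    funext i; fin_cases i <;> rfl
  · intro I _
    congr 1
    funext i; fin_cases i <;> rfl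

/-- Multilinear expansion of the determinant in its rows. With `leviCivita_mul_det` it evaluates the
contraction of the symbol with four inverse metrics. -/
theorem det_eq_sum_leviCivita (R : Matrix (Fin 4) (Fin 4) ℝ) :
    R.det = ∑ a, ∑ b, ∑ c, ∑ d, R 0 a * R 1 b * R 2 c * R 3 d * leviCivita ![a, b, c, d] := by
  have h1 : R = fun i => ∑ j, R i j • (Pi.single j 1 : Fin 4 → ℝ) := by
    funext i; exact (pi_eq_sum_univ' (R i)).trans (by simp)
  have h2 : R.det = ∑ I : Fin 4 → Fin 4, (∏ i, R i (I i)) * leviCivita I := by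
    conv_lhs => rw [h1]
    change Matrix.detRowAlternating.toMultilinearMap _ = _
    rw [MultilinearMap.map_sum]
    refine Finset.sum_congr rfl fun I _ => ?_
    rw [MultilinearMap.map_smul_univ, smul_eq_mul]
    congr 1
    change Matrix.det _ = Matrix.det _
    congr 1
    ext i j
    simp [Pi.single_apply, eq_comm]
  rw [h2, sum_pi_four]
  simp [Fin.prod_univ_four]

theorem leviCivita_mul_det (A : Matrix (Fin 4) (Fin 4) ℝ) (I : Fin 4 → Fin 4) :
    (Matrix.of fun i => A (I i)).det = leviCivita I * A.det := by
  rw [leviCivita, ← Matrix.det_mul]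
  congr 1
  ext i j
  simp [Matrix.mul_apply]

theorem IsSkew.swap_left {T : (Fin 3 → Fin 4) → ℝ} (h : IsSkew T) (a b c : Fin 4) :
    T ![b, a, c] = -T ![a, b, c] := by
  have := h (Equiv.swap 0 1) ![a, b, c]
  rw [Equiv.Perm.sign_swap (by decide)] at this
  rw [show ![b, a, c] = ![a, b, c] ∘ (Equiv.swap 0 1 : Equiv.Perm (Fin 3)) by
    funext i; fin_cases i <;> rfl, this]
  simp

theorem IsSkew.swap_right {T : (Fin 3 → Fin 4) → ℝ} (h : IsSkew T) (a b c : Fin 4) :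
    T ![a, c, b] = -T ![a, b, c] := by
  have := h (Equiv.swap 1 2) ![a, b, c]
  rw [Equiv.Perm.sign_swap (by decide)] at this
  rw [show ![a, c, b] = ![a, b, c] ∘ (Equiv.swap 1 2 : Equiv.Perm (Fin 3)) by
    funext i; fin_cases i <;> rfl, this]
  simp

theorem IsSkew.swap_pair {T : (Fin 2 → Fin 4) → ℝ} (h : IsSkew T) (a b : Fin 4) :
    T ![b, a] = -T ![a, b] := by
  have := h (Equiv.swap 0 1) ![a, b]
  rw [Equiv.Perm.sign_swap (by decide)] at this
  rw [show ![b, a] = ![a, b] ∘ (Equiv.swap 0 1 : Equiv.Perm (Fin 2)) by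
    funext i; fin_cases i <;> rfl, this]
  simp

theorem isSkew_two {n : ℕ} {T : (Fin 2 → Fin n) → ℝ} (h : ∀ a b, T ![b, a] = -T ![a, b]) : IsSkew T := by
  intro σ I
  have hI : I = ![I 0, I 1] := by funext i; fin_cases i <;> rfl
  have hσ : σ = 1 ∨ σ = Equiv.swap 0 1 := by revert σ; decide
  rcases hσ with rfl | rfl
  · simp
  · rw [Equiv.Perm.sign_swap (by decide)]
    have : I ∘ (Equiv.swap 0 1 : Equiv.Perm (Fin 2)) = ![I 1, I 0] := by
      funext i; fin_cases i <;> rfl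
    rw [this, h]
    conv_rhs => rw [hI]
    simp

/-- A skew function of three indices, in terms of its four components. -/
theorem skew_three_table {T : Fin 4 → Fin 4 → Fin 4 → ℝ} (h1 : ∀ a b c, T b a c = -T a b c)
    (h2 : ∀ a b c, T a c b = -T a b c) :
    (∀ a b, T a a b = 0 ∧ T a b a = 0 ∧ T b a a = 0) ∧
    (T 0 2 1 = -T 0 1 2 ∧ T 1 0 2 = -T 0 1 2 ∧ T 1 2 0 = T 0 1 2 ∧ T 2 0 1 = T 0 1 2 ∧
      T 2 1 0 = -T 0 1 2) ∧
    (T 0 3 1 = -T 0 1 3 ∧ T 1 0 3 = -T 0 1 3 ∧ T 1 3 0 = T 0 1 3 ∧ T 3 0 1 = T 0 1 3 ∧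
      T 3 1 0 = -T 0 1 3) ∧
    (T 0 3 2 = -T 0 2 3 ∧ T 2 0 3 = -T 0 2 3 ∧ T 2 3 0 = T 0 2 3 ∧ T 3 0 2 = T 0 2 3 ∧
      T 3 2 0 = -T 0 2 3) ∧
    (T 1 3 2 = -T 1 2 3 ∧ T 2 1 3 = -T 1 2 3 ∧ T 2 3 1 = T 1 2 3 ∧ T 3 1 2 = T 1 2 3 ∧
      T 3 2 1 = -T 1 2 3) := by
  have hd : ∀ a b, T a a b = 0 := fun a b => by linarith [h1 a a b]
  have hd' : ∀ a b, T b a a = 0 := fun a b => by linarith [h2 b a a]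
  have e : ∀ a b c, T a c b = -T a b c ∧ T b a c = -T a b c ∧ T b c a = T a b c ∧
      T c a b = T a b c ∧ T c b a = -T a b c := fun a b c =>
    ⟨h2 a b c, h1 a b c, by linarith [h2 b a c, h1 a b c], by linarith [h2 a b c, h1 a c b],
      by linarith [h2 c a b, h2 a b c, h1 a c b]⟩
  exact ⟨fun a b => ⟨hd a b, by rw [h2, hd, neg_zero], hd' a b⟩, e 0 1 2, e 0 1 3, e 0 2 3, e 1 2 3⟩

variable {G : Matrix (Fin 4) (Fin 4) ℝ}

theorem sum_mul_sum_three (H : Fin 4 → ℝ) (Y : Fin 4 → Fin 4 → Fin 4 → ℝ) (k : ℝ)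
    (X : Tensor4 ℝ) : ∑ d, H d * (k * ∑ a, ∑ b, ∑ c, Y a b c * X a b c d)
      = k * ∑ a, ∑ b, ∑ c, Y a b c * ∑ d, H d * X a b c d := by
  simp only [Finset.mul_sum]
  rw [Finset.sum_comm]
  refine Finset.sum_congr rfl fun a _ => ?_
  rw [Finset.sum_comm]
  refine Finset.sum_congr rfl fun b _ => ?_
  rw [Finset.sum_comm]
  exact Finset.sum_congr rfl fun c _ => Finset.sum_congr rfl fun d _ => by ring

/-- Raising all four indices of the volume form multiplies the symbol by `√|det G| · det G⁻¹ =
-1/√|det G|`; the minus sign is that of the Lorentzian determinant. -/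
theorem hodgeDual_eq_sum (hG : G.det < 0) (Y : (Fin 3 → Fin 4) → ℝ) (e : Fin 4) :
    hodgeDual G Y e = -(1 / 6) * (1 / Real.sqrt |G.det|) *
      ∑ a, ∑ b, ∑ c, Y ![a, b, c] * leviCivita ![a, b, c, e] := by
  have hs : Real.sqrt |G.det| * (G⁻¹).det = -(1 / Real.sqrt |G.det|) := by
    have h1 : G.det = -(Real.sqrt |G.det| ^ 2) := by
      rw [Real.sq_sqrt (abs_nonneg _), abs_of_neg hG, neg_neg]
    have h2 : Real.sqrt |G.det| ≠ 0 := by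
      rw [Real.sqrt_ne_zero']; exact abs_pos.2 hG.ne
    rw [Matrix.det_nonsing_inv, Ring.inverse_eq_inv']
    set s := Real.sqrt |G.det|
    rw [h1]
    field_simp
  have key : ∀ a b c, ∑ d, G⁻¹ e d * ∑ a', ∑ b', ∑ c', G⁻¹ a a' * G⁻¹ b b' * G⁻¹ c c'
      * volumeForm G ![a', b', c', d]
      = Real.sqrt |G.det| * (G⁻¹).det * leviCivita ![a, b, c, e] := by
    intro a b c
    have h := det_eq_sum_leviCivita (Matrix.of fun i => G⁻¹ (![a, b, c, e] i))
    rw [leviCivita_mul_det] at h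
    rw [mul_assoc, mul_comm (G⁻¹).det, h]
    simp only [Finset.mul_sum]
    rw [Finset.sum_comm]
    refine Finset.sum_congr rfl fun a' _ => ?_
    rw [Finset.sum_comm]
    refine Finset.sum_congr rfl fun b' _ => ?_
    rw [Finset.sum_comm]
    refine Finset.sum_congr rfl fun c' _ => Finset.sum_congr rfl fun d _ => ?_
    simp [volumeForm, leviCivita]
    ring
  have h3 : hodgeDual G Y e = (1 / 6) * ∑ a, ∑ b, ∑ c, Y ![a, b, c] * ∑ d, G⁻¹ e d *
      ∑ a', ∑ b', ∑ c', G⁻¹ a a' * G⁻¹ b b' * G⁻¹ c c' * volumeForm G ![a', b', c', d] := by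
    exact sum_mul_sum_three (G⁻¹ e) (fun a b c => Y ![a, b, c]) (1 / 6) fun a b c d =>
      ∑ a', ∑ b', ∑ c', G⁻¹ a a' * G⁻¹ b b' * G⁻¹ c c' * volumeForm G ![a', b', c', d]
  rw [h3]
  simp only [key, hs]
  simp only [Finset.mul_sum]
  exact Finset.sum_congr rfl fun a _ => Finset.sum_congr rfl fun b _ =>
    Finset.sum_congr rfl fun c _ => by ring

theorem leviCivita_swap_left (a b c d : Fin 4) :
    leviCivita ![b, a, c, d] = -leviCivita ![a, b, c, d] := by
  have h := Matrix.det_permute (Equiv.swap (0 : Fin 4) 1)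
    (Matrix.of fun i j : Fin 4 => if ![a, b, c, d] i = j then (1 : ℝ) else 0)
  rw [Equiv.Perm.sign_swap (by decide)] at h
  simp only [leviCivita]
  rw [← neg_one_mul, show (-1 : ℝ) = ((-1 : ℤˣ) : ℤ) by simp, ← h]
  congr 1
  ext i j
  fin_cases i <;> rfl

theorem leviCivita_swap_right (a b c d : Fin 4) :
    leviCivita ![a, c, b, d] = -leviCivita ![a, b, c, d] := by
  have h := Matrix.det_permute (Equiv.swap (1 : Fin 4) 2)
    (Matrix.of fun i j : Fin 4 => if ![a, b, c, d] i = j then (1 : ℝ) else 0)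
  rw [Equiv.Perm.sign_swap (by decide)] at h
  simp only [leviCivita]
  rw [← neg_one_mul, show (-1 : ℝ) = ((-1 : ℤˣ) : ℤ) by simp, ← h]
  congr 1
  ext i j
  fin_cases i <;> rfl

theorem leviCivita_repeat (a b c : Fin 4) : leviCivita ![a, b, c, a] = 0 ∧
    leviCivita ![a, b, c, b] = 0 ∧ leviCivita ![a, b, c, c] = 0 := by
  refine ⟨?_, ?_, ?_⟩
  · exact Matrix.det_zero_of_row_eq (i := 0) (j := 3) (by decide) rfl
  · exact Matrix.det_zero_of_row_eq (i := 1) (j := 3) (by decide) rfl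
  · exact Matrix.det_zero_of_row_eq (i := 2) (j := 3) (by decide) rfl

theorem hodgeDual_components (hG : G.det < 0) {Y : (Fin 3 → Fin 4) → ℝ} (hY : IsSkew Y) :
    hodgeDual G Y 0 = (1 / Real.sqrt |G.det|) * Y ![1, 2, 3] ∧
    hodgeDual G Y 1 = -(1 / Real.sqrt |G.det|) * Y ![0, 2, 3] ∧
    hodgeDual G Y 2 = (1 / Real.sqrt |G.det|) * Y ![0, 1, 3] ∧
    hodgeDual G Y 3 = -(1 / Real.sqrt |G.det|) * Y ![0, 1, 2] := by
  have v0 : leviCivita ![1, 2, 3, 0] = -1 := by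
    simp [leviCivita, Matrix.det_succ_row_zero, Fin.sum_univ_succ, Fin.succAbove]
  have v1 : leviCivita ![0, 2, 3, 1] = 1 := by
    simp [leviCivita, Matrix.det_succ_row_zero, Fin.sum_univ_succ, Fin.succAbove]
  have v2 : leviCivita ![0, 1, 3, 2] = -1 := by
    simp [leviCivita, Matrix.det_succ_row_zero, Fin.sum_univ_succ, Fin.succAbove]
  have v3 : leviCivita ![0, 1, 2, 3] = 1 := by
    simp [leviCivita, Matrix.det_succ_row_zero, Fin.sum_univ_succ, Fin.succAbove]
  obtain ⟨hz, ⟨a1, a2, a3, a4, a5⟩, ⟨b1, b2, b3, b4, b5⟩, ⟨c1, c2, c3, c4, c5⟩,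
    d1, d2, d3, d4, d5⟩ := skew_three_table (T := fun a b c => Y ![a, b, c]) hY.swap_left
      hY.swap_right
  have L := fun e => skew_three_table (T := fun a b c => leviCivita ![a, b, c, e])
    (fun a b c => leviCivita_swap_left a b c e) (fun a b c => leviCivita_swap_right a b c e)
  obtain ⟨lz, -, -, -, l1, l2, l3, l4, l5⟩ := L 0
  obtain ⟨-, -, -, ⟨m1, m2, m3, m4, m5⟩, -⟩ := L 1
  obtain ⟨-, -, ⟨n1, n2, n3, n4, n5⟩, -, -⟩ := L 2
  obtain ⟨-, ⟨p1, p2, p3, p4, p5⟩, -, -, -⟩ := L 3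
  have R := leviCivita_repeat
  refine ⟨?_, ?_, ?_, ?_⟩
  · rw [hodgeDual_eq_sum hG]
    simp only [Fin.sum_univ_four, hz, R, d1, d2, d3, d4, d5, l1, l2, l3, l4, l5, v0]
    ring
  · rw [hodgeDual_eq_sum hG]
    simp only [Fin.sum_univ_four, hz, R, c1, c2, c3, c4, c5, m1, m2, m3, m4, m5, v1]
    ring
  · rw [hodgeDual_eq_sum hG]
    simp only [Fin.sum_univ_four, hz, R, b1, b2, b3, b4, b5, n1, n2, n3, n4, n5, v2]
    ring
  · rw [hodgeDual_eq_sum hG]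
    simp only [Fin.sum_univ_four, hz, R, a1, a2, a3, a4, a5, p1, p2, p3, p4, p5, v3]
    ring

end HodgeAlgebra

/-! ### The Hodge dual commutes with the covariant derivative. -/

section Dual

open Matrix

/-- The density `√|det g|` of the volume form. -/
def volDensity {n : ℕ} (G : Coord n → Matrix (Fin n) (Fin n) ℝ) (u : Coord n) : ℝ :=
  Real.sqrt |(G u).det|

theorem MetricOn.volDensity_smooth {n : ℕ} {G : Coord n → Matrix (Fin n) (Fin n) ℝ}
    {U : Set (Coord n)} (hG : MetricOn G U) (hdet : ∀ u ∈ U, (G u).det < 0) :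
    ContDiffOn ℝ ∞ (volDensity G) U := by
  have h : ContDiffOn ℝ ∞ (fun v => Real.sqrt (-(G v).det)) U :=
    hG.smooth.det.neg.sqrt fun v hv => (neg_pos.2 (hdet v hv)).ne'
  exact h.congr fun v hv => by rw [volDensity, abs_of_neg (hdet v hv)]

theorem volDensity_pos {n : ℕ} {G : Coord n → Matrix (Fin n) (Fin n) ℝ} {u : Coord n}
    (hdet : (G u).det < 0) : 0 < volDensity G u :=
  Real.sqrt_pos.2 (abs_pos.2 hdet.ne)

/-- The volume form is parallel. -/
theorem MetricOn.pderiv_volDensity {n : ℕ} {G : Coord n → Matrix (Fin n) (Fin n) ℝ}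
    {U : Set (Coord n)} (hG : MetricOn G U) (hdet : ∀ u ∈ U, (G u).det < 0) {u : Coord n}
    (hu : u ∈ U) (a : Fin n) :
    pderiv a (volDensity G) u = volDensity G u * ∑ c, christoffel G u c a c := by
  have h1 : pderiv a (fun v => (G v).det) u = 2 * (G u).det * ∑ c, christoffel G u c a c := by
    have ht : (connMat G a u).trace = ∑ c, christoffel G u c a c := rfl
    rw [pderiv_det hG.isOpen hG.smooth hu, hG.mpderiv_metric hu, ← ht, Matrix.mul_add,
      Matrix.trace_add, Matrix.trace_mul_comm, Matrix.mul_assoc, Matrix.mul_adjugate,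
      ← Matrix.mul_assoc, Matrix.adjugate_mul]
    simp [Matrix.trace_transpose]
    ring
  have hs := volDensity_pos (hdet u hu)
  have hd := differentiableAt_of_contDiffOn hG.isOpen (hG.volDensity_smooth hdet) hu
  -- Differentiating the square of the density, which is `-det G`, avoids differentiating the root;
  -- Jacobi's formula and `∇g = 0` then give the trace of the connection.
  have h2 : pderiv a (fun v => volDensity G v * volDensity G v) u
      = -pderiv a (fun v => (G v).det) u := by
    rw [← pderiv_neg]
    refine pderiv_congr hG.isOpen hu fun v hv => ?_
    rw [volDensity, Real.mul_self_sqrt (abs_nonneg _), abs_of_neg (hdet v hv)]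
  have h3 : (G u).det = -(volDensity G u * volDensity G u) := by
    rw [volDensity, Real.mul_self_sqrt (abs_nonneg _), abs_of_neg (hdet u hu), neg_neg]
  rw [pderiv_mul hd hd, h1, h3] at h2
  have : 2 * volDensity G u * pderiv a (volDensity G) u
      = 2 * volDensity G u * (volDensity G u * ∑ c, christoffel G u c a c) := by linarith
  exact mul_left_cancel₀ (by positivity) this

theorem covDeriv_three {n : ℕ} (G : Coord n → Matrix (Fin n) (Fin n) ℝ)
    (T : Coord n → (Fin 3 → Fin n) → ℝ) (u : Coord n) (e a b c : Fin n) :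
    covDeriv G T u e ![a, b, c] = pderiv e (fun v => T v ![a, b, c]) u
      - ∑ d, (christoffel G u d e a * T u ![d, b, c] + christoffel G u d e b * T u ![a, d, c]
        + christoffel G u d e c * T u ![a, b, d]) := by
  have h0 : ∀ d, Function.update ![a, b, c] 0 d = ![d, b, c] := fun d => by
    ext i; fin_cases i <;> rfl
  have h1 : ∀ d, Function.update ![a, b, c] 1 d = ![a, d, c] := fun d => by
    ext i; fin_cases i <;> rfl
  have h2 : ∀ d, Function.update ![a, b, c] 2 d = ![a, b, d] := fun d => by
    ext i; fin_cases i <;> rfl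
  simp only [covDeriv, Fin.sum_univ_three, h0, h1, h2, Finset.sum_add_distrib]
  rfl

theorem covDeriv_two {n : ℕ} (G : Coord n → Matrix (Fin n) (Fin n) ℝ)
    (T : Coord n → (Fin 2 → Fin n) → ℝ) (u : Coord n) (e a b : Fin n) :
    covDeriv G T u e ![a, b] = pderiv e (fun v => T v ![a, b]) u
      - ∑ d, (christoffel G u d e a * T u ![d, b] + christoffel G u d e b * T u ![a, d]) := by
  have h0 : ∀ d, Function.update ![a, b] 0 d = ![d, b] := fun d => by
    ext i; fin_cases i <;> rfl
  have h1 : ∀ d, Function.update ![a, b] 1 d = ![a, d] := fun d => by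
    ext i; fin_cases i <;> rfl
  simp only [covDeriv, Fin.sum_univ_two, h0, h1, Finset.sum_add_distrib]
  rfl

theorem covDeriv_three_skew {n : ℕ} {G : Coord n → Matrix (Fin n) (Fin n) ℝ}
    {T : Coord n → (Fin 3 → Fin n) → ℝ} {U : Set (Coord n)} (hU : IsOpen U) {u : Coord n}
    (hu : u ∈ U) (h1 : ∀ v ∈ U, ∀ a b c, T v ![b, a, c] = -T v ![a, b, c])
    (h2 : ∀ v ∈ U, ∀ a b c, T v ![a, c, b] = -T v ![a, b, c]) (e a b c : Fin n) :
    covDeriv G T u e ![b, a, c] = -covDeriv G T u e ![a, b, c] ∧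
    covDeriv G T u e ![a, c, b] = -covDeriv G T u e ![a, b, c] := by
  have p1 : pderiv e (fun v => T v ![b, a, c]) u = -pderiv e (fun v => T v ![a, b, c]) u := by
    rw [← pderiv_neg]; exact pderiv_congr hU hu fun v hv => h1 v hv a b c
  have p2 : pderiv e (fun v => T v ![a, c, b]) u = -pderiv e (fun v => T v ![a, b, c]) u := by
    rw [← pderiv_neg]; exact pderiv_congr hU hu fun v hv => h2 v hv a b c
  simp only [covDeriv_three, p1, p2, neg_sub', ← Finset.sum_neg_distrib]
  constructor
  · congr 1
    refine Finset.sum_congr rfl fun d _ => ?_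
    rw [h1 u hu a d c, h1 u hu d b c, h1 u hu a b d]; ring
  · congr 1
    refine Finset.sum_congr rfl fun d _ => ?_
    rw [h2 u hu d b c, h2 u hu a b d, h2 u hu a d c]; ring

variable {G : Coord 4 → Matrix (Fin 4) (Fin 4) ℝ} {U : Set (Coord 4)} {u : Coord 4}

/-- The dual vector field of a field of 3-forms. -/
def dualVec (G : Coord 4 → Matrix (Fin 4) (Fin 4) ℝ) (Y : Coord 4 → (Fin 3 → Fin 4) → ℝ)
    (u : Coord 4) : Fin 4 → ℝ :=
  hodgeDual (G u) (Y u)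

variable {Y : Coord 4 → (Fin 3 → Fin 4) → ℝ}

/-- Duality inverted: each component of the 3-form is, up to sign and density, the component of the
vector along the missing index. -/
theorem form_eq_dualVec (hdet : (G u).det < 0) (hY : IsSkew (Y u)) :
    Y u ![0, 1, 2] = -(volDensity G u * dualVec G Y u 3) ∧
    Y u ![0, 1, 3] = volDensity G u * dualVec G Y u 2 ∧
    Y u ![0, 2, 3] = -(volDensity G u * dualVec G Y u 1) ∧
    Y u ![1, 2, 3] = volDensity G u * dualVec G Y u 0 := by
  obtain ⟨h0, h1, h2, h3⟩ := hodgeDual_components hdet hY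
  have hs := (volDensity_pos hdet).ne'
  have hs' : Real.sqrt |(G u).det| = volDensity G u := rfl
  rw [hs'] at h0 h1 h2 h3
  simp only [dualVec, h0, h1, h2, h3]
  refine ⟨?_, ?_, ?_, ?_⟩ <;> field_simp

theorem MetricOn.dualVec_smooth (hG : MetricOn G U) (hdet : ∀ v ∈ U, (G v).det < 0)
    (hY : ∀ v ∈ U, IsSkew (Y v)) (hYs : ∀ I, ContDiffOn ℝ ∞ (fun v => Y v I) U) (b : Fin 4) :
    ContDiffOn ℝ ∞ (fun v => dualVec G Y v b) U := by
  have hs : ContDiffOn ℝ ∞ (fun v => 1 / volDensity G v) U :=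
    contDiffOn_const.div (hG.volDensity_smooth hdet) fun v hv => (volDensity_pos (hdet v hv)).ne'
  fin_cases b
  · exact (hs.mul (hYs ![1, 2, 3])).congr fun v hv =>
      (hodgeDual_components (hdet v hv) (hY v hv)).1
  · exact (hs.neg.mul (hYs ![0, 2, 3])).congr fun v hv =>
      (hodgeDual_components (hdet v hv) (hY v hv)).2.1
  · exact (hs.mul (hYs ![0, 1, 3])).congr fun v hv =>
      (hodgeDual_components (hdet v hv) (hY v hv)).2.2.1
  · exact (hs.neg.mul (hYs ![0, 1, 2])).congr fun v hv =>
      (hodgeDual_components (hdet v hv) (hY v hv)).2.2.2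

set_option linter.unusedSimpArgs false in
/-- The covariant derivative commutes with the Hodge dual of 3-forms. -/
theorem MetricOn.covDeriv_form (hG : MetricOn G U) (hdet : ∀ v ∈ U, (G v).det < 0)
    (hY : ∀ v ∈ U, IsSkew (Y v)) (hYs : ∀ I, ContDiffOn ℝ ∞ (fun v => Y v I) U) (hu : u ∈ U)
    (e : Fin 4) :
    covDeriv G Y u e ![0, 1, 2] = -(volDensity G u * vecD G (dualVec G Y) u e 3) ∧
    covDeriv G Y u e ![0, 1, 3] = volDensity G u * vecD G (dualVec G Y) u e 2 ∧
    covDeriv G Y u e ![0, 2, 3] = -(volDensity G u * vecD G (dualVec G Y) u e 1) ∧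
    covDeriv G Y u e ![1, 2, 3] = volDensity G u * vecD G (dualVec G Y) u e 0 := by
  have hsd := differentiableAt_of_contDiffOn hG.isOpen (hG.volDensity_smooth hdet) hu
  have hξd := fun b => differentiableAt_of_contDiffOn hG.isOpen (hG.dualVec_smooth hdet hY hYs b) hu
  -- The density contributes the full connection trace. Three of its terms cancel the diagonal
  -- connection terms of the 3-form, and the fourth, at the missing index, is the one needed in
  -- `vecD`.
  have hp : ∀ b, pderiv e (fun v => volDensity G v * dualVec G Y v b) u
      = volDensity G u * ((∑ c, christoffel G u c e c) * dualVec G Y u b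
        + pderiv e (fun v => dualVec G Y v b) u) := by
    intro b
    rw [pderiv_mul hsd (hξd b), hG.pderiv_volDensity hdet hu]
    ring
  have hc := fun v hv => form_eq_dualVec (hdet v hv) (hY v hv)
  have q3 := pderiv_congr (a := e) hG.isOpen hu fun v hv => (hc v hv).1
  have q2 := pderiv_congr (a := e) hG.isOpen hu fun v hv => (hc v hv).2.1
  have q1 := pderiv_congr (a := e) hG.isOpen hu fun v hv => (hc v hv).2.2.1
  have q0 := pderiv_congr (a := e) hG.isOpen hu fun v hv => (hc v hv).2.2.2
  rw [pderiv_neg, hp] at q1 q3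
  rw [hp] at q0 q2
  obtain ⟨y3, y2, y1, y0⟩ := hc u hu
  obtain ⟨hz, ⟨a1, a2, a3, a4, a5⟩, ⟨b1, b2, b3, b4, b5⟩, ⟨c1, c2, c3, c4, c5⟩,
    d1, d2, d3, d4, d5⟩ := skew_three_table (T := fun a b c => Y u ![a, b, c]) (hY u hu).swap_left
      (hY u hu).swap_right
  refine ⟨?_, ?_, ?_, ?_⟩
  · rw [covDeriv_three, q3]
    simp only [Fin.sum_univ_four, vecD, Matrix.of_apply, hz, a1, a2, a3, a4, a5, b1, b2, b3, b4,
      b5, c1, c2, c3, c4, c5, d1, d2, d3, d4, d5, y3, y2, y1, y0]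
    ring
  · rw [covDeriv_three, q2]
    simp only [Fin.sum_univ_four, vecD, Matrix.of_apply, hz, a1, a2, a3, a4, a5, b1, b2, b3, b4,
      b5, c1, c2, c3, c4, c5, d1, d2, d3, d4, d5, y3, y2, y1, y0]
    ring
  · rw [covDeriv_three, q1]
    simp only [Fin.sum_univ_four, vecD, Matrix.of_apply, hz, a1, a2, a3, a4, a5, b1, b2, b3, b4,
      b5, c1, c2, c3, c4, c5, d1, d2, d3, d4, d5, y3, y2, y1, y0]
    ring
  · rw [covDeriv_three, q0]
    simp only [Fin.sum_univ_four, vecD, Matrix.of_apply, hz, a1, a2, a3, a4, a5, b1, b2, b3, b4,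
      b5, c1, c2, c3, c4, c5, d1, d2, d3, d4, d5, y3, y2, y1, y0]
    ring

set_option linter.unusedSimpArgs false in
/-- The covariant derivative commutes with the Hodge dual of 2-forms. -/
theorem MetricOn.covDeriv_dual_bivector (hG : MetricOn G U) (hdet : ∀ v ∈ U, (G v).det < 0)
    {A : Coord 4 → (Fin 2 → Fin 4) → ℝ} {P : Coord 4 → Matrix (Fin 4) (Fin 4) ℝ}
    (hP : MSmooth P U) (hPs : ∀ v ∈ U, ∀ a b, P v a b = -P v b a)
    (hA : ∀ v ∈ U, ∀ a b, A v ![b, a] = -A v ![a, b])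
    (hAP : ∀ v ∈ U, A v ![0, 1] = -(volDensity G v * P v 2 3) ∧
      A v ![0, 2] = volDensity G v * P v 1 3 ∧ A v ![0, 3] = -(volDensity G v * P v 1 2) ∧
      A v ![1, 2] = -(volDensity G v * P v 0 3) ∧ A v ![1, 3] = volDensity G v * P v 0 2 ∧
      A v ![2, 3] = -(volDensity G v * P v 0 1)) (hu : u ∈ U) (e : Fin 4) :
    covDeriv G A u e ![0, 1] = -(volDensity G u * bivD G P e u 2 3) ∧
    covDeriv G A u e ![0, 2] = volDensity G u * bivD G P e u 1 3 ∧
    covDeriv G A u e ![0, 3] = -(volDensity G u * bivD G P e u 1 2) ∧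
    covDeriv G A u e ![1, 2] = -(volDensity G u * bivD G P e u 0 3) ∧
    covDeriv G A u e ![1, 3] = volDensity G u * bivD G P e u 0 2 ∧
    covDeriv G A u e ![2, 3] = -(volDensity G u * bivD G P e u 0 1) := by
  have hsd := differentiableAt_of_contDiffOn hG.isOpen (hG.volDensity_smooth hdet) hu
  have hp : ∀ a b, pderiv e (fun v => volDensity G v * P v a b) u
      = volDensity G u * ((∑ c, christoffel G u c e c) * P u a b
        + pderiv e (fun v => P v a b) u) := by
    intro a b
    rw [pderiv_mul hsd (hP.diff hG.isOpen hu a b), hG.pderiv_volDensity hdet hu]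
    ring
  have q01 := pderiv_congr (a := e) hG.isOpen hu fun v hv => (hAP v hv).1
  have q02 := pderiv_congr (a := e) hG.isOpen hu fun v hv => (hAP v hv).2.1
  have q03 := pderiv_congr (a := e) hG.isOpen hu fun v hv => (hAP v hv).2.2.1
  have q12 := pderiv_congr (a := e) hG.isOpen hu fun v hv => (hAP v hv).2.2.2.1
  have q13 := pderiv_congr (a := e) hG.isOpen hu fun v hv => (hAP v hv).2.2.2.2.1
  have q23 := pderiv_congr (a := e) hG.isOpen hu fun v hv => (hAP v hv).2.2.2.2.2
  rw [pderiv_neg, hp] at q01 q03 q12 q23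
  rw [hp] at q02 q13
  obtain ⟨y01, y02, y03, y12, y13, y23⟩ := hAP u hu
  have hz : ∀ a, A u ![a, a] = 0 := fun a => by linarith [hA u hu a a]
  have a10 := hA u hu 0 1
  have a20 := hA u hu 0 2
  have a30 := hA u hu 0 3
  have a21 := hA u hu 1 2
  have a31 := hA u hu 1 3
  have a32 := hA u hu 2 3
  have hPz : ∀ a, P u a a = 0 := fun a => by linarith [hPs u hu a a]
  have p10 := hPs u hu 1 0
  have p20 := hPs u hu 2 0
  have p30 := hPs u hu 3 0
  have p21 := hPs u hu 2 1
  have p31 := hPs u hu 3 1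
  have p32 := hPs u hu 3 2
  refine ⟨?_, ?_, ?_, ?_, ?_, ?_⟩
  · rw [covDeriv_two, q01]
    simp only [Fin.sum_univ_four, bivD, Matrix.add_apply, Matrix.mul_apply, Matrix.transpose_apply,
      connMat_apply, mpderiv_apply, hz, a10, a20, a30, a21, a31, a32, y01, y02, y03, y12, y13, y23,
      hPz, p10, p20, p30, p21, p31, p32]
    ring
  · rw [covDeriv_two, q02]
    simp only [Fin.sum_univ_four, bivD, Matrix.add_apply, Matrix.mul_apply, Matrix.transpose_apply,
      connMat_apply, mpderiv_apply, hz, a10, a20, a30, a21, a31, a32, y01, y02, y03, y12, y13, y23,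
      hPz, p10, p20, p30, p21, p31, p32]
    ring
  · rw [covDeriv_two, q03]
    simp only [Fin.sum_univ_four, bivD, Matrix.add_apply, Matrix.mul_apply, Matrix.transpose_apply,
      connMat_apply, mpderiv_apply, hz, a10, a20, a30, a21, a31, a32, y01, y02, y03, y12, y13, y23,
      hPz, p10, p20, p30, p21, p31, p32]
    ring
  · rw [covDeriv_two, q12]
    simp only [Fin.sum_univ_four, bivD, Matrix.add_apply, Matrix.mul_apply, Matrix.transpose_apply,
      connMat_apply, mpderiv_apply, hz, a10, a20, a30, a21, a31, a32, y01, y02, y03, y12, y13, y23,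
      hPz, p10, p20, p30, p21, p31, p32]
    ring
  · rw [covDeriv_two, q13]
    simp only [Fin.sum_univ_four, bivD, Matrix.add_apply, Matrix.mul_apply, Matrix.transpose_apply,
      connMat_apply, mpderiv_apply, hz, a10, a20, a30, a21, a31, a32, y01, y02, y03, y12, y13, y23,
      hPz, p10, p20, p30, p21, p31, p32]
    ring
  · rw [covDeriv_two, q23]
    simp only [Fin.sum_univ_four, bivD, Matrix.add_apply, Matrix.mul_apply, Matrix.transpose_apply,
      connMat_apply, mpderiv_apply, hz, a10, a20, a30, a21, a31, a32, y01, y02, y03, y12, y13, y23,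
      hPz, p10, p20, p30, p21, p31, p32]
    ring

end Dual

/-! ### From the conformal Killing–Yano equation to the conformal Killing equation. -/

section ConformalKY

open Matrix

theorem alternate_three {n : ℕ} (T : (Fin 3 → Fin n) → ℝ) (b c d : Fin n) :
    alternate T ![b, c, d] = (1 / 6) * (T ![b, c, d] - T ![c, b, d] - T ![d, c, b] - T ![b, d, c]
      + T ![c, d, b] + T ![d, b, c]) := by
  have hs : (Finset.univ : Finset (Equiv.Perm (Fin 3))) = {1, Equiv.swap 0 1, Equiv.swap 0 2,
      Equiv.swap 1 2, Equiv.swap 0 1 * Equiv.swap 1 2, Equiv.swap 1 2 * Equiv.swap 0 1} := by decide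
  have e1 : ![b, c, d] ∘ ⇑(Equiv.swap (0 : Fin 3) 1) = ![c, b, d] := by
    funext i; fin_cases i <;> rfl
  have e2 : ![b, c, d] ∘ ⇑(Equiv.swap (0 : Fin 3) 2) = ![d, c, b] := by
    funext i; fin_cases i <;> rfl
  have e3 : ![b, c, d] ∘ ⇑(Equiv.swap (1 : Fin 3) 2) = ![b, d, c] := by
    funext i; fin_cases i <;> rfl
  have e4 : ![b, c, d] ∘ ⇑(Equiv.swap 0 1 * Equiv.swap 1 2 : Equiv.Perm (Fin 3)) = ![c, d, b] := by
    funext i; fin_cases i <;> rfl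
  have e5 : ![b, c, d] ∘ ⇑(Equiv.swap 1 2 * Equiv.swap 0 1 : Equiv.Perm (Fin 3)) = ![d, b, c] := by
    funext i; fin_cases i <;> rfl
  rw [alternate, hs, Finset.sum_insert (by decide), Finset.sum_insert (by decide),
    Finset.sum_insert (by decide), Finset.sum_insert (by decide), Finset.sum_insert (by decide),
    Finset.sum_singleton, e1, e2, e3, e4, e5]
  have t1 : Equiv.Perm.sign (Equiv.swap (0 : Fin 3) 1) = -1 := by decide
  have t2 : Equiv.Perm.sign (Equiv.swap (0 : Fin 3) 2) = -1 := by decide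
  have t3 : Equiv.Perm.sign (Equiv.swap (1 : Fin 3) 2) = -1 := by decide
  simp only [Equiv.Perm.sign_mul, t1, t2, t3, Equiv.Perm.sign_one, Equiv.Perm.coe_one,
    Function.comp_id, Nat.factorial]
  push_cast
  ring

theorem alternate_metric {n : ℕ} (g : Fin n → ℝ) {h : (Fin 2 → Fin n) → ℝ}
    (hh : ∀ a b, h ![b, a] = -h ![a, b]) (b c d : Fin n) :
    alternate (fun I : Fin 3 → Fin n => g (I 0) * h (Fin.tail I)) ![b, c, d]
      = (1 / 3) * (g b * h ![c, d] + g c * h ![d, b] + g d * h ![b, c]) := by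
  have ht : ∀ b c d : Fin n, Fin.tail ![b, c, d] = ![c, d] := fun b c d => by
    funext i; fin_cases i <;> rfl
  rw [alternate_three]
  simp only [ht, Matrix.cons_val_zero]
  rw [hh d b, hh c d, hh b c]
  ring

/-- The algebra behind the duality of conformal Killing–Yano 3-forms and conformal Killing
vectors. -/
theorem conformal_of_cky {G K : Matrix (Fin 4) (Fin 4) ℝ} (hG : Gᵀ = G) {s : ℝ} (hs : s ≠ 0)
    {h : Fin 4 → Fin 4 → ℝ} (hh : ∀ a b, h b a = -h a b)
    {T : Fin 4 → Fin 4 → Fin 4 → Fin 4 → ℝ} (h1 : ∀ e a b c, T e b a c = -T e a b c)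
    (h2 : ∀ e a b c, T e a c b = -T e a b c)
    (hK : ∀ e, T e 0 1 2 = -(s * K e 3) ∧ T e 0 1 3 = s * K e 2 ∧ T e 0 2 3 = -(s * K e 1) ∧
      T e 1 2 3 = s * K e 0)
    (hT : ∀ a b c d, T a b c d + T b a c d
      = 2 * ((1 / 3) * (G a b * h c d + G a c * h d b + G a d * h b c))
        + 2 * ((1 / 3) * (G b a * h c d + G b c * h d a + G b d * h a c))) :
    K * G + (K * G)ᵀ = (2 * (K.trace / 4)) • G := by
  have g : ∀ a b, G b a = G a b := fun a b => congrFun (congrFun hG a) b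
  -- `H` is `2/3` of the dual of `h`, without density. The aim is that `s • K` differs from `G * H`
  -- by a multiple of the identity; multiplying by `G` turns `G * H` into the skew `G * H * G`, so
  -- the symmetric part of `K * G` is a multiple of `G`.
  set H : Matrix (Fin 4) (Fin 4) ℝ := (2 / 3 : ℝ) • !![0, -h 2 3, h 1 3, -h 1 2;
    h 2 3, 0, -h 0 3, h 0 2; -h 1 3, h 0 3, 0, -h 0 1; h 1 2, -h 0 2, h 0 1, 0] with hH
  have hHs : Hᵀ = -H := by
    rw [hH]; ext i j; fin_cases i <;> fin_cases j <;> simp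
  have gh : ∀ e, (G * H) e 0 = 2 / 3 * (G e 1 * h 2 3 - G e 2 * h 1 3 + G e 3 * h 1 2) ∧
      (G * H) e 1 = 2 / 3 * (-(G e 0 * h 2 3) + G e 2 * h 0 3 - G e 3 * h 0 2) ∧
      (G * H) e 2 = 2 / 3 * (G e 0 * h 1 3 - G e 1 * h 0 3 + G e 3 * h 0 1) ∧
      (G * H) e 3 = 2 / 3 * (-(G e 0 * h 1 2) + G e 1 * h 0 2 - G e 2 * h 0 1) := by
    intro e
    refine ⟨?_, ?_, ?_, ?_⟩ <;> simp [hH, Matrix.mul_apply, Fin.sum_univ_four] <;> ring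
  have hz : ∀ a, h a a = 0 := fun a => by linarith [hh a a]
  set ψ := s * K 0 0 - (G * H) 0 0 with hψ
  have key : s • K = G * H + ψ • (1 : Matrix (Fin 4) (Fin 4) ℝ) := by
    have k3 := fun e => (hK e).1
    have k2 := fun e => (hK e).2.1
    have k1 := fun e => (hK e).2.2.1
    have k0 := fun e => (hK e).2.2.2
    -- With four distinct indices the equation compares two diagonal entries of `K`.
    have hd : s * K 1 1 = (G * H) 1 1 + ψ ∧ s * K 2 2 = (G * H) 2 2 + ψ ∧
        s * K 3 3 = (G * H) 3 3 + ψ := by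
      have t1 := hT 0 1 2 3
      have t2 := hT 0 2 1 3
      have t3 := hT 0 3 1 2
      rw [h1 0 1 2 3] at t2
      rw [h1 0 1 3 2, h2 0 1 2 3] at t3
      simp only [k0, k1, k2, k3, g 0 1, g 0 2, g 0 3, g 1 2, g 1 3, g 2 3, hh 0 2, hh 0 3, hh 1 2, hh 1 3, hh 2 3] at t1 t2 t3
      rw [hψ, (gh 0).1, (gh 1).2.1, (gh 2).2.2.1, (gh 3).2.2.2]
      simp only [g 0 1, g 0 2, g 0 3, g 1 2, g 1 3, g 2 3]
      refine ⟨?_, ?_, ?_⟩ <;> linarith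
    -- With the first two indices equal it determines an off-diagonal entry.
    have o := fun e a b => hT e e a b
    have o3 : ∀ e, e ≠ 3 → s * K e 3 = (G * H) e 3 := by
      intro e he
      have t0 := o 0 1 2
      have t1 := o 1 0 2
      have t2 := o 2 0 1
      rw [h1 1 0 1 2] at t1
      rw [h1 2 0 2 1, h2 2 0 1 2] at t2
      simp only [k3, hh 0 1, hh 0 2, hh 1 2] at t0 t1 t2
      rw [(gh e).2.2.2]
      fin_cases e
      · simp only [Fin.zero_eta]; linarith
      · simp only [Fin.mk_one]; linarith
      · simp only [Fin.reduceFinMk]; linarith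
      · exact absurd rfl he
    have o2 : ∀ e, e ≠ 2 → s * K e 2 = (G * H) e 2 := by
      intro e he
      have t0 := o 0 1 3
      have t1 := o 1 0 3
      have t2 := o 3 0 1
      rw [h1 1 0 1 3] at t1
      rw [h1 3 0 3 1, h2 3 0 1 3] at t2
      simp only [k2, hh 0 1, hh 0 3, hh 1 3] at t0 t1 t2
      rw [(gh e).2.2.1]
      fin_cases e
      · simp only [Fin.zero_eta]; linarith
      · simp only [Fin.mk_one]; linarith
      · exact absurd rfl he
      · simp only [Fin.reduceFinMk]; linarith
    have o1 : ∀ e, e ≠ 1 → s * K e 1 = (G * H) e 1 := by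
      intro e he
      have t0 := o 0 2 3
      have t1 := o 2 0 3
      have t2 := o 3 0 2
      rw [h1 2 0 2 3] at t1
      rw [h1 3 0 3 2, h2 3 0 2 3] at t2
      simp only [k1, hh 0 2, hh 0 3, hh 2 3] at t0 t1 t2
      rw [(gh e).2.1]
      fin_cases e
      · simp only [Fin.zero_eta]; linarith
      · exact absurd rfl he
      · simp only [Fin.reduceFinMk]; linarith
      · simp only [Fin.reduceFinMk]; linarith
    have o0 : ∀ e, e ≠ 0 → s * K e 0 = (G * H) e 0 := by
      intro e he
      have t0 := o 1 2 3
      have t1 := o 2 1 3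
      have t2 := o 3 1 2
      rw [h1 2 1 2 3] at t1
      rw [h1 3 1 3 2, h2 3 1 2 3] at t2
      simp only [k0, hh 1 2, hh 1 3, hh 2 3] at t0 t1 t2
      rw [(gh e).1]
      fin_cases e
      · exact absurd rfl he
      · simp only [Fin.mk_one]; linarith
      · simp only [Fin.reduceFinMk]; linarith
      · simp only [Fin.reduceFinMk]; linarith
    have hall : ∀ b e, e ≠ b → s * K e b = (G * H) e b :=
      Fin.forall_fin_succ.2 ⟨o0, Fin.forall_fin_succ.2 ⟨o1, Fin.forall_fin_succ.2 ⟨o2,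
        Fin.forall_fin_succ.2 ⟨o3, fun i => i.elim0⟩⟩⟩⟩
    have hdiag : ∀ a, s * K a a = (G * H) a a + ψ :=
      Fin.forall_fin_succ.2 ⟨by rw [hψ]; ring, Fin.forall_fin_succ.2 ⟨hd.1,
        Fin.forall_fin_succ.2 ⟨hd.2.1, Fin.forall_fin_succ.2 ⟨hd.2.2, fun i => i.elim0⟩⟩⟩⟩
    ext a b
    rcases eq_or_ne a b with rfl | hab
    · simpa using hdiag a
    · simpa [Matrix.one_apply_ne hab] using hall b a hab
  -- A symmetric matrix times a skew one is trace-free, so `ψ` is fixed by the trace of `K`.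
  have htr : (G * H).trace = 0 := by
    have : (G * H).trace = -(G * H).trace := by
      conv_lhs => rw [← Matrix.trace_transpose, Matrix.transpose_mul, hG, hHs, Matrix.neg_mul,
        Matrix.trace_neg, Matrix.trace_mul_comm]
    linarith
  have htK : s * K.trace = 4 * ψ := by
    have := congrArg Matrix.trace key
    rw [Matrix.trace_smul, Matrix.trace_add, htr, Matrix.trace_smul, Matrix.trace_one] at this
    simpa [mul_comm] using this
  have hfin : s • (K * G + (K * G)ᵀ) = s • ((2 * (K.trace / 4)) • G) := by
    have e1 : s • (K * G) = G * H * G + ψ • G := by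
      rw [← Matrix.smul_mul, key, Matrix.add_mul]; simp
    rw [smul_add, ← Matrix.transpose_smul, e1, smul_smul]
    rw [show s * (2 * (K.trace / 4)) = 2 * ψ by linear_combination htK / 2]
    simp only [Matrix.transpose_add, Matrix.transpose_mul, Matrix.transpose_smul, hG, hHs]
    rw [two_mul, add_smul]
    noncomm_ring
  exact smul_right_injective _ hs hfin

end ConformalKY

/-! ### The Killing–Yano condition on the divergence as annihilation of the Weyl tensor. -/

section EinsteinCKY

open Matrix

/-- The algebra of the Killing–Yano equation for the dual of a bivector field: `c` is the
covariant derivative of the 2-form and `W` the Weyl part of the one of the bivector. -/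
theorem killingYano_iff_weylPart {c D W : Fin 4 → Fin 4 → Fin 4 → ℝ} {θ : Fin 4 → ℝ}
    (hc : ∀ e a b, c e b a = -c e a b) (hW : ∀ e a b, W e b a = -W e a b)
    (hD : ∀ e a b, D e a b = W e a b + (if e = b then θ a else 0) - (if e = a then θ b else 0))
    (htr : ∀ b, ∑ e, W e e b = 0)
    (hcD : ∀ e, c e 0 1 = -D e 2 3 ∧ c e 0 2 = D e 1 3 ∧ c e 0 3 = -D e 1 2 ∧
      c e 1 2 = -D e 0 3 ∧ c e 1 3 = D e 0 2 ∧ c e 2 3 = -D e 0 1) :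
    (∀ a b d, c a b d + c b a d = 0) ↔ W = 0 := by
  have c01 := fun e => (hcD e).1
  have c02 := fun e => (hcD e).2.1
  have c03 := fun e => (hcD e).2.2.1
  have c12 := fun e => (hcD e).2.2.2.1
  have c13 := fun e => (hcD e).2.2.2.2.1
  have c23 := fun e => (hcD e).2.2.2.2.2
  have hWz : ∀ e a, W e a a = 0 := fun e a => by linarith [hW e a a]
  have hcz : ∀ e a, c e a a = 0 := fun e a => by linarith [hc e a a]
  have c10 := fun e => hc e 0 1
  have c20 := fun e => hc e 0 2
  have c30 := fun e => hc e 0 3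
  have c21 := fun e => hc e 1 2
  have c31 := fun e => hc e 1 3
  have c32 := fun e => hc e 2 3
  constructor
  · intro h
    have e0 := htr 0
    have e1 := htr 1
    have e2 := htr 2
    have e3 := htr 3
    rw [Fin.sum_univ_four] at e0 e1 e2 e3
    -- The equation makes `c` totally skew. In four dimensions its dual `D` is then pure trace, so
    -- the trace-free `W` must vanish.
    have n : ∀ a b d, c a b d = -c b a d := fun a b d => by linarith [h a b d]
    have z : ∀ a d, c a a d = 0 := fun a d => by linarith [h a a d]
    have w0 := And.intro (z 0 1) (And.intro (z 0 2) (z 0 3))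
    have w1 := And.intro (z 1 0) (And.intro (z 1 2) (z 1 3))
    have w2 := And.intro (z 2 0) (And.intro (z 2 1) (z 2 3))
    have w3 := And.intro (z 3 0) (And.intro (z 3 1) (z 3 2))
    have v0 := And.intro (n 0 1 2) (And.intro (n 0 1 3) (n 0 2 3))
    have v1 := And.intro (n 0 2 1) (And.intro (n 0 3 1) (n 0 3 2))
    have v2 := And.intro (n 1 2 0) (And.intro (n 1 3 0) (n 1 2 3))
    have v3 := And.intro (n 1 3 2) (And.intro (n 2 3 0) (n 2 3 1))
    simp only [c01, c02, c03, c12, c13, c23, c10, c20, c30, c21, c31, c32, hD, Fin.reduceEq, if_true, if_false] at w0 w1 w2 w3 v0 v1 v2 v3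
    simp only [hWz, hW _ 0 1, hW _ 0 2, hW _ 0 3, hW _ 1 2, hW _ 1 3, hW _ 2 3] at e0 e1 e2 e3
    obtain ⟨w01, w02, w03⟩ := w0
    obtain ⟨w11, w12, w13⟩ := w1
    obtain ⟨w21, w22, w23⟩ := w2
    obtain ⟨w31, w32, w33⟩ := w3
    obtain ⟨v01, v02, v03⟩ := v0
    obtain ⟨v11, v12, v13⟩ := v1
    obtain ⟨v21, v22, v23⟩ := v2
    obtain ⟨v31, v32, v33⟩ := v3
    funext e a b
    refine skew_eq_zero (T := W e) (fun a b => hW e b a) ?_ ?_ ?_ ?_ ?_ ?_ a b <;> fin_cases e <;>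
      simp only [Fin.zero_eta, Fin.mk_one, Fin.reduceFinMk] <;> linarith
  · rintro rfl a b d
    have key : ∀ a b d, c a b d = -c b a d := by
      intro a b d
      fin_cases a <;> fin_cases b <;> fin_cases d <;>
        simp only [Fin.zero_eta, Fin.mk_one, Fin.reduceFinMk, hcz, c01, c02, c03, c12, c13, c23, c10, c20, c30, c21, c31, c32, hD, Fin.reduceEq, if_true, if_false, Pi.zero_apply, neg_zero] <;> ring
    rw [key a b d]; ring

/-- A conformal Killing–Yano 3-form on an open set of `ℝ⁴` with a Lorentzian Einstein metric. -/
structure EinsteinCKYOn (G : Coord 4 → Matrix (Fin 4) (Fin 4) ℝ)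
    (Y : Coord 4 → (Fin 3 → Fin 4) → ℝ) (U : Set (Coord 4)) : Prop where
  metric : MetricOn G U
  lorentzian : ∀ u ∈ U, IsLorentzian (G u)
  einstein : ∀ u ∈ U, ∃ Λ : ℝ, ∀ a b, ricci G u a b = Λ * G u a b
  skew : ∀ u ∈ U, IsSkew (Y u)
  smooth : ∀ I, ContDiffOn ℝ ∞ (fun v => Y v I) U
  cky : ∀ u ∈ U, ∃ h : (Fin 2 → Fin 4) → ℝ, IsSkew h ∧ ∀ (a b : Fin 4) (B : Fin 2 → Fin 4),
    covDeriv G Y u a (Fin.cons b B) + covDeriv G Y u b (Fin.cons a B)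
      = 2 * alternate (fun I => G u a (I 0) * h (Fin.tail I)) (Fin.cons b B)
        + 2 * alternate (fun I => G u b (I 0) * h (Fin.tail I)) (Fin.cons a B)

variable {G : Coord 4 → Matrix (Fin 4) (Fin 4) ℝ} {Y : Coord 4 → (Fin 3 → Fin 4) → ℝ}
  {U : Set (Coord 4)} {u : Coord 4}

/-- A quarter of the divergence of the dual vector field. -/
def divFun (G : Coord 4 → Matrix (Fin 4) (Fin 4) ℝ) (Y : Coord 4 → (Fin 3 → Fin 4) → ℝ)
    (u : Coord 4) : ℝ := (vecD G (dualVec G Y) u).trace / 4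

/-- The covector field `∂ₐ φ + (λ / 3) ξₐ`, where `λ = scalarCurv / 4`. -/
def thetaFun (G : Coord 4 → Matrix (Fin 4) (Fin 4) ℝ) (Y : Coord 4 → (Fin 3 → Fin 4) → ℝ)
    (u : Coord 4) (a : Fin 4) : ℝ :=
  pderiv a (divFun G Y) u + scalarCurv G u / 12 * ∑ d, G u d a * dualVec G Y u d

theorem MetricOn.scalarCurv_of_einstein (hG : MetricOn G U) (hu : u ∈ U) {Λ : ℝ}
    (h : ∀ a b, ricci G u a b = Λ * G u a b) : scalarCurv G u = 4 * Λ := by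
  have h1 : ((G u)⁻¹ * G u).trace = 4 := by rw [hG.inv_mul hu, Matrix.trace_one]; simp
  have h2 : scalarCurv G u = Λ * ((G u)⁻¹ * G u).trace := by
    simp only [scalarCurv, h, Matrix.trace, Matrix.diag, Matrix.mul_apply, Finset.mul_sum]
    exact Finset.sum_congr rfl fun a _ => Finset.sum_congr rfl fun b _ => by
      rw [hG.symm_apply hu a b]; ring
  rw [h2, h1]; ring

/-- The Ricci term contributes `-Λ` and the scalar term, with scalar curvature `4 Λ`, contributes `2
Λ / 3`; together `-Λ / 3`. -/
theorem MetricOn.weyl_of_einstein (hG : MetricOn G U) (hu : u ∈ U) {Λ : ℝ}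
    (h : ∀ a b, ricci G u a b = Λ * G u a b) (a b c d : Fin 4) :
    weyl G u a b c d = riemann G u a b c d
      - Λ / 3 * (G u a c * G u b d - G u a d * G u b c) := by
  rw [weyl, hG.scalarCurv_of_einstein hu h, h, h, h, h]
  push_cast
  ring

theorem MetricOn.isWeyl_weyl (hG : MetricOn G U) (hu : u ∈ U) {Λ : ℝ}
    (h : ∀ a b, ricci G u a b = Λ * G u a b) : IsWeyl (G u)⁻¹ (weyl G u) := by
  have g := hG.symm_apply hu
  constructor
  · intro a b c d
    rw [hG.weyl_of_einstein hu h, hG.weyl_of_einstein hu h, hG.riemann_skew_left hu a b]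
    ring
  · intro a b c d
    rw [hG.weyl_of_einstein hu h, hG.weyl_of_einstein hu h, MetricOn.riemann_skew_right a b c d]
    ring
  · intro a b c d
    rw [hG.weyl_of_einstein hu h, hG.weyl_of_einstein hu h, hG.riemann_pair hu a b c d,
      g c a, g d b, g c b, g d a]
    ring
  · intro a b c d
    rw [hG.weyl_of_einstein hu h, hG.weyl_of_einstein hu h, hG.weyl_of_einstein hu h,
      g c b, g d b, g d c]
    linear_combination hG.riemann_cyclic hu a b c d
  · intro b d
    have h1 : ∀ x y, ∑ a, (G u)⁻¹ x a * G u a y = if x = y then 1 else 0 := fun x y => by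
      rw [← Matrix.mul_apply, hG.inv_mul hu, Matrix.one_apply]
    have e1 : ∑ a, ∑ c, (G u)⁻¹ a c * (G u a c * G u b d) = 4 * G u b d := by
      have : ∀ a, ∑ c, (G u)⁻¹ a c * (G u a c * G u b d) = G u b d := fun a => by
        calc _ = (∑ c, (G u)⁻¹ a c * G u c a) * G u b d := by
              rw [Finset.sum_mul]
              exact Finset.sum_congr rfl fun c _ => by rw [g a c]; ring
          _ = _ := by rw [h1]; simp
      simp [this]
    have e2 : ∑ a, ∑ c, (G u)⁻¹ a c * (G u a d * G u b c) = G u b d := by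
      have : ∀ a, ∑ c, (G u)⁻¹ a c * (G u a d * G u b c) = if a = b then G u a d else 0 :=
        fun a => by
          have h2 := h1 a b
          calc _ = (∑ c, (G u)⁻¹ a c * G u c b) * G u a d := by
                rw [Finset.sum_mul]
                exact Finset.sum_congr rfl fun c _ => by rw [g b c]; ring
            _ = _ := by rw [h2]; simp
      simp [this]
    -- The metric terms contract to `4 g - g = 3 g`, so `Λ / 3` times them cancels the Ricci tensor.
    have e3 := hG.ricci_eq_trace hu b d
    rw [h] at e3
    have : ∑ a, ∑ c, (G u)⁻¹ a c * weyl G u a b c d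
        = ∑ a, ∑ c, (G u)⁻¹ a c * riemann G u a b c d
          - Λ / 3 * (∑ a, ∑ c, (G u)⁻¹ a c * (G u a c * G u b d)
            - ∑ a, ∑ c, (G u)⁻¹ a c * (G u a d * G u b c)) := by
      rw [← Finset.sum_sub_distrib, Finset.mul_sum, ← Finset.sum_sub_distrib]
      refine Finset.sum_congr rfl fun a _ => ?_
      rw [← Finset.sum_sub_distrib, Finset.mul_sum, ← Finset.sum_sub_distrib]
      exact Finset.sum_congr rfl fun c _ => by rw [hG.weyl_of_einstein hu h]; ring
    rw [this, e1, e2, e3]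
    ring

namespace EinsteinCKYOn

variable (hY : EinsteinCKYOn G Y U)
include hY

theorem det_neg : ∀ v ∈ U, (G v).det < 0 := fun v hv => (hY.lorentzian v hv).det_neg

theorem isWeyl (hu : u ∈ U) : IsWeyl (G u)⁻¹ (weyl G u) := by
  obtain ⟨Λ, h⟩ := hY.einstein u hu
  exact hY.metric.isWeyl_weyl hu h

theorem dualVec_smooth (b : Fin 4) : ContDiffOn ℝ ∞ (fun v => dualVec G Y v b) U :=
  hY.metric.dualVec_smooth hY.det_neg hY.skew hY.smooth b

theorem vecD_smooth : MSmooth (vecD G (dualVec G Y)) U :=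
  hY.metric.vecD_smooth hY.dualVec_smooth

theorem divFun_smooth : ContDiffOn ℝ ∞ (divFun G Y) U := by
  have : divFun G Y = fun v => (∑ a, vecD G (dualVec G Y) v a a) * (1 / 4) := by
    funext v; simp [divFun, Matrix.trace, div_eq_mul_inv]
  rw [this]
  exact (ContDiffOn.sum fun a _ => hY.vecD_smooth a a).mul contDiffOn_const

theorem thetaFun_smooth (a : Fin 4) : ContDiffOn ℝ ∞ (fun v => thetaFun G Y v a) U :=
  (pderiv_contDiffOn hY.metric.isOpen hY.divFun_smooth a).add
    ((hY.metric.scalarCurv_smooth.div_const 12).mul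
      (ContDiffOn.sum fun d _ => (hY.metric.smooth d a).mul (hY.dualVec_smooth d)))

theorem covDeriv_skew (hu : u ∈ U) (e a b c : Fin 4) :
    covDeriv G Y u e ![b, a, c] = -covDeriv G Y u e ![a, b, c] ∧
    covDeriv G Y u e ![a, c, b] = -covDeriv G Y u e ![a, b, c] :=
  covDeriv_three_skew hY.metric.isOpen hu (fun v hv => (hY.skew v hv).swap_left)
    (fun v hv => (hY.skew v hv).swap_right) e a b c

/-- The dual vector field of a conformal Killing–Yano 3-form is a conformal Killing field. -/
theorem conformal : ∀ v ∈ U, vecD G (dualVec G Y) v * G v + (vecD G (dualVec G Y) v * G v)ᵀ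
    = (2 * divFun G Y v) • G v := by
  intro v hv
  obtain ⟨h, hh, hcky⟩ := hY.cky v hv
  have hc : ∀ (b : Fin 4) (c d : Fin 4), (Fin.cons b ![c, d] : Fin 3 → Fin 4) = ![b, c, d] :=
    fun _ _ _ => rfl
  refine conformal_of_cky (hY.metric.symm v hv) (volDensity_pos (hY.det_neg v hv)).ne'
    (h := fun a b => h ![a, b]) (T := fun e a b c => covDeriv G Y v e ![a, b, c])
    (fun a b => hh.swap_pair a b) (fun e a b c => (hY.covDeriv_skew hv e a b c).1)
    (fun e a b c => (hY.covDeriv_skew hv e a b c).2)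
    (fun e => hY.metric.covDeriv_form hY.det_neg hY.skew hY.smooth hv e) fun a b c d => ?_
  have := hcky a b ![c, d]
  rw [hc, hc, alternate_metric _ hh.swap_pair, alternate_metric _ hh.swap_pair] at this
  exact this

/-- The second covariant derivative of the dual vector field. -/
theorem endD_vecD (hu : u ∈ U) (c a b : Fin 4) :
    (endD G (vecD G (dualVec G Y)) c u * G u) a b
      = (∑ d, weyl G u d c a b * dualVec G Y u d) + thetaFun G Y u a * G u c b
        - thetaFun G Y u b * G u c a + pderiv c (divFun G Y) u * G u a b := by
  obtain ⟨Λ, hΛ⟩ := hY.einstein u hu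
  rw [hY.metric.endD_vecD_conformal hu hY.dualVec_smooth hY.divFun_smooth hY.conformal]
  simp only [thetaFun, hY.metric.scalarCurv_of_einstein hu hΛ, hY.metric.weyl_of_einstein hu hΛ,
    sub_mul, Finset.sum_sub_distrib]
  -- The constant-curvature part of Riemann has exactly the shape of the two skew `∂φ` terms and
  -- turns them into `θ`; the term symmetric in `a, b` keeps `∂φ`.
  have : ∑ d, Λ / 3 * (G u d a * G u c b - G u d b * G u c a) * dualVec G Y u d
      = Λ / 3 * (∑ d, G u d a * dualVec G Y u d) * G u c b
        - Λ / 3 * (∑ d, G u d b * dualVec G Y u d) * G u c a := by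
    simp only [Finset.mul_sum, Finset.sum_mul]
    rw [← Finset.sum_sub_distrib]
    exact Finset.sum_congr rfl fun d _ => by ring
  rw [this]
  ring

/-- `P` is the exterior derivative of `ξ` with its indices raised. Since the volume form is
parallel, contracting `∇Y` yields the dual of this bivector. -/
theorem divergence_components (hu : u ∈ U) {P : Matrix (Fin 4) (Fin 4) ℝ}
    (hP : P = (G u)⁻¹ * vecD G (dualVec G Y) u - ((G u)⁻¹ * vecD G (dualVec G Y) u)ᵀ) :
    (∀ a b, localDivergence G (q := 2) Y u ![b, a] = -localDivergence G (q := 2) Y u ![a, b]) ∧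
    localDivergence G (q := 2) Y u ![0, 1] = -(volDensity G u * P 2 3) ∧
    localDivergence G (q := 2) Y u ![0, 2] = volDensity G u * P 1 3 ∧
    localDivergence G (q := 2) Y u ![0, 3] = -(volDensity G u * P 1 2) ∧
    localDivergence G (q := 2) Y u ![1, 2] = -(volDensity G u * P 0 3) ∧
    localDivergence G (q := 2) Y u ![1, 3] = volDensity G u * P 0 2 ∧
    localDivergence G (q := 2) Y u ![2, 3] = -(volDensity G u * P 0 1) := by
  have h0 : ∀ b c, localDivergence G (q := 2) Y u ![b, c]
      = ∑ a, ∑ e, (G u)⁻¹ e a * covDeriv G Y u a ![e, b, c] := fun b c => by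
    refine Finset.sum_congr rfl fun a _ => Finset.sum_congr rfl fun e _ => ?_
    rw [← congrFun (congrFun (hY.metric.inv_symm hu) e) a]
    rfl
  refine ⟨fun a b => ?_, ?_⟩
  · rw [h0, h0, ← Finset.sum_neg_distrib]
    refine Finset.sum_congr rfl fun e _ => ?_
    rw [← Finset.sum_neg_distrib]
    exact Finset.sum_congr rfl fun c _ => by rw [(hY.covDeriv_skew hu e c a b).2]; ring
  have hT := fun e => skew_three_table (T := fun a b c => covDeriv G Y u e ![a, b, c])
    (fun a b c => (hY.covDeriv_skew hu e a b c).1) (fun a b c => (hY.covDeriv_skew hu e a b c).2)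
  have hK := hY.metric.covDeriv_form hY.det_neg hY.skew hY.smooth hu
  have z1 := fun e a b => ((hT e).1 a b).1
  have z2 := fun e a b => ((hT e).1 a b).2.1
  have a3 := fun e => (hT e).2.1.2.2.2.1
  have a2 := fun e => (hT e).2.1.2.1
  have b3 := fun e => (hT e).2.2.1.2.2.2.1
  have b2 := fun e => (hT e).2.2.1.2.1
  have c3 := fun e => (hT e).2.2.2.1.2.2.2.1
  have c2 := fun e => (hT e).2.2.2.1.2.1
  have d3 := fun e => (hT e).2.2.2.2.2.2.2.1
  have d2 := fun e => (hT e).2.2.2.2.2.1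
  have k3 := fun e => (hK e).1
  have k2 := fun e => (hK e).2.1
  have k1 := fun e => (hK e).2.2.1
  have k0 := fun e => (hK e).2.2.2
  refine ⟨?_, ?_, ?_, ?_, ?_, ?_⟩ <;>
  · rw [h0]
    simp only [hP, Fin.sum_univ_four, z1, z2, a2, a3, b2, b3, c2, c3, d2, d3, k0, k1, k2, k3,
      Matrix.sub_apply, Matrix.transpose_apply, Matrix.mul_apply]
    ring

/-- The divergence of a conformal Killing–Yano 3-form satisfies the Killing–Yano equation at a
point if and only if the dual vector annihilates the Weyl tensor there. -/
theorem divergence_killingYano_iff (hu : u ∈ U) :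
    (∀ a b c, covDeriv G (localDivergence G (q := 2) Y) u a ![b, c]
      + covDeriv G (localDivergence G (q := 2) Y) u b ![a, c] = 0)
    ↔ InKer (weyl G u) (dualVec G Y u) := by
  have hM := hY.metric
  have hC := hY.isWeyl hu
  set ξ := dualVec G Y u with hξ
  set B : Coord 4 → Matrix (Fin 4) (Fin 4) ℝ := fun v => (G v)⁻¹ * vecD G (dualVec G Y) v with hB
  set P : Coord 4 → Matrix (Fin 4) (Fin 4) ℝ := fun v => B v - (B v)ᵀ with hP
  have hBs : MSmooth B U := hM.inv_smooth.mul hY.vecD_smooth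
  have hPs : MSmooth P U := fun i j => (hBs i j).sub (hBs j i)
  have hA := fun v hv => hY.divergence_components (u := v) hv (P := P v) rfl
  have hcov := hM.covDeriv_dual_bivector hY.det_neg hPs
    (fun v _ a b => by simp [hP]) (fun v hv => (hA v hv).1) (fun v hv => (hA v hv).2) hu
  have hs : volDensity G u ≠ 0 := (volDensity_pos (hY.det_neg u hu)).ne'
  set A := localDivergence G (q := 2) Y
  have hcovs : ∀ e a b, covDeriv G A u e ![b, a] = -covDeriv G A u e ![a, b] := by
    intro e a b
    have p1 : pderiv e (fun v => A v ![b, a]) u = -pderiv e (fun v => A v ![a, b]) u := by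
      rw [← pderiv_neg]; exact pderiv_congr hM.isOpen hu fun v hv => (hA v hv).1 a b
    simp only [covDeriv_two, p1, neg_sub', ← Finset.sum_neg_distrib]
    congr 1
    refine Finset.sum_congr rfl fun d _ => ?_
    rw [(hA u hu).1 a d, (hA u hu).1 d b]; ring
  set Wl : Fin 4 → Matrix (Fin 4) (Fin 4) ℝ := fun e =>
    Matrix.of fun a b => ∑ d, weyl G u d e a b * ξ d with hWl
  set θ := (G u)⁻¹ *ᵥ thetaFun G Y u with hθ
  have hWls : ∀ e, (Wl e)ᵀ = -Wl e := by
    intro e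
    ext a b
    simp only [hWl, Matrix.transpose_apply, Matrix.of_apply, Matrix.neg_apply,
      ← Finset.sum_neg_distrib]
    exact Finset.sum_congr rfl fun d _ => by rw [hC.skew_right d e b a]; ring
  have hinv := hM.inv_mul hu
  have hmul := hM.mul_inv hu
  have hGt := hM.inv_symm hu
  -- Decomposition of `∇P` into the Weyl part and a pure trace built from `θ`.
  have hbiv : ∀ e, bivD G P e u = (2 : ℝ) • ((G u)⁻¹ * Wl e * (G u)⁻¹)
      + (2 : ℝ) • (Matrix.vecMulVec θ (Pi.single e 1) - Matrix.vecMulVec (Pi.single e 1) θ) := by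
    intro e
    have b1 : bivD G P e u = bivD G B e u - (bivD G B e u)ᵀ := by
      have : mpderiv e P u = mpderiv e B u - (mpderiv e B u)ᵀ := by
        rw [← mpderiv_transpose]
        exact mpderiv_sub hM.isOpen hBs hBs.transpose hu
      rw [bivD, this]
      simp only [bivD, hP, Matrix.transpose_add, Matrix.transpose_mul, Matrix.transpose_transpose]
      noncomm_ring
    have b2 : G u * bivD G B e u = endD G (vecD G (dualVec G Y)) e u :=
      (hM.endD_eq_mul_bivD hu hBs (fun v hv => by
        rw [hB, ← Matrix.mul_assoc, hM.mul_inv hv, Matrix.one_mul]) e).symm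
    set N := endD G (vecD G (dualVec G Y)) e u * G u with hN
    have b3 : bivD G B e u = (G u)⁻¹ * N * (G u)⁻¹ := by
      rw [hN, ← b2]
      calc bivD G B e u = ((G u)⁻¹ * G u) * bivD G B e u * (G u * (G u)⁻¹) := by
            rw [hinv, hmul]; simp
        _ = _ := by noncomm_ring
    -- Antisymmetrising removes the one term `φ_c g_{ab}` not expressed by `θ`.
    have b4 : N - Nᵀ = (2 : ℝ) • Wl e + (2 : ℝ) • (Matrix.vecMulVec (thetaFun G Y u) (G u e)
        - Matrix.vecMulVec (G u e) (thetaFun G Y u)) := by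
      ext a b
      simp only [Matrix.sub_apply, Matrix.transpose_apply, Matrix.add_apply, Matrix.smul_apply,
        Matrix.vecMulVec_apply, hN, hY.endD_vecD hu, smul_eq_mul]
      have hw : ∑ d, weyl G u d e b a * dualVec G Y u d = -Wl e a b :=
        congrFun (congrFun (hWls e) a) b
      have hw' : ∑ d, weyl G u d e a b * dualVec G Y u d = Wl e a b := rfl
      rw [hw, hw', hM.symm_apply hu b a]
      ring
    have b5 : G u e ᵥ* (G u)⁻¹ = Pi.single e 1 := by
      have : G u e = Pi.single e 1 ᵥ* G u := by simp; rfl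
      rw [this, Matrix.vecMul_vecMul, hmul, Matrix.vecMul_one]
    have b6 : (G u)⁻¹ *ᵥ G u e = Pi.single e 1 := by
      rw [← b5, ← Matrix.mulVec_transpose, hGt]
    have b7 : thetaFun G Y u ᵥ* (G u)⁻¹ = θ := by
      rw [hθ, ← Matrix.mulVec_transpose, hGt]
    have b8 : bivD G B e u - (bivD G B e u)ᵀ = (G u)⁻¹ * (N - Nᵀ) * (G u)⁻¹ := by
      rw [b3]
      simp only [Matrix.transpose_mul, hGt]
      noncomm_ring
    rw [b1, b8, b4]
    simp only [Matrix.mul_add, Matrix.add_mul, Matrix.mul_sub, Matrix.sub_mul, Matrix.mul_smul,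
      Matrix.smul_mul, Matrix.mul_vecMulVec, Matrix.vecMulVec_mul, b5, b6, b7, ← hθ]
  set W : Fin 4 → Fin 4 → Fin 4 → ℝ := fun e => (G u)⁻¹ * Wl e * (G u)⁻¹ with hW
  have hWs : ∀ e a b, W e b a = -W e a b := by
    intro e a b
    have : ((G u)⁻¹ * Wl e * (G u)⁻¹)ᵀ = -((G u)⁻¹ * Wl e * (G u)⁻¹) := by
      simp only [Matrix.transpose_mul, hGt, hWls]
      noncomm_ring
    exact congrFun (congrFun this a) b
  -- This is tracelessness of the Weyl tensor, after moving `ξ` to the free slot.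
  have htr : ∀ b, ∑ e, W e e b = 0 := by
    intro b
    have t : ∀ y, ∑ e, ((G u)⁻¹ * Wl e) e y = 0 := by
      intro y
      have : ∑ e, ((G u)⁻¹ * Wl e) e y
          = ∑ d, (-∑ e, ∑ a, (G u)⁻¹ e a * weyl G u e d a y) * ξ d := by
        simp only [Matrix.mul_apply, hWl, Matrix.of_apply, Finset.mul_sum, Finset.sum_mul,
          ← Finset.sum_neg_distrib]
        conv_rhs => rw [Finset.sum_comm]
        refine Finset.sum_congr rfl fun e _ => ?_
        rw [Finset.sum_comm]
        exact Finset.sum_congr rfl fun d _ => Finset.sum_congr rfl fun a _ => by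
          rw [hC.skew_left e d]; ring
      rw [this]
      simp [hC.trace]
    simp only [hW, Matrix.mul_apply (M := (G u)⁻¹ * Wl _)]
    rw [Finset.sum_comm]
    refine Finset.sum_eq_zero fun y _ => ?_
    rw [← Finset.sum_mul, t, zero_mul]
  have hWz : W = 0 ↔ InKer (weyl G u) ξ := by
    constructor
    · intro h a b c
      have h1 : Wl c = 0 := by
        have h2 : (G u)⁻¹ * Wl c * (G u)⁻¹ = 0 := congrFun h c
        calc Wl c = (G u * (G u)⁻¹) * Wl c * ((G u)⁻¹ * G u) := by rw [hinv, hmul]; simp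
          _ = G u * ((G u)⁻¹ * Wl c * (G u)⁻¹) * G u := by noncomm_ring
          _ = 0 := by rw [h2]; simp
      have h2 : ∑ d, weyl G u d c a b * ξ d = 0 := congrFun (congrFun h1 a) b
      rw [← neg_eq_zero, ← h2, ← Finset.sum_neg_distrib]
      exact Finset.sum_congr rfl fun d _ => by rw [hC.pair a b c d, hC.skew_left c d]; ring
    · intro h
      have h1 : ∀ e, Wl e = 0 := by
        intro e
        ext a b
        have h2 := h a b e
        simp only [hWl, Matrix.of_apply, Matrix.zero_apply]
        rw [← neg_eq_zero, ← h2, ← Finset.sum_neg_distrib]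
        exact Finset.sum_congr rfl fun d _ => by rw [hC.pair a b e d, hC.skew_left e d]; ring
      funext e
      simp only [hW, h1, Matrix.mul_zero, Matrix.zero_mul]
      rfl
  -- Dividing by twice the density normalises both the factor `2` in `hbiv` and the density in the
  -- duality.
  rw [← hWz, ← killingYano_iff_weylPart
    (c := fun e a b => covDeriv G A u e ![a, b] / (2 * volDensity G u))
    (D := fun e a b => bivD G P e u a b / 2) (θ := θ) (fun e a b => by rw [hcovs]; ring) hWs
    (fun e a b => by
      rw [hbiv]
      simp only [Matrix.add_apply, Matrix.smul_apply, Matrix.sub_apply, Matrix.vecMulVec_apply,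
        Pi.single_apply, smul_eq_mul, eq_comm (a := b), eq_comm (a := a), mul_ite, ite_mul,
        mul_one, mul_zero, one_mul, zero_mul, hW]
      ring) htr (fun e => by
      obtain ⟨h1, h2, h3, h4, h5, h6⟩ := hcov e
      simp only [h1, h2, h3, h4, h5, h6]
      refine ⟨?_, ?_, ?_, ?_, ?_, ?_⟩ <;> field_simp)]
  refine forall_congr' fun a => forall_congr' fun b => forall_congr' fun c => ?_
  rw [← add_div, div_eq_zero_iff]
  simp [hs]

end EinsteinCKYOn

end EinsteinCKY

/-! ### Unique continuation from differential inequalities. -/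

section UniqueContinuation

open Filter Topology Asymptotics Matrix

/-- A function vanishes near one of its zeros if its derivative is dominated by it. -/
theorem eventually_eq_zero_of_fderiv_isBigO {E F : Type*} [NormedAddCommGroup E]
    [NormedSpace ℝ E] [NormedAddCommGroup F] [NormedSpace ℝ F] {W : E → F} {u : E}
    (hd : ∀ᶠ v in 𝓝 u, DifferentiableAt ℝ W v) (hO : fderiv ℝ W =O[𝓝 u] W) (h0 : W u = 0) :
    ∀ᶠ v in 𝓝 u, W v = 0 := by
  obtain ⟨C, hC⟩ := hO.bound
  obtain ⟨r, hr, hB⟩ := Metric.eventually_nhds_iff_ball.1 (hd.and hC)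
  refine Metric.eventually_nhds_iff_ball.2 ⟨r, hr, fun v hv => ?_⟩
  have hseg : ∀ t ∈ Set.Icc (0 : ℝ) 1, u + t • (v - u) ∈ Metric.ball u r := by
    intro t ht
    rw [mem_ball_iff_norm] at hv ⊢
    rw [add_sub_cancel_left, norm_smul, Real.norm_of_nonneg ht.1]
    exact lt_of_le_of_lt (mul_le_of_le_one_left (norm_nonneg _) ht.2) hv
  have hder : ∀ t ∈ Set.Icc (0 : ℝ) 1, HasDerivAt (fun t : ℝ => W (u + t • (v - u)))
      (fderiv ℝ W (u + t • (v - u)) (v - u)) t := by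
    intro t ht
    have h1 : HasDerivAt (fun t : ℝ => u + t • (v - u)) (v - u) t := by
      simpa using ((hasDerivAt_id t).smul_const (v - u)).const_add u
    exact (hB _ (hseg t ht)).1.hasFDerivAt.comp_hasDerivAt t h1
  -- Grönwall on the segment from `u` to `v`: zero initial value and a linear bound, hence zero at
  -- `t = 1`. The absolute value of `C` covers a possibly negative constant.
  have := norm_le_gronwallBound_of_norm_deriv_right_le (f := fun t : ℝ => W (u + t • (v - u)))
    (f' := fun t => fderiv ℝ W (u + t • (v - u)) (v - u)) (δ := 0) (K := |C| * ‖v - u‖) (ε := 0)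
    (a := 0) (b := 1) (fun t ht => (hder t ht).continuousAt.continuousWithinAt)
    (fun t ht => (hder t ⟨ht.1, ht.2.le⟩).hasDerivWithinAt) (by simp [h0])
    (fun t ht => by
      have h1 := (hB _ (hseg t ⟨ht.1, ht.2.le⟩)).2
      calc _ ≤ ‖fderiv ℝ W (u + t • (v - u))‖ * ‖v - u‖ := ContinuousLinearMap.le_opNorm _ _
        _ ≤ (|C| * ‖W (u + t • (v - u))‖) * ‖v - u‖ := by
            gcongr
            exact h1.trans (by gcongr; exact le_abs_self C)
        _ = _ := by ring) 1 (by simp)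
  simpa [gronwallBound_ε0, gronwallBound] using this

theorem fderiv_isBigO_of_pderiv {n : ℕ} {ι : Type*} [Fintype ι] {W : Coord n → ι → ℝ}
    {u : Coord n} (hd : ∀ᶠ v in 𝓝 u, DifferentiableAt ℝ W v)
    (h : ∀ a i, pderiv a (fun v => W v i) =O[𝓝 u] W) : fderiv ℝ W =O[𝓝 u] W := by
  have e1 : ∀ L : Coord n →L[ℝ] (ι → ℝ),
      ‖L‖ ≤ ∑ a, ‖L (EuclideanSpace.single a 1)‖ := by
    intro L
    refine ContinuousLinearMap.opNorm_le_bound _ (Finset.sum_nonneg fun _ _ => norm_nonneg _)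
      fun x => ?_
    have hx : x = ∑ a, x a • EuclideanSpace.single a (1 : ℝ) := by
      ext i
      simp [Pi.single_apply]
    have : L x = ∑ a, x a • L (EuclideanSpace.single a 1) := by
      conv_lhs => rw [hx, map_sum]
      simp
    rw [this, Finset.sum_mul]
    refine (norm_sum_le _ _).trans (Finset.sum_le_sum fun a _ => ?_)
    rw [norm_smul, mul_comm]
    gcongr
    exact PiLp.norm_apply_le x a
  have e2 : ∀ a, (fun v => fderiv ℝ W v (EuclideanSpace.single a 1)) =O[𝓝 u] W := by
    intro a
    refine isBigO_pi.2 fun i => (h a i).congr' ?_ EventuallyEq.rfl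
    filter_upwards [hd] with v hv
    rw [pderiv, fderiv_pi (differentiableAt_pi.1 hv)]
    rfl
  refine IsBigO.trans (g := fun v => ∑ a, ‖fderiv ℝ W v (EuclideanSpace.single a 1)‖) ?_
    (IsBigO.fun_sum fun a _ => (e2 a).norm_left)
  exact IsBigO.of_bound 1 (Eventually.of_forall fun v => by
    rw [one_mul]; exact (e1 _).trans (le_abs_self _))

/-- The functions that are dominated near `u` by `W`, together with their derivatives. -/
structure Tame {n : ℕ} {ι : Type*} [Fintype ι] (W : Coord n → ι → ℝ) (U : Set (Coord n))
    (u : Coord n) (f : Coord n → ℝ) : Prop where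
  smooth : ContDiffOn ℝ ∞ f U
  isBigO : f =O[𝓝 u] W
  pderiv_isBigO : ∀ a, pderiv a f =O[𝓝 u] W

section Tame

variable {n : ℕ} {ι : Type*} [Fintype ι] {W : Coord n → ι → ℝ} {U : Set (Coord n)}
  {u : Coord n} {f g c : Coord n → ℝ}

theorem isBigO_smooth_mul (hU : IsOpen U) (hu : u ∈ U) (hc : ContDiffOn ℝ ∞ c U)
    (hf : f =O[𝓝 u] W) : (fun v => c v * f v) =O[𝓝 u] W := by
  have h1 : c =O[𝓝 u] (fun _ => (1 : ℝ)) :=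
    (hc.continuousOn.continuousAt (hU.mem_nhds hu)).isBigO_one ℝ
  refine IsBigO.of_norm_right ((h1.mul hf.norm_right).congr_right fun v => ?_)
  rw [one_mul]

theorem Tame.add (hU : IsOpen U) (hu : u ∈ U) (hf : Tame W U u f) (hg : Tame W U u g) :
    Tame W U u (fun v => f v + g v) := by
  refine ⟨hf.smooth.add hg.smooth, hf.isBigO.add hg.isBigO, fun a =>
    ((hf.pderiv_isBigO a).add (hg.pderiv_isBigO a)).congr' ?_ EventuallyEq.rfl⟩
  filter_upwards [hU.mem_nhds hu] with v hv
  exact (pderiv_add (differentiableAt_of_contDiffOn hU hf.smooth hv)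
    (differentiableAt_of_contDiffOn hU hg.smooth hv)).symm

theorem Tame.smooth_mul (hU : IsOpen U) (hu : u ∈ U) (hc : ContDiffOn ℝ ∞ c U)
    (hf : Tame W U u f) : Tame W U u (fun v => c v * f v) := by
  refine ⟨hc.mul hf.smooth, isBigO_smooth_mul hU hu hc hf.isBigO, fun a =>
    ((isBigO_smooth_mul hU hu (pderiv_contDiffOn hU hc a) hf.isBigO).add
      (isBigO_smooth_mul hU hu hc (hf.pderiv_isBigO a))).congr' ?_ EventuallyEq.rfl⟩
  filter_upwards [hU.mem_nhds hu] with v hv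
  rw [pderiv_mul (differentiableAt_of_contDiffOn hU hc hv)
    (differentiableAt_of_contDiffOn hU hf.smooth hv)]

theorem Tame.sum {κ : Type*} {s : Finset κ} {F : κ → Coord n → ℝ} (hU : IsOpen U) (hu : u ∈ U)
    (hF : ∀ k ∈ s, Tame W U u (F k)) : Tame W U u (fun v => ∑ k ∈ s, F k v) := by
  refine ⟨ContDiffOn.sum fun k hk => (hF k hk).smooth, IsBigO.fun_sum fun k hk => (hF k hk).isBigO,
    fun a => (IsBigO.fun_sum fun k hk => (hF k hk).pderiv_isBigO a).congr' ?_ EventuallyEq.rfl⟩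
  filter_upwards [hU.mem_nhds hu] with v hv
  exact (pderiv_sum fun k hk => differentiableAt_of_contDiffOn hU (hF k hk).smooth hv).symm

end Tame

end UniqueContinuation

/-! ### Prolongation: zeros of `ξ` and of its derivatives. -/

section Jet

open Filter Topology Asymptotics Matrix

variable {G : Coord 4 → Matrix (Fin 4) (Fin 4) ℝ} {Y : Coord 4 → (Fin 3 → Fin 4) → ℝ}
  {U : Set (Coord 4)} {u : Coord 4}

/-- The dual vector field of a field of 3-forms, with its prolongation variables. -/
def jet (G : Coord 4 → Matrix (Fin 4) (Fin 4) ℝ) (Y : Coord 4 → (Fin 3 → Fin 4) → ℝ)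
    (u : Coord 4) : (Fin 4 ⊕ (Fin 4 × Fin 4)) ⊕ Fin 4 → ℝ :=
  Sum.elim (Sum.elim (dualVec G Y u) fun p => vecD G (dualVec G Y) u p.1 p.2) (thetaFun G Y u)

theorem jet_eq_zero_iff : jet G Y u = 0 ↔
    dualVec G Y u = 0 ∧ vecD G (dualVec G Y) u = 0 ∧ thetaFun G Y u = 0 := by
  constructor
  · intro h
    exact ⟨funext fun b => congrFun h (Sum.inl (Sum.inl b)),
      Matrix.ext fun a b => congrFun h (Sum.inl (Sum.inr (a, b))),
      funext fun b => congrFun h (Sum.inr b)⟩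
  · rintro ⟨h1, h2, h3⟩
    funext i
    rcases i with (b | p) | b <;> simp [jet, h1, h2, h3]

namespace EinsteinCKYOn

variable (hY : EinsteinCKYOn G Y U)
include hY

theorem jet_smooth (i) : ContDiffOn ℝ ∞ (fun v => jet G Y v i) U := by
  rcases i with (b | p) | b
  · exact hY.dualVec_smooth b
  · exact hY.vecD_smooth p.1 p.2
  · exact hY.thetaFun_smooth b

omit hY in
theorem pderiv_dualVec (a b : Fin 4) : pderiv a (fun v => dualVec G Y v b) u
    = vecD G (dualVec G Y) u a b + ∑ c, -christoffel G u b a c * dualVec G Y u c := by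
  simp only [vecD, Matrix.of_apply, neg_mul, Finset.sum_neg_distrib]
  ring

/-- When `ξ` annihilates `C`, the only curvature left in `∇∇ξ` is scalar, and `∂φ` is rewritten by
`θ` and `ξ`, so the system closes linearly on `(ξ, ∇ξ, θ)`. The first group contains only `ξ` and
`∇ξ`, whose derivatives are already controlled; the second isolates `θ`. -/
theorem pderiv_vecD (hu : u ∈ U) (hk : InKer (weyl G u) (dualVec G Y u)) (c a f : Fin 4) :
    pderiv c (fun v => vecD G (dualVec G Y) v a f) u
      = ((∑ d, christoffel G u d c a * vecD G (dualVec G Y) u d f)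
        + (∑ d, -christoffel G u f c d * vecD G (dualVec G Y) u a d)
        + ∑ d, -(scalarCurv G u / 12 * (if a = f then G u d c else 0)) * dualVec G Y u d)
        + ((if c = f then thetaFun G Y u a else 0)
          + (∑ b, -(G u c a * (G u)⁻¹ b f) * thetaFun G Y u b)
          + if a = f then thetaFun G Y u c else 0) := by
  have hM := hY.metric
  have hC := hY.isWeyl hu
  set K := vecD G (dualVec G Y) with hK
  have h1 : endD G K c u = (endD G K c u * G u) * (G u)⁻¹ := by
    rw [Matrix.mul_assoc, hM.mul_inv hu, Matrix.mul_one]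
  have hg : ∀ a, ∑ b, G u a b * (G u)⁻¹ b f = if a = f then 1 else 0 := fun a => by
    rw [← Matrix.mul_apply, hM.mul_inv hu, Matrix.one_apply]
  have h2 : endD G K c u a f = thetaFun G Y u a * (if c = f then 1 else 0)
      + (∑ b, -(G u c a * (G u)⁻¹ b f) * thetaFun G Y u b)
      + pderiv c (divFun G Y) u * (if a = f then 1 else 0) := by
    rw [h1, Matrix.mul_apply, ← hg, ← hg, Finset.mul_sum, Finset.mul_sum,
      ← Finset.sum_add_distrib, ← Finset.sum_add_distrib]
    refine Finset.sum_congr rfl fun b _ => ?_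
    have h3 : ∑ d, weyl G u d c a b * dualVec G Y u d = 0 := by
      rw [← neg_eq_zero, ← hk a b c, ← Finset.sum_neg_distrib]
      exact Finset.sum_congr rfl fun d _ => by rw [hC.pair a b c d, hC.skew_left c d]; ring
    rw [hY.endD_vecD hu, h3]
    ring
  have h3 : pderiv c (divFun G Y) u = thetaFun G Y u c
      - scalarCurv G u / 12 * ∑ d, G u d c * dualVec G Y u d := by
    rw [thetaFun]; ring
  have h4 : pderiv c (fun v => K v a f) u = endD G K c u a f
      + (∑ d, christoffel G u d c a * K u d f) - ∑ d, christoffel G u f c d * K u a d := by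
    simp only [endD, Matrix.add_apply, Matrix.sub_apply, Matrix.mul_apply, Matrix.transpose_apply,
      connMat_apply, mpderiv_apply]
    rw [Finset.sum_congr rfl fun d _ => mul_comm (K u a d) (christoffel G u f c d)]
    ring
  rw [h4, h2, h3]
  by_cases haf : a = f
  · simp only [haf, if_true, neg_mul, Finset.sum_neg_distrib, Finset.mul_sum, mul_assoc]
    split_ifs <;> ring
  · simp only [haf, if_false, neg_mul, Finset.sum_neg_distrib]
    split_ifs <;> simp <;> ring

theorem tame_dualVec (hu : u ∈ U) (b : Fin 4) :
    Tame (jet G Y) U u (fun v => dualVec G Y v b) := by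
  have hc : ∀ i, (fun v => jet G Y v i) =O[𝓝 u] jet G Y := fun i =>
    IsBigO.of_bound 1 (Eventually.of_forall fun v => by
      rw [one_mul]; exact norm_le_pi_norm (jet G Y v) i)
  refine ⟨hY.dualVec_smooth b, hc (Sum.inl (Sum.inl b)), fun a => ?_⟩
  have h1 : pderiv a (fun v => dualVec G Y v b)
      = fun v => vecD G (dualVec G Y) v a b + ∑ c, -christoffel G v b a c * dualVec G Y v c := by
    funext v; exact pderiv_dualVec a b
  rw [h1]
  exact (hc (Sum.inl (Sum.inr (a, b)))).add (IsBigO.fun_sum fun c _ =>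
    isBigO_smooth_mul hY.metric.isOpen hu (hY.metric.christoffel_smooth b a c).neg
      (hc (Sum.inl (Sum.inl c))))

theorem tame_vecD (hu : u ∈ U) (hk : ∀ v ∈ U, InKer (weyl G v) (dualVec G Y v)) (a f : Fin 4) :
    Tame (jet G Y) U u (fun v => vecD G (dualVec G Y) v a f) := by
  have hU := hY.metric.isOpen
  have hΓ := hY.metric.christoffel_smooth
  have hc : ∀ i, (fun v => jet G Y v i) =O[𝓝 u] jet G Y := fun i =>
    IsBigO.of_bound 1 (Eventually.of_forall fun v => by
      rw [one_mul]; exact norm_le_pi_norm (jet G Y v) i)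
  have hK : ∀ a b, (fun v => vecD G (dualVec G Y) v a b) =O[𝓝 u] jet G Y := fun a b =>
    hc (Sum.inl (Sum.inr (a, b)))
  have hθ : ∀ b, (fun v => thetaFun G Y v b) =O[𝓝 u] jet G Y := fun b => hc (Sum.inr b)
  refine ⟨hY.vecD_smooth a f, hK a f, fun c => ?_⟩
  refine IsBigO.congr' ?_ (eventually_of_mem (hU.mem_nhds hu) fun v hv =>
    (hY.pderiv_vecD hv (hk v hv) c a f).symm) EventuallyEq.rfl
  refine (((IsBigO.fun_sum fun d _ => isBigO_smooth_mul hU hu (hΓ d c a) (hK d f)).add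
    (IsBigO.fun_sum fun d _ => isBigO_smooth_mul hU hu (hΓ f c d).neg (hK a d))).add
    (IsBigO.fun_sum fun d _ => isBigO_smooth_mul hU hu ?_ (hc (Sum.inl (Sum.inl d))))).add
    ((IsBigO.add ?_ (IsBigO.fun_sum fun b _ => isBigO_smooth_mul hU hu
      ((hY.metric.smooth c a).mul (hY.metric.inv_smooth b f)).neg (hθ b))).add ?_)
  · refine ((hY.metric.scalarCurv_smooth.div_const 12).mul ?_).neg
    split_ifs
    exacts [hY.metric.smooth d c, contDiffOn_const]
  · split_ifs
    exacts [hθ a, isBigO_zero _ _]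
  · split_ifs
    exacts [hθ c, isBigO_zero _ _]

/-- One more derivative of `pderiv_vecD`. All terms bounded by the jet go into `X`, so that only the
uncontrolled derivatives of `θ` stay explicit. -/
theorem pderiv_pderiv_vecD (hu : u ∈ U) (hk : ∀ v ∈ U, InKer (weyl G v) (dualVec G Y v))
    (d c a f : Fin 4) : ∃ X : Coord 4 → ℝ, X =O[𝓝 u] jet G Y ∧ ∀ v ∈ U,
      pderiv d (fun v => pderiv c (fun v => vecD G (dualVec G Y) v a f) v) v = X v
        + ((if c = f then pderiv d (fun v => thetaFun G Y v a) v else 0)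
          + (∑ b, -(G v c a * (G v)⁻¹ b f) * pderiv d (fun v => thetaFun G Y v b) v)
          + if a = f then pderiv d (fun v => thetaFun G Y v c) v else 0) := by
  have hU := hY.metric.isOpen
  have hΓ := hY.metric.christoffel_smooth
  have hcoef : ∀ b, ContDiffOn ℝ ∞ (fun v => -(G v c a * (G v)⁻¹ b f)) U := fun b =>
    ((hY.metric.smooth c a).mul (hY.metric.inv_smooth b f)).neg
  have hθs := hY.thetaFun_smooth
  set S : Coord 4 → ℝ := fun u => (∑ d, christoffel G u d c a * vecD G (dualVec G Y) u d f)
        + (∑ d, -christoffel G u f c d * vecD G (dualVec G Y) u a d)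
        + ∑ d, -(scalarCurv G u / 12 * (if a = f then G u d c else 0)) * dualVec G Y u d with hS
  have hSt : Tame (jet G Y) U u S := by
    refine Tame.add hU hu (Tame.add hU hu ?_ ?_) ?_
    · exact Tame.sum hU hu fun d _ => (hY.tame_vecD hu hk d f).smooth_mul hU hu (hΓ d c a)
    · exact Tame.sum hU hu fun d _ => (hY.tame_vecD hu hk a d).smooth_mul hU hu (hΓ f c d).neg
    · refine Tame.sum hU hu fun d _ => (hY.tame_dualVec hu d).smooth_mul hU hu
        ((hY.metric.scalarCurv_smooth.div_const 12).mul ?_).neg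
      split_ifs
      exacts [hY.metric.smooth d c, contDiffOn_const]
  refine ⟨fun v => pderiv d S v
    + ∑ b, pderiv d (fun v => -(G v c a * (G v)⁻¹ b f)) v * thetaFun G Y v b, ?_, ?_⟩
  · refine (hSt.pderiv_isBigO d).add (IsBigO.fun_sum fun b _ =>
      isBigO_smooth_mul hU hu (pderiv_contDiffOn hU (hcoef b) d) ?_)
    exact IsBigO.of_bound 1 (Eventually.of_forall fun v => by
      rw [one_mul]; exact norm_le_pi_norm (jet G Y v) (Sum.inr b))
  · intro v hv
    have hθd := fun b => differentiableAt_of_contDiffOn hU (hθs b) hv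
    have hcd := fun b => differentiableAt_of_contDiffOn hU (hcoef b) hv
    have hite : ∀ (p : Prop) [Decidable p] (b : Fin 4),
        DifferentiableAt ℝ (fun v => if p then thetaFun G Y v b else 0) v := by
      intro p _ b
      split_ifs
      exacts [hθd b, differentiableAt_const _]
    have hitep : ∀ (p : Prop) [Decidable p] (b : Fin 4),
        pderiv d (fun v => if p then thetaFun G Y v b else 0) v
          = if p then pderiv d (fun v => thetaFun G Y v b) v else 0 := by
      intro p _ b
      split_ifs
      exacts [rfl, pderiv_const 0]
    have hsum : DifferentiableAt ℝ
        (fun v => ∑ b, -(G v c a * (G v)⁻¹ b f) * thetaFun G Y v b) v :=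
      DifferentiableAt.fun_sum fun b _ => (hcd b).fun_mul (hθd b)
    rw [pderiv_congr hU hv fun w hw => hY.pderiv_vecD hw (hk w hw) c a f,
      pderiv_add (differentiableAt_of_contDiffOn hU hSt.smooth hv)
        (((hite _ a).fun_add hsum).fun_add (hite _ c)),
      pderiv_add ((hite _ a).fun_add hsum) (hite _ c), pderiv_add (hite _ a) hsum, hitep, hitep,
      pderiv_sum fun b _ => (hcd b).fun_mul (hθd b),
      Finset.sum_congr rfl fun b _ => pderiv_mul (hcd b) (hθd b), Finset.sum_add_distrib]
    ring

/-- The prolongation closes here: commutation of second partials of `∇ξ`, contracted over one pair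
of indices, is an invertible linear system for `∂θ` modulo terms bounded by the jet. Neither
constancy of the scalar curvature nor derivatives of the Weyl tensor are needed. -/
theorem pderiv_thetaFun_isBigO (hu : u ∈ U)
    (hk : ∀ v ∈ U, InKer (weyl G v) (dualVec G Y v)) (d a : Fin 4) :
    pderiv d (fun v => thetaFun G Y v a) =O[𝓝 u] jet G Y := by
  have hU := hY.metric.isOpen
  have hM := hY.metric
  choose X hXO hX using hY.pderiv_pderiv_vecD hu hk
  set Θ : Fin 4 → Fin 4 → Coord 4 → ℝ := fun d a v => pderiv d (fun v => thetaFun G Y v a) v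
    with hΘ
  set T : Coord 4 → ℝ := fun v => ∑ f, ∑ b, (G v)⁻¹ b f * Θ f b v with hT
  set r : Fin 4 → Fin 4 → Coord 4 → ℝ := fun d a v =>
    (∑ f, X f d a f v) + ∑ f, -X d f a f v with hr
  have hrO : ∀ d a, r d a =O[𝓝 u] jet G Y := fun d a =>
    (IsBigO.fun_sum fun f _ => hXO f d a f).add (IsBigO.fun_sum fun f _ => (hXO d f a f).neg_left)
  -- Equality of `∂_f ∂_d` and `∂_d ∂_f` on `∇ₐ ξᶠ`, summed over `f`. The coefficient `3` is `4 - 1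
  -- + 1 - 1`, from the Kronecker deltas and the contracted metric.
  have hrel : ∀ d a, ∀ v ∈ U, r d a v = 3 * Θ d a v - Θ a d v + G v d a * T v := by
    intro d a v hv
    have h1 : ∀ f, X f d a f v - X d f a f v
        = ((if f = f then Θ d a v else 0) + (∑ b, -(G v f a * (G v)⁻¹ b f) * Θ d b v)
            + if a = f then Θ d f v else 0)
          - ((if d = f then Θ f a v else 0) + (∑ b, -(G v d a * (G v)⁻¹ b f) * Θ f b v)
            + if a = f then Θ f d v else 0) := by
      intro f
      have e1 := hX f d a f v hv
      have e2 := hX d f a f v hv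
      rw [pderiv_comm hU (hY.vecD_smooth a f) hv] at e1
      linarith
    have h2 : ∑ f, ∑ b, -(G v f a * (G v)⁻¹ b f) * Θ d b v = -Θ d a v := by
      rw [Finset.sum_comm]
      have : ∀ b, ∑ f, -(G v f a * (G v)⁻¹ b f) * Θ d b v = if b = a then -Θ d b v else 0 := by
        intro b
        have h3 : ∑ f, (G v)⁻¹ b f * G v f a = if b = a then 1 else 0 := by
          rw [← Matrix.mul_apply, hM.inv_mul hv, Matrix.one_apply]
        calc _ = -(∑ f, (G v)⁻¹ b f * G v f a) * Θ d b v := by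
              rw [← Finset.sum_neg_distrib, Finset.sum_mul]
              exact Finset.sum_congr rfl fun f _ => by ring
          _ = _ := by rw [h3]; split_ifs <;> simp
      simp only [this]
      simp
    have h4 : ∑ f, ∑ b, -(G v d a * (G v)⁻¹ b f) * Θ f b v = -(G v d a * T v) := by
      simp only [hT, Finset.mul_sum, ← Finset.sum_neg_distrib]
      exact Finset.sum_congr rfl fun f _ => Finset.sum_congr rfl fun b _ => by ring
    simp only [hr]
    rw [← Finset.sum_add_distrib, Finset.sum_congr rfl fun f _ => (sub_eq_add_neg _ _).symm.trans
      (h1 f)]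
    simp only [Finset.sum_sub_distrib, Finset.sum_add_distrib, h2, h4]
    simp
    ring
  -- Tracing gives `3 - 1 + 4 = 6` times `T`.
  have hTr : ∀ v ∈ U, ∑ f, ∑ b, (G v)⁻¹ b f * r f b v = 6 * T v := by
    intro v hv
    have h1 : ∑ f, ∑ b, (G v)⁻¹ b f * Θ b f v = T v := by
      rw [hT, Finset.sum_comm]
      exact Finset.sum_congr rfl fun b _ => Finset.sum_congr rfl fun f _ => by
        rw [← congrFun (congrFun (hM.inv_symm hv) f) b]; rfl
    have h2 : ∑ f, ∑ b, (G v)⁻¹ b f * G v f b = 4 := by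
      rw [Finset.sum_comm]
      simp only [← Matrix.mul_apply, hM.inv_mul hv]
      simp
    have h3 : ∀ t, ∑ f, ∑ b, (G v)⁻¹ b f * (3 * Θ f b v - Θ b f v + G v f b * t)
        = 3 * ∑ f, ∑ b, (G v)⁻¹ b f * Θ f b v - ∑ f, ∑ b, (G v)⁻¹ b f * Θ b f v
        + (∑ f, ∑ b, (G v)⁻¹ b f * G v f b) * t := by
      intro t
      simp only [Finset.mul_sum, Finset.sum_mul, ← Finset.sum_sub_distrib,
        ← Finset.sum_add_distrib]
      exact Finset.sum_congr rfl fun f _ => Finset.sum_congr rfl fun b _ => by ring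
    simp only [hrel _ _ v hv]
    rw [h3, h1, h2]
    simp only [hT]
    ring
  -- The combination `3 r_{da} + r_{ad}` eliminates the transpose and equals `8 Θ_{da} + 4 g_{da}
  -- T`; the second sum removes the trace, using `r`'s own trace `6 T`.
  have hfin : ∀ v ∈ U, (1 / 8) * (3 * r d a v + r a d v)
      + ∑ f, ∑ b, -(G v d a * (G v)⁻¹ b f / 12) * r f b v = Θ d a v := by
    intro v hv
    have h1 : ∑ f, ∑ b, -(G v d a * (G v)⁻¹ b f / 12) * r f b v
        = -(G v d a / 12) * ∑ f, ∑ b, (G v)⁻¹ b f * r f b v := by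
      simp only [Finset.mul_sum]
      exact Finset.sum_congr rfl fun f _ => Finset.sum_congr rfl fun b _ => by ring
    rw [h1, hTr v hv, hrel d a v hv, hrel a d v hv, hM.symm_apply hv a d]
    ring
  refine IsBigO.congr' ?_ (eventually_of_mem (hU.mem_nhds hu) hfin) EventuallyEq.rfl
  refine ((((hrO d a).const_mul_left 3).add (hrO a d)).const_mul_left _).add
    (IsBigO.fun_sum fun f _ => IsBigO.fun_sum fun b _ => isBigO_smooth_mul hU hu ?_ (hrO f b))
  exact (((hM.smooth d a).mul (hM.inv_smooth b f)).div_const 12).neg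

/-- Unique continuation for conformal Killing fields that annihilate the Weyl tensor. -/
theorem jet_eventually_eq_zero (hu : u ∈ U) (hk : ∀ v ∈ U, InKer (weyl G v) (dualVec G Y v))
    (h0 : jet G Y u = 0) : ∀ᶠ v in 𝓝 u, jet G Y v = 0 := by
  have hU := hY.metric.isOpen
  have hd : ∀ᶠ v in 𝓝 u, DifferentiableAt ℝ (jet G Y) v :=
    eventually_of_mem (hU.mem_nhds hu) fun v hv => differentiableAt_pi.2 fun i =>
      differentiableAt_of_contDiffOn hU (hY.jet_smooth i) hv
  refine eventually_eq_zero_of_fderiv_isBigO hd (fderiv_isBigO_of_pderiv hd fun a i => ?_) h0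
  rcases i with (b | p) | b
  · exact (hY.tame_dualVec hu b).pderiv_isBigO a
  · exact (hY.tame_vecD hu hk p.1 p.2).pderiv_isBigO a
  · exact hY.pderiv_thetaFun_isBigO hu hk a b

/-- A conformal Killing field that annihilates the Weyl tensor vanishes together with its
derivatives at its zeros where the Weyl tensor is nonzero. -/
theorem jet_eq_zero_of_weyl_ne (hu : u ∈ U) (hk : ∀ v ∈ U, InKer (weyl G v) (dualVec G Y v))
    (hC : weyl G u ≠ 0) (h0 : dualVec G Y u = 0) : jet G Y u = 0 := by
  have hU := hY.metric.isOpen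
  have hM := hY.metric
  have hCs := fun a b c d => differentiableAt_of_contDiffOn hU (hM.weyl_smooth a b c d) hu
  have hξ0 : ∀ d, dualVec G Y u d = 0 := fun d => congrFun h0 d
  have hξd := fun d => differentiableAt_of_contDiffOn hU (hY.dualVec_smooth d) hu
  have hp1 : ∀ e d, pderiv e (fun v => dualVec G Y v d) u = vecD G (dualVec G Y) u e d :=
    fun e d => by rw [pderiv_dualVec]; simp [hξ0]
  -- The once differentiated equation `C·ξ = 0`, kept on all of `U` so that it can be differentiated
  -- again. At `u` its first term drops, which leaves the rows of `∇ξ` in the kernel of `C`.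
  have hdk : ∀ v ∈ U, ∀ e a b c, ∑ d, (pderiv e (fun v => weyl G v a b c d) v * dualVec G Y v d
      + weyl G v a b c d * pderiv e (fun v => dualVec G Y v d) v) = 0 := by
    intro v hv e a b c
    have h1 := pderiv_congr (a := e) hU hv fun w hw => hk w hw a b c
    have hc := fun d => differentiableAt_of_contDiffOn hU (hM.weyl_smooth a b c d) hv
    have hx := fun d => differentiableAt_of_contDiffOn hU (hY.dualVec_smooth d) hv
    rw [pderiv_const, pderiv_sum fun d _ => (hc d).fun_mul (hx d)] at h1
    rw [← h1]
    exact Finset.sum_congr rfl fun d _ => (pderiv_mul (hc d) (hx d)).symm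
  have hK : vecD G (dualVec G Y) u = 0 := by
    refine (hY.isWeyl hu).eq_zero_of_inKer_rows (hY.lorentzian u hu) hC (fun e a b c => ?_)
      (hY.conformal u hu)
    have := hdk u hu e a b c
    simpa only [hξ0, mul_zero, zero_add, hp1] using this
  have hp0 : ∀ e d, pderiv e (fun v => dualVec G Y v d) u = 0 := fun e d => by rw [hp1, hK]; rfl
  have hpp : ∀ f e d, pderiv f (fun v => pderiv e (fun v => dualVec G Y v d) v) u
      = pderiv f (fun v => vecD G (dualVec G Y) v e d) u := by
    intro f e d
    have hΓ := fun c => differentiableAt_of_contDiffOn hU (hM.christoffel_smooth d e c).neg hu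
    have h1 : (fun v => pderiv e (fun v => dualVec G Y v d) v) = fun v =>
        vecD G (dualVec G Y) v e d + ∑ c, -christoffel G v d e c * dualVec G Y v c := by
      funext v; exact pderiv_dualVec e d
    rw [h1, pderiv_add (hY.vecD_smooth.diff hU hu e d)
      (DifferentiableAt.fun_sum fun c _ => (hΓ c).fun_mul (hξd c)),
      pderiv_sum fun c _ => (hΓ c).fun_mul (hξd c),
      Finset.sum_congr rfl fun c _ => pderiv_mul (hΓ c) (hξd c)]
    simp [hξ0, hp0]
  -- At `u` both `ξ` and its first derivatives vanish, so the twice differentiated equation reduces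
  -- to `C` contracted with `∂∂ξ`, and `∂∂ξ` involves only `θ`.
  have hθ : thetaFun G Y u = 0 := by
    refine IsWeyl.eq_zero_of_inKer_second (hM.symm u hu) (hM.det_ne u hu) hC fun a b c e f => ?_
    have h1 := pderiv_congr (a := f) hU hu fun w hw => hdk w hw e a b c
    have hc := fun d => differentiableAt_of_contDiffOn hU
      (pderiv_contDiffOn hU (hM.weyl_smooth a b c d) e) hu
    have hx := fun d => differentiableAt_of_contDiffOn hU
      (pderiv_contDiffOn hU (hY.dualVec_smooth d) e) hu
    rw [pderiv_const, pderiv_sum fun d _ => ((hc d).fun_mul (hξd d)).fun_add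
      ((hCs a b c d).fun_mul (hx d))] at h1
    have h2 : ∑ d, weyl G u a b c d * pderiv f (fun v => vecD G (dualVec G Y) v e d) u = 0 := by
      rw [← h1]
      refine Finset.sum_congr rfl fun d _ => ?_
      rw [pderiv_add ((hc d).fun_mul (hξd d)) ((hCs a b c d).fun_mul (hx d)),
        pderiv_mul (hc d) (hξd d), pderiv_mul (hCs a b c d) (hx d), hξ0, hp0, hp0, hpp]
      ring
    have hKz : ∀ a b, vecD G (dualVec G Y) u a b = 0 := fun a b => by rw [hK]; rfl
    have h3 : ∀ d, pderiv f (fun v => vecD G (dualVec G Y) v e d) u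
        = (if f = d then thetaFun G Y u e else 0)
          - G u e f * ((G u)⁻¹ *ᵥ thetaFun G Y u) d + if e = d then thetaFun G Y u f else 0 := by
      intro d
      have h4 : ∑ b, -(G u f e * (G u)⁻¹ b d) * thetaFun G Y u b
          = -(G u e f * ((G u)⁻¹ *ᵥ thetaFun G Y u) d) := by
        rw [Matrix.mulVec, dotProduct, Finset.mul_sum, ← Finset.sum_neg_distrib]
        refine Finset.sum_congr rfl fun b _ => ?_
        rw [hM.symm_apply hu e f, ← congrFun (congrFun (hM.inv_symm hu) d) b,
          Matrix.transpose_apply]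
        ring
      rw [hY.pderiv_vecD hu (hk u hu), h4]
      simp only [hKz, hξ0, mul_zero, Finset.sum_const_zero, zero_add]
      ring
    simp only [h3, mul_add, mul_sub, Finset.sum_add_distrib, Finset.sum_sub_distrib, mul_ite,
      mul_zero, Finset.sum_ite_eq, Finset.mem_univ, if_true] at h2
    rw [Finset.mul_sum]
    have h5 : ∑ d, weyl G u a b c d * (G u e f * ((G u)⁻¹ *ᵥ thetaFun G Y u) d)
        = ∑ d, G u e f * (weyl G u a b c d * ((G u)⁻¹ *ᵥ thetaFun G Y u) d) :=
      Finset.sum_congr rfl fun d _ => by ring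
    linarith
  exact jet_eq_zero_iff.2 ⟨h0, hK, hθ⟩

-- Vanishing near a point is stronger than vanishing of the jet there. Together with unique
-- continuation it makes the set where `Y` vanishes locally the zero set of a continuous function,
-- when `ξ` annihilates `C`.
omit hY in
theorem jet_eq_zero_of_eventually (h : ∀ᶠ v in 𝓝 u, dualVec G Y v = 0) : jet G Y u = 0 := by
  have h1 : ∀ᶠ v in 𝓝 u, vecD G (dualVec G Y) v = 0 := by
    filter_upwards [h.eventually_nhds] with v hv
    ext a b
    have h2 : (fun v => dualVec G Y v b) =ᶠ[𝓝 v] fun _ => 0 := hv.mono fun w hw => congrFun hw b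
    have h3 : pderiv a (fun v => dualVec G Y v b) v = 0 := by
      rw [pderiv, h2.fderiv_eq]; simp
    simp [vecD, h3, hv.self_of_nhds]
  have h2 : divFun G Y =ᶠ[𝓝 u] fun _ => 0 := h1.mono fun v hv => by simp [divFun, hv]
  refine jet_eq_zero_iff.2 ⟨h.self_of_nhds, h1.self_of_nhds, ?_⟩
  funext a
  simp [thetaFun, h.self_of_nhds, pderiv, h2.fderiv_eq]

end EinsteinCKYOn

end Jet

/-! ### From charts to the manifold, and the equivalence. -/

section Glue

open Filter Topology Matrix

section CoordBasis

variable {n : ℕ} {M : Type*} [TopologicalSpace M] [ChartedSpace (Coord n) M]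

/-- The coordinate vectors of a chart form a basis of the tangent space. -/
theorem exists_coordBasis {e : OpenPartialHomeomorph M (Coord n)}
    (he : e ∈ IsManifold.maximalAtlas (𝓡 n) ∞ M) {u : Coord n} (hu : u ∈ e.target) :
    ∃ b : Module.Basis (Fin n) ℝ (TangentSpace (𝓡 n) (e.symm u)), ∀ i, b i = coordVec e u i := by
  have hd : e.MDifferentiable (𝓡 n) (𝓡 n) :=
    ⟨(contMDiffOn_of_mem_maximalAtlas he).mdifferentiableOn (by simp),
      (contMDiffOn_symm_of_mem_maximalAtlas he).mdifferentiableOn (by simp)⟩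
  have hb : Function.Bijective (mfderiv (𝓡 n) (𝓡 n) e.symm u) := hd.symm.mfderiv_bijective hu
  let L : Coord n ≃ₗ[ℝ] TangentSpace (𝓡 n) (e.symm u) :=
    LinearEquiv.ofBijective (mfderiv (𝓡 n) (𝓡 n) e.symm u).toLinearMap hb
  refine ⟨(EuclideanSpace.basisFun (Fin n) ℝ).toBasis.map L, fun i => ?_⟩
  rw [Module.Basis.map_apply, OrthonormalBasis.coe_toBasis, EuclideanSpace.basisFun_apply]
  rfl

theorem FormField.comp_isSkew {p : ℕ} (Y : FormField n p M)
    (e : OpenPartialHomeomorph M (Coord n)) (u : Coord n) : IsSkew (Y.comp e u) := by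
  intro σ I
  have := (Y (e.symm u)).toAlternatingMap.map_perm (fun k => coordVec e u (I k)) σ
  rw [Units.smul_def, zsmul_eq_mul] at this
  exact this

theorem FormField.eq_zero_of_comp {p : ℕ} (Y : FormField n p M)
    {e : OpenPartialHomeomorph M (Coord n)} (he : e ∈ IsManifold.maximalAtlas (𝓡 n) ∞ M)
    {u : Coord n} (hu : u ∈ e.target) (h : Y.comp e u = 0) : Y (e.symm u) = 0 := by
  obtain ⟨b, hb⟩ := exists_coordBasis he hu
  refine ContinuousAlternatingMap.toAlternatingMap_injective ?_
  refine Module.Basis.ext_alternating b fun v _ => ?_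
  simp only [hb]
  exact congrFun h v

end CoordBasis

variable {M : Type*} [TopologicalSpace M] [ChartedSpace (Coord 4) M] [IsManifold (𝓡 4) ∞ M]
  (g : LorentzianMetric 4 M)

theorem LorentzianMetric.isLorentzian_mat {e : OpenPartialHomeomorph M (Coord 4)}
    (he : e ∈ IsManifold.maximalAtlas (𝓡 4) ∞ M) {u : Coord 4} (hu : u ∈ e.target) :
    IsLorentzian (g.mat e u) := by
  obtain ⟨c, hc⟩ := exists_coordBasis he hu
  obtain ⟨b, hb⟩ := g.lorentzian (e.symm u)
  refine ⟨Matrix.of fun i j => c.repr (b j) i, ?_⟩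
  have hbj : ∀ j, b j = ∑ i, c.repr (b j) i • coordVec e u i := fun j => by
    conv_lhs => rw [← c.sum_repr (b j)]
    simp only [hc]
  ext i j
  have h1 := hb i j
  rw [hbj i, hbj j] at h1
  simp only [map_sum, map_smul, _root_.sum_apply, _root_.smul_apply,
    smul_eq_mul] at h1
  have h2 : minkowski i j = if i = j then (if (i : ℕ) = 0 then -1 else 1) else 0 := by
    fin_cases i <;> fin_cases j <;> simp [minkowski]
  rw [h2, ← h1]
  simp only [Matrix.mul_apply, Matrix.transpose_apply, Matrix.of_apply, mat, Finset.sum_mul,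
    Finset.mul_sum]
  exact Finset.sum_congr rfl fun k _ => Finset.sum_congr rfl fun l _ => by ring

variable {g} {Y : FormField 4 3 M}

theorem einsteinCKYOn_chart (hE : g.IsEinstein) (hYs : Y.IsSmooth)
    (hY : g.IsConformalKillingYano (q := 2) Y.comp) {e : OpenPartialHomeomorph M (Coord 4)}
    (he : e ∈ IsManifold.maximalAtlas (𝓡 4) ∞ M) :
    EinsteinCKYOn (g.mat e) (Y.comp e) e.target where
  metric :=
    { isOpen := e.open_target
      smooth := fun i j => g.smooth e he i j
      symm := fun _ hu => (g.isLorentzian_mat he hu).symm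
      det_ne := fun _ hu => (g.isLorentzian_mat he hu).det_neg.ne }
  lorentzian := fun _ hu => g.isLorentzian_mat he hu
  einstein := by
    obtain ⟨Λ, hΛ⟩ := hE
    exact fun u hu => ⟨Λ (e.symm u), hΛ e he u hu⟩
  skew := fun u _ => Y.comp_isSkew e u
  smooth := hYs e he
  cky := by
    obtain ⟨h, hh⟩ := hY
    exact fun u hu => ⟨h e u, (hh e he u hu).2⟩

/-- Duality is injective at each point. This exchanges the chart-dependent `ξ`, whose sign depends
on orientation, for the globally defined `Y`. -/
theorem dualVec_comp_eq_zero_iff (hE : g.IsEinstein) (hYs : Y.IsSmooth)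
    (hY : g.IsConformalKillingYano (q := 2) Y.comp) {e : OpenPartialHomeomorph M (Coord 4)}
    (he : e ∈ IsManifold.maximalAtlas (𝓡 4) ∞ M) {u : Coord 4} (hu : u ∈ e.target) :
    dualVec (g.mat e) (Y.comp e) u = 0 ↔ Y (e.symm u) = 0 := by
  have hL := (einsteinCKYOn_chart hE hYs hY he).det_neg u hu
  constructor
  · intro h
    refine Y.eq_zero_of_comp he hu ?_
    obtain ⟨y3, y2, y1, y0⟩ := form_eq_dualVec hL (Y.comp_isSkew e u)
    simp only [h, Pi.zero_apply, mul_zero, neg_zero] at y0 y1 y2 y3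
    have hs := Y.comp_isSkew e u
    obtain ⟨hz, ⟨a1, a2, a3, a4, a5⟩, ⟨b1, b2, b3, b4, b5⟩, ⟨c1, c2, c3, c4, c5⟩,
      d1, d2, d3, d4, d5⟩ := skew_three_table (T := fun a b c => Y.comp e u ![a, b, c])
        hs.swap_left hs.swap_right
    have key : ∀ a b c, Y.comp e u ![a, b, c] = 0 := by
      intro a b c
      fin_cases a <;> fin_cases b <;> fin_cases c <;>
        simp only [Fin.zero_eta, Fin.mk_one, Fin.reduceFinMk, hz, y0, y1, y2, y3, a1, a2, a3, a4, a5, b1, b2, b3, b4, b5, c1, c2, c3, c4, c5, d1, d2, d3, d4, d5, neg_zero]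
    funext I
    have hI : I = ![I 0, I 1, I 2] := by funext i; fin_cases i <;> rfl
    rw [hI]; exact key _ _ _
  · intro h
    have h0 : Y.comp e u = 0 := by
      funext I; simp only [FormField.comp, h]; rfl
    funext b
    simp [dualVec, hodgeDual, h0]

/-- A conformal Killing–Yano form vanishes near a point if and only if its prolongation
vanishes there. -/
theorem eventually_eq_zero_iff_jet (hE : g.IsEinstein) (hYs : Y.IsSmooth)
    (hY : g.IsConformalKillingYano (q := 2) Y.comp) {e : OpenPartialHomeomorph M (Coord 4)}
    (he : e ∈ IsManifold.maximalAtlas (𝓡 4) ∞ M) {u : Coord 4} (hu : u ∈ e.target)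
    (hk : ∀ v ∈ e.target, InKer (weyl (g.mat e) v) (dualVec (g.mat e) (Y.comp e) v)) :
    (∀ᶠ q in 𝓝 (e.symm u), Y q = 0) ↔ jet (g.mat e) (Y.comp e) u = 0 := by
  have hloc := einsteinCKYOn_chart hE hYs hY he
  have hu' : e.symm u ∈ e.source := e.map_target hu
  constructor
  · intro h
    refine EinsteinCKYOn.jet_eq_zero_of_eventually ?_
    have h1 : Tendsto e.symm (𝓝 u) (𝓝 (e.symm u)) := e.continuousAt_symm hu
    filter_upwards [h1.eventually h, e.open_target.mem_nhds hu] with v hv hvt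
    exact (dualVec_comp_eq_zero_iff hE hYs hY he hvt).2 hv
  · intro h
    have h1 : Tendsto e (𝓝 (e.symm u)) (𝓝 u) := by
      have := e.continuousAt hu'
      rwa [ContinuousAt, e.right_inv hu] at this
    filter_upwards [h1.eventually (hloc.jet_eventually_eq_zero hu hk h),
      e.open_source.mem_nhds hu'] with q hq hqs
    have := (dualVec_comp_eq_zero_iff hE hYs hY he (e.map_source hqs)).1 (jet_eq_zero_iff.1 hq).1
    rwa [e.left_inv hqs] at this

/-- A conformal Killing–Yano 3-form whose dual vector annihilates the Weyl tensor vanishes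
identically if it vanishes near a point. -/
theorem eq_zero_of_eventually_eq_zero [ConnectedSpace M] (hE : g.IsEinstein) (hYs : Y.IsSmooth)
    (hY : g.IsConformalKillingYano (q := 2) Y.comp)
    (hk : ∀ e ∈ IsManifold.maximalAtlas (𝓡 4) ∞ M, ∀ v ∈ e.target,
      InKer (weyl (g.mat e) v) (dualVec (g.mat e) (Y.comp e) v))
    {p : M} (hp : ∀ᶠ q in 𝓝 p, Y q = 0) : Y = 0 := by
  set Z : Set M := {p | ∀ᶠ q in 𝓝 p, Y q = 0} with hZ
  have hopen : IsOpen Z := isOpen_iff_mem_nhds.2 fun p hp => hp.eventually_nhds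
  -- At a limit point of `Z` the jet in a chart vanishes by continuity, and unique continuation puts
  -- the point back in `Z`.
  have hclosed : IsClosed Z := by
    refine isClosed_of_closure_subset fun p hp => ?_
    set e := chartAt (Coord 4) p with he'
    have he : e ∈ IsManifold.maximalAtlas (𝓡 4) ∞ M := IsManifold.chart_mem_maximalAtlas p
    have hps : p ∈ e.source := mem_chart_source _ p
    have hloc := einsteinCKYOn_chart hE hYs hY he
    have hu : e p ∈ e.target := e.map_source hps
    have hcont : ContinuousAt (fun q => jet (g.mat e) (Y.comp e) (e q)) p := by
      refine ContinuousAt.comp (f := e) (g := jet (g.mat e) (Y.comp e)) ?_ (e.continuousAt hps)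
      exact continuousAt_pi.2 fun i =>
        (hloc.jet_smooth i).continuousOn.continuousAt (e.open_target.mem_nhds hu)
    have hfreq : ∃ᶠ q in 𝓝 p, jet (g.mat e) (Y.comp e) (e q) = 0 := by
      refine ((mem_closure_iff_frequently.1 hp).and_eventually
        (e.open_source.mem_nhds hps)).mono fun q hq => ?_
      rw [← eventually_eq_zero_iff_jet hE hYs hY he (e.map_source hq.2) (hk e he),
        e.left_inv hq.2]
      exact hq.1
    have h0 : jet (g.mat e) (Y.comp e) (e p) = 0 := by
      by_contra hne
      exact hfreq ((hcont.eventually_ne hne).mono fun q hq => hq)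
    rw [← eventually_eq_zero_iff_jet hE hYs hY he hu (hk e he), e.left_inv hps] at h0
    exact h0
  have huniv : Z = Set.univ := IsClopen.eq_univ ⟨hclosed, hopen⟩ ⟨p, hp⟩
  funext q
  have : q ∈ Z := by rw [huniv]; trivial
  exact this.self_of_nhds

theorem divergence_comp_zero (e : OpenPartialHomeomorph M (Coord 4)) (u : Coord 4) :
    g.divergence (q := 2) (FormField.comp (0 : FormField 4 3 M)) e u = 0 := by
  have h0 : FormField.comp (0 : FormField 4 3 M) = 0 := rfl
  have h1 : ∀ (a : Fin 4) I, covDeriv (g.mat e) ((0 : Components 4 3 M) e) u a I = 0 := by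
    intro a I
    have : pderiv a (fun v => (0 : Components 4 3 M) e v I) u = 0 := pderiv_const 0
    simp only [covDeriv, this]
    simp
  funext B
  rw [h0]
  simp only [LorentzianMetric.divergence, localDivergence]
  exact Finset.sum_eq_zero fun a _ => Finset.sum_eq_zero fun c _ => by rw [h1, mul_zero]

/-- The divergence of a conformal Killing–Yano 3-form is Killing–Yano if and only if the Weyl
tensor is of type N along the dual vector, wherever it does not vanish. -/
theorem killingYano_iff_typeN [ConnectedSpace M] (hEinstein : g.IsEinstein)
    (hYsmooth : Y.IsSmooth)
    (hY : g.IsConformalKillingYano (q := 2) Y.comp)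
    (hdiv : ∃ e ∈ IsManifold.maximalAtlas (𝓡 4) ∞ M, ∃ u ∈ e.target,
      g.divergence (q := 2) Y.comp e u ≠ 0) :
    g.IsKillingYano (q := 1) (g.divergence (q := 2) Y.comp) ↔
      ∀ e ∈ IsManifold.maximalAtlas (𝓡 4) ∞ M, ∀ u ∈ e.target,
        weyl (g.mat e) u ≠ 0 →
          IsPetrovTypeN (g.mat e u) (weyl (g.mat e) u) ∧
          IsRepeatedPND (g.mat e u) (weyl (g.mat e) u)
            (hodgeDual (g.mat e u) (Y.comp e u)) := by
  have hloc := fun e (he : e ∈ IsManifold.maximalAtlas (𝓡 4) ∞ M) =>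
    einsteinCKYOn_chart hEinstein hYsmooth hY he
  constructor
  · intro hA e he u hu hC
    have hk : ∀ e ∈ IsManifold.maximalAtlas (𝓡 4) ∞ M, ∀ v ∈ e.target,
        InKer (weyl (g.mat e) v) (dualVec (g.mat e) (Y.comp e) v) := fun e he v hv =>
      ((hloc e he).divergence_killingYano_iff hv).1 fun a b c => (hA e he v hv).2 a b ![c]
    -- A zero of `ξ` where `C ≠ 0` would propagate to `Y = 0` on the connected manifold, against the
    -- nonzero divergence.
    have hξ : dualVec (g.mat e) (Y.comp e) u ≠ 0 := by
      intro h0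
      have hj := (hloc e he).jet_eq_zero_of_weyl_ne hu (hk e he) hC h0
      rw [← eventually_eq_zero_iff_jet hEinstein hYsmooth hY he hu (hk e he)] at hj
      have hYz := eq_zero_of_eventually_eq_zero hEinstein hYsmooth hY hk hj
      obtain ⟨e', -, u', -, hne⟩ := hdiv
      exact hne (by rw [hYz]; exact divergence_comp_zero e' u')
    exact ((hloc e he).isWeyl hu).typeN_of_inKer ((hloc e he).lorentzian u hu) (hk e he u hu) hC hξ
  · intro h e he u hu
    have hl := hloc e he
    refine ⟨isSkew_two (hl.divergence_components hu rfl).1, fun a b B => ?_⟩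
    have hB : ∀ b : Fin 4, (Fin.cons b B : Fin 2 → Fin 4) = ![b, B 0] := fun b => by
      funext i; fin_cases i <;> rfl
    rw [hB, hB]
    refine (hl.divergence_killingYano_iff hu).2 ?_ a b (B 0)
    -- Where the Weyl tensor vanishes the kernel condition is vacuous, so no information on `ξ` is
    -- needed there.
    by_cases hC : weyl (g.mat e) u = 0
    · intro a b c; simp [hC]
    · obtain ⟨hN, hP⟩ := h e he u hu hC
      exact (hl.isWeyl hu).inKer_of_typeN (hl.lorentzian u hu) hN hP

end Glue

end CKY

end

theorem mainTheorem9 {M : Type*} [TopologicalSpace M] [ChartedSpace (CKY.Coord 4) M]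
    [IsManifold (𝓡 4) ∞ M] [ConnectedSpace M]
    (g : CKY.LorentzianMetric 4 M) (hEinstein : g.IsEinstein)
    (hWeyl : ∃ e ∈ IsManifold.maximalAtlas (𝓡 4) ∞ M, ∃ u ∈ e.target,
      CKY.weyl (g.mat e) u ≠ 0)
    (Y : CKY.FormField 4 3 M) (hYsmooth : Y.IsSmooth)
    (hY : g.IsConformalKillingYano (q := 2) Y.comp)
    (hdiv : ∃ e ∈ IsManifold.maximalAtlas (𝓡 4) ∞ M, ∃ u ∈ e.target,
      g.divergence (q := 2) Y.comp e u ≠ 0) :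
    g.IsKillingYano (q := 1) (g.divergence (q := 2) Y.comp) ↔
      ∀ e ∈ IsManifold.maximalAtlas (𝓡 4) ∞ M, ∀ u ∈ e.target,
        CKY.weyl (g.mat e) u ≠ 0 →
          CKY.IsPetrovTypeN (g.mat e u) (CKY.weyl (g.mat e) u) ∧
          CKY.IsRepeatedPND (g.mat e u) (CKY.weyl (g.mat e) u)
            (CKY.hodgeDual (g.mat e u) (Y.comp e u)) :=
  CKY.killingYano_iff_typeN hEinstein hYsmooth hY hdiv
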